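/- Let $X=L^2(-1,1)\times W^{1,2}_0(-1,1)\times W^{1,2}_0(-1,1)$ and, for $(S,T,U)\in X$ (with $'$ the weak derivative), let $$I[S,T,U]=\tfrac12\int_{-1}^1\big[U'^2(1-x^2)-2xU'+(S^2+T'^2)e^{-2U}\big]dx+\tfrac12M_2^2,\qquad M_2=\max\Big\{0,\frac{\sqrt{M_1}-2|c_2|}{c_1}\Big\},\quad M_1=\max\{0,4-c_3^4\},$$ $$c_1=\Big(\int_{-1}^1e^{4U}(1-x^2)\,dx\Big)^{1/2},\qquad c_2=\int_{-1}^1ST\,dx,\qquad c_3=\tfrac1{\sqrt2}\int_{-1}^1S\,dx .$$ For $\gamma\in[-1,0]$ and signs $\sigma_S,\sigma_T\in\{1,-1\}$ (chosen independently) let $\mathcal F_{\gamma,\sigma_S,\sigma_T}$ denote the triple given by $$e^{2U}=\frac{2}{(1+\gamma)x^2+1-\gamma},\quad T=\sigma_T\sqrt{-\gamma(1-\gamma^2)}\,\frac{1-x^2}{1-\gamma+(1+\gamma)x^2},\quad S=\sigma_S\Big[(-\gamma)^{3/2}+\sqrt{1-\gamma^2}\,|T|\Big]e^{2U}.$$ 1.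 The minimum of $I$ on $X$ is attained and equals $1$. 2. For real functions $S,T,U$ (up to equality almost everywhere on $(-1,1)$): $(S,T,U)\in X$ and $I[S,T,U]=1$ if and only if $(S,T,U)=\mathcal F_{\gamma,\sigma_S,\sigma_T}$ for some $\gamma\in[-1,0]$ and some signs. 3. At $(S,T,U)=\mathcal F_{\gamma,\sigma_S,\sigma_T}$, real numbers $\lambda_1,\lambda_2,\lambda_3$ are Lagrange multipliers, i.e. all directional derivatives along $X$ of $$\tfrac12\int_{-1}^1\big[U'^2(1-x^2)-2xU'+(S^2+T'^2)e^{-2U}\big]dx+\lambda_1c_1^2+\lambda_2c_2+\sqrt2\,\lambda_3c_3$$ vanish there, if and only if $$\lambda_1=-\tfrac18(1-\gamma^2),\qquad \lambda_2=-\sigma_S\sigma_T\sqrt{1-\gamma^2},\qquad \lambda_3=-\sigma_S(-\gamma)^{3/2},$$ except that for $\gamma=0$ (where $S=T=0$) the condition on $\lambda_2$ is void. 4. Functions $S,T,U:[-1,1]\to\mathbb R$ are smooth, satisfy $T(\pm1)=U(\pm1)=0$ and solve on $(-1,1)$ the Euler-Lagrange equations $$0=-U''(1-x^2)+2xU'+1-(S^2+T'^2)e^{-2U}+4\lambda_1(1-x^2)e^{4U},$$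 $$0=-T''+2U'T'+\lambda_2Se^{2U},\qquad 0=S+(\lambda_2T+\lambda_3)e^{2U}$$ for some real $\lambda_1,\lambda_2,\lambda_3$ with $\lambda_1=-\frac18\lambda_2^2$ (the horizon equations of degenerate black holes), if and only if $(S,T,U)=\mathcal F_{\gamma,\sigma_S,\sigma_T}$ on $[-1,1]$ for some $\gamma\in[-1,0]$ and some signs. 5. Consider, in an electrovacuum vicinity $0\le R<R_0$ of a horizon at $R=0$ (degenerate: surface gravity $0$), the axisymmetric stationary line element $$ds^2=\hat\mu\Big(\frac{dR^2}{R^2}+d\theta^2\Big)+\hat u\sin^2\theta\,(d\varphi-\omega\,dt)^2-\frac4{\hat u}R^2dt^2$$ and an electromagnetic potential $(0,0,A_\varphi,A_t)$, $\Phi=A_t+\omega A_\varphi$, where $\hat\mu,\hat u>0$, $\omega,\Phi,A_\varphi$ are smooth functions of $(R,x)\in[0,R_0)\times[-1,1]$, $x=\cos\theta$. Put $\hat u_N=\hat u(0,\theta=0)$, $\tilde u=\frac12\ln(\hat u/\hat u_N)$, $\tilde\mu=\frac12\ln(\hat\mu/\hat u_N)$, $E_R=\Phi_{,R}-A_\varphi\omega_{,R}$,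 $E_\theta=\Phi_{,\theta}-A_\varphi\omega_{,\theta}$. A degenerate black hole is such a collection of fields satisfying, for $0<R<R_0$, $0<\theta<\pi$, the Einstein-Maxwell equations $$R^2\tilde u_{,RR}+2R\tilde u_{,R}+\tilde u_{,\theta\theta}+\cot\theta\,\tilde u_{,\theta}=1-\frac{\hat u^2}8\sin^2\theta\Big(\omega_{,R}^2+\frac{\omega_{,\theta}^2}{R^2}\Big)-\frac{R^2A_{\varphi,R}^2+A_{\varphi,\theta}^2}{\hat u\sin^2\theta}-\frac{\hat u}4\Big(E_R^2+\frac{E_\theta^2}{R^2}\Big),$$ $$R^2\tilde\mu_{,RR}+R\tilde\mu_{,R}+\tilde\mu_{,\theta\theta}=\frac{\hat u^2}{16}\sin^2\theta\Big(\omega_{,R}^2+\frac{\omega_{,\theta}^2}{R^2}\Big)-R^2\tilde u_{,R}^2+R\tilde u_{,R}-\tilde u_{,\theta}(\tilde u_{,\theta}+\cot\theta),$$ $$R^2(\omega_{,RR}+4\omega_{,R}\tilde u_{,R})+\omega_{,\theta\theta}+\omega_{,\theta}(3\cot\theta+4\tilde u_{,\theta})=\frac{4}{\hat u\sin^2\theta}\big(R^2A_{\varphi,R}E_R+A_{\varphi,\theta}E_\theta\big),$$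 $$R^2\big[\Phi_{,RR}-A_\varphi\omega_{,RR}+2\tilde u_{,R}E_R-A_{\varphi,R}\omega_{,R}\big]+\Phi_{,\theta\theta}-A_\varphi\omega_{,\theta\theta}+(2\tilde u_{,\theta}+\cot\theta)E_\theta-A_{\varphi,\theta}\omega_{,\theta}=0,$$ $$R^2\big[A_{\varphi,RR}-2\tilde u_{,R}A_{\varphi,R}\big]+2RA_{\varphi,R}+A_{\varphi,\theta\theta}-(2\tilde u_{,\theta}+\cot\theta)A_{\varphi,\theta}=\frac{\hat u^2}4\sin^2\theta\Big(E_R\,\omega_{,R}+\frac{E_\theta\,\omega_{,\theta}}{R^2}\Big),$$ together with the conditions that $\omega$, $\Phi$ and $\hat\mu\hat u$ are constant on the horizon $R=0$, $\hat\mu=\hat u$ at its two poles, and $A_\varphi=0$ at $\theta=0,\pi$. Its horizon potentials are the functions on $[-1,1]$ $$U=\tfrac12\ln\frac{\hat u}{\hat u_N}\Big|_{R=0},\qquad S=\frac{\hat u}{2\sqrt{\hat u_N}}(\Phi_{,R}-A_\varphi\omega_{,R})\Big|_{R=0},\qquad T=\frac{A_\varphi}{\sqrt{\hat u_N}}\Big|_{R=0}.$$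 Then $(S,T,U)$ are the horizon potentials of some degenerate black hole if and only if $(S,T,U)=\mathcal F_{\gamma,\sigma_S,\sigma_T}$ on $[-1,1]$ for some $\gamma\in[-1,0]$ and some signs. In particular, with neither equatorial symmetry nor a continuous sequence of spacetimes from the Kerr-Newman solution being assumed, the horizon potentials of every degenerate black hole satisfy $S(-x)=S(x)$, $T(-x)=T(x)$, $U(-x)=U(x)$. -/

import Mathlib

open scoped ContDiff ENNReal

noncomputable section

namespace DegenerateHorizon

open MeasureTheory Set

/-! ### The spaces `L²(-1,1)`, `W₀^{1,2}(-1,1)` and `X = L² × W₀^{1,2} × W₀^{1,2}` -/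

/-- Lebesgue measure on the interval `(-1,1)`. -/
def mu : Measure ℝ := volume.restrict (Ioo (-1) 1)

/-- Test functions: smooth functions with compact support in `(-1,1)`. -/
structure IsTest (φ : ℝ → ℝ) : Prop where
  smooth : ContDiff ℝ ∞ φ
  compact : HasCompactSupport φ
  supp : tsupport φ ⊆ Ioo (-1) 1

/-- `g` is a weak derivative of `u` on `(-1,1)`. -/
structure HasWeakDeriv (u g : ℝ → ℝ) : Prop where
  locInt : LocallyIntegrableOn u (Ioo (-1) 1)
  locInt' : LocallyIntegrableOn g (Ioo (-1) 1)
  parts : ∀ φ : ℝ → ℝ, IsTest φ →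
    ∫ x in Ioo (-1) 1, u x * deriv φ x = - ∫ x in Ioo (-1) 1, g x * φ x

open Classical in
/-- A choice of the (almost everywhere unique) weak derivative; `0` if there is none. -/
def weakDeriv (u : ℝ → ℝ) : ℝ → ℝ :=
  if h : ∃ g, HasWeakDeriv u g then h.choose else 0

/-- (Representatives of) elements of `L²(-1,1)`. -/
def MemL2 (u : ℝ → ℝ) : Prop := MemLp u 2 mu

/-- (Representatives of) elements of the Sobolev space `W^{1,2}(-1,1)`. -/
structure MemW12 (u : ℝ → ℝ) : Prop where
  memL2 : MemL2 u
  exists_deriv : ∃ g, HasWeakDeriv u g ∧ MemL2 g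

/-- (Representatives of) elements of `W₀^{1,2}(-1,1)`, the closure of the test functions in
`W^{1,2}(-1,1)`. -/
structure MemW012 (u : ℝ → ℝ) : Prop where
  memW12 : MemW12 u
  approx : ∀ ε : ℝ≥0∞, 0 < ε → ∃ φ : ℝ → ℝ, IsTest φ ∧
    eLpNorm (fun x => u x - φ x) 2 mu + eLpNorm (fun x => weakDeriv u x - deriv φ x) 2 mu < ε

/-- Membership of `(S,T,U)` in `X = L² × W₀^{1,2} × W₀^{1,2}`. -/
structure MemX (S T U : ℝ → ℝ) : Prop where
  memS : MemL2 S
  memT : MemW012 T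
  memU : MemW012 U

/-! ### The functional `I` -/

/-- The part of `I` without `M₂`. -/
def energy (S T U : ℝ → ℝ) : ℝ :=
  (1 / 2) * ∫ x in (-1)..1, ((weakDeriv U x) ^ 2 * (1 - x ^ 2) - 2 * x * weakDeriv U x
    + ((S x) ^ 2 + (weakDeriv T x) ^ 2) * Real.exp (-2 * U x))

def c₁ (U : ℝ → ℝ) : ℝ := Real.sqrt (∫ x in (-1)..1, Real.exp (4 * U x) * (1 - x ^ 2))

def c₂ (S T : ℝ → ℝ) : ℝ := ∫ x in (-1)..1, S x * T x

def c₃ (S : ℝ → ℝ) : ℝ := (1 / Real.sqrt 2) * ∫ x in (-1)..1, S x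

def M₁ (S : ℝ → ℝ) : ℝ := max 0 (4 - c₃ S ^ 4)

def M₂ (S T U : ℝ → ℝ) : ℝ := max 0 ((Real.sqrt (M₁ S) - 2 * |c₂ S T|) / c₁ U)

/-- The functional `I[S,T,U]`. -/
def functionalI (S T U : ℝ → ℝ) : ℝ := energy S T U + M₂ S T U ^ 2 / 2

/-! ### Lagrange multipliers -/

/-- The Lagrangian of `energy` under the constraints that `c₁`, `c₂`, `c₃` are constant
(up to an additive constant that depends on the multipliers only). -/
def lagrangian (l₁ l₂ l₃ : ℝ) (S T U : ℝ → ℝ) : ℝ :=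
  energy S T U + l₁ * c₁ U ^ 2 + l₂ * c₂ S T + Real.sqrt 2 * l₃ * c₃ S

/-- `l₁, l₂, l₃` are Lagrange multipliers at `(S,T,U)`: the Lagrangian is stationary there in
every direction of `X`. -/
def IsLagrangeMultiplier (l₁ l₂ l₃ : ℝ) (S T U : ℝ → ℝ) : Prop :=
  ∀ ρ φ ψ : ℝ → ℝ, MemX ρ φ ψ →
    HasDerivAt (fun t : ℝ => lagrangian l₁ l₂ l₃ (fun x => S x + t * ρ x)
      (fun x => T x + t * φ x) (fun x => U x + t * ψ x)) 0 0

/-- Smooth solutions on `[-1,1]` of the Euler-Lagrange equations (in their classical form) with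
multipliers `l₁, l₂, l₃`. -/
structure IsSmoothELSolution (l₁ l₂ l₃ : ℝ) (S T U : ℝ → ℝ) : Prop where
  smoothS : ContDiffOn ℝ ∞ S (Icc (-1) 1)
  smoothT : ContDiffOn ℝ ∞ T (Icc (-1) 1)
  smoothU : ContDiffOn ℝ ∞ U (Icc (-1) 1)
  T_neg : T (-1) = 0
  T_pos : T 1 = 0
  U_neg : U (-1) = 0
  U_pos : U 1 = 0
  eqU : ∀ x ∈ Ioo (-1 : ℝ) 1,
    0 = -deriv (deriv U) x * (1 - x ^ 2) + 2 * x * deriv U x + 1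
      - ((S x) ^ 2 + (deriv T x) ^ 2) * Real.exp (-2 * U x)
      + 4 * l₁ * (1 - x ^ 2) * Real.exp (4 * U x)
  eqT : ∀ x ∈ Ioo (-1 : ℝ) 1,
    0 = -deriv (deriv T) x + 2 * deriv U x * deriv T x + l₂ * S x * Real.exp (2 * U x)
  eqS : ∀ x ∈ Ioo (-1 : ℝ) 1,
    0 = S x + (l₂ * T x + l₃) * Real.exp (2 * U x)

/-! ### The explicit family -/

/-- The values `s, t, u` of `S, T, U` at the point `x`, for the parameter `γ` and the signs
`σS, σT` of `S` and `T`. -/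
structure FamilyAt (γ σS σT x s t u : ℝ) : Prop where
  eqU : Real.exp (2 * u) = 2 / ((1 + γ) * x ^ 2 + 1 - γ)
  eqT : t = σT * Real.sqrt (-γ * (1 - γ ^ 2)) * ((1 - x ^ 2) / (1 - γ + (1 + γ) * x ^ 2))
  eqS : s = σS * ((-γ) ^ (3 / 2 : ℝ) + Real.sqrt (1 - γ ^ 2) * |t|) * Real.exp (2 * u)

/-- `(S,T,U)` belongs to the family, as an element of a function space. -/
def InFamilyAE (γ σS σT : ℝ) (S T U : ℝ → ℝ) : Prop :=
  ∀ᵐ x ∂mu, FamilyAt γ σS σT x (S x) (T x) (U x)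

/-- `(S,T,U)` belongs to the family, as functions on `[-1,1]`. -/
def InFamilyOn (γ σS σT : ℝ) (S T U : ℝ → ℝ) : Prop :=
  ∀ x ∈ Icc (-1 : ℝ) 1, FamilyAt γ σS σT x (S x) (T x) (U x)

/-! ### Degenerate black holes -/

/-- Metric and electromagnetic potentials in an electrovacuum vicinity `0 ≤ R < R₀` of a horizon
located at `R = 0`, as functions of `R` and `x = cos θ`. The line element is
`ds² = μ̂ (dR²/R² + dθ²) + û sin²θ (dφ - ω dt)² - (4/û) R² dt²`; `A` is the component `A_φ` of the
electromagnetic potential and `Φ = A_t + ω A_φ` the comoving electric potential. -/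
structure HorizonFields where
  R₀ : ℝ
  muHat : ℝ → ℝ → ℝ
  uHat : ℝ → ℝ → ℝ
  omega : ℝ → ℝ → ℝ
  Phi : ℝ → ℝ → ℝ
  A : ℝ → ℝ → ℝ

/-- A function of `(R, x)` as a function of `(R, θ)`. -/
def polar (f : ℝ → ℝ → ℝ) : ℝ → ℝ → ℝ := fun R θ => f R (Real.cos θ)

/-- `∂/∂R` for functions of `(R, θ)`. -/
def dR (f : ℝ → ℝ → ℝ) : ℝ → ℝ → ℝ := fun R θ => deriv (fun r => f r θ) R

/-- `∂/∂θ` for functions of `(R, θ)`. -/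
def dTheta (f : ℝ → ℝ → ℝ) : ℝ → ℝ → ℝ := fun R θ => deriv (fun t => f R t) θ

namespace HorizonFields

variable (F : HorizonFields)

/-- The value of `û` at the north pole of the horizon. -/
def uN : ℝ := F.uHat 0 1

/-- `ũ = ½ ln (û / û_N)`. -/
def uTilde : ℝ → ℝ → ℝ := fun R θ => (1 / 2) * Real.log (polar F.uHat R θ / F.uN)

/-- `μ̃ = ½ ln (μ̂ / û_N)`. -/
def muTilde : ℝ → ℝ → ℝ := fun R θ => (1 / 2) * Real.log (polar F.muHat R θ / F.uN)

/-- `Φ_{,R} - A_φ ω_{,R}`. -/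
def eR : ℝ → ℝ → ℝ := fun R θ => dR (polar F.Phi) R θ - polar F.A R θ * dR (polar F.omega) R θ

/-- `Φ_{,θ} - A_φ ω_{,θ}`. -/
def eTheta : ℝ → ℝ → ℝ :=
  fun R θ => dTheta (polar F.Phi) R θ - polar F.A R θ * dTheta (polar F.omega) R θ

/-- The Einstein-Maxwell equations in electrovacuum (vanishing cosmological constant) at the
point `(R, θ)`. -/
structure EinsteinMaxwellAt (R θ : ℝ) : Prop where
  eq1 : R ^ 2 * dR (dR F.uTilde) R θ + 2 * R * dR F.uTilde R θ + dTheta (dTheta F.uTilde) R θ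
      + Real.cot θ * dTheta F.uTilde R θ
    = 1 - polar F.uHat R θ ^ 2 / 8 * Real.sin θ ^ 2
          * (dR (polar F.omega) R θ ^ 2 + dTheta (polar F.omega) R θ ^ 2 / R ^ 2)
        - 1 / (polar F.uHat R θ * Real.sin θ ^ 2)
          * (R ^ 2 * dR (polar F.A) R θ ^ 2 + dTheta (polar F.A) R θ ^ 2)
        - polar F.uHat R θ / 4 * (F.eR R θ ^ 2 + F.eTheta R θ ^ 2 / R ^ 2)
  eq2 : R ^ 2 * dR (dR F.muTilde) R θ + R * dR F.muTilde R θ + dTheta (dTheta F.muTilde) R θ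
    = polar F.uHat R θ ^ 2 / 16 * Real.sin θ ^ 2
          * (dR (polar F.omega) R θ ^ 2 + dTheta (polar F.omega) R θ ^ 2 / R ^ 2)
        - R ^ 2 * dR F.uTilde R θ ^ 2 + R * dR F.uTilde R θ
        - dTheta F.uTilde R θ * (dTheta F.uTilde R θ + Real.cot θ)
  eq3 : R ^ 2 * (dR (dR (polar F.omega)) R θ + 4 * dR (polar F.omega) R θ * dR F.uTilde R θ)
      + dTheta (dTheta (polar F.omega)) R θ
      + dTheta (polar F.omega) R θ * (3 * Real.cot θ + 4 * dTheta F.uTilde R θ)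
    = 4 / (polar F.uHat R θ * Real.sin θ ^ 2)
        * (R ^ 2 * dR (polar F.A) R θ * F.eR R θ + dTheta (polar F.A) R θ * F.eTheta R θ)
  eq4 : R ^ 2 * (dR (dR (polar F.Phi)) R θ - polar F.A R θ * dR (dR (polar F.omega)) R θ
        + 2 * dR F.uTilde R θ * F.eR R θ - dR (polar F.A) R θ * dR (polar F.omega) R θ)
      + dTheta (dTheta (polar F.Phi)) R θ - polar F.A R θ * dTheta (dTheta (polar F.omega)) R θ
      + (2 * dTheta F.uTilde R θ + Real.cot θ) * F.eTheta R θ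
      - dTheta (polar F.A) R θ * dTheta (polar F.omega) R θ
    = 0
  eq5 : R ^ 2 * (dR (dR (polar F.A)) R θ - 2 * dR F.uTilde R θ * dR (polar F.A) R θ)
      + 2 * R * dR (polar F.A) R θ + dTheta (dTheta (polar F.A)) R θ
      - (2 * dTheta F.uTilde R θ + Real.cot θ) * dTheta (polar F.A) R θ
    = polar F.uHat R θ ^ 2 / 4 * Real.sin θ ^ 2
        * (F.eR R θ * dR (polar F.omega) R θ + F.eTheta R θ / R ^ 2 * dTheta (polar F.omega) R θ)

/-- A function of `(R, x)` is smooth on the vicinity, up to the horizon and the rotation axis. -/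
def SmoothOn (f : ℝ → ℝ → ℝ) : Prop :=
  ContDiffOn ℝ ∞ (fun p : ℝ × ℝ => f p.1 p.2) (Ico 0 F.R₀ ×ˢ Icc (-1) 1)

/-- The fields describe the exterior vicinity of the horizon of a degenerate axisymmetric and
stationary black hole. A horizon located at `R = r_h` has surface gravity
`κ = 2 r_h / √(μ̂ û)`, so that degeneracy (`κ = 0`) means `r_h = 0`. -/
structure IsDegenerateBlackHole : Prop where
  R₀_pos : 0 < F.R₀
  smooth_muHat : F.SmoothOn F.muHat
  smooth_uHat : F.SmoothOn F.uHat
  smooth_omega : F.SmoothOn F.omega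
  smooth_Phi : F.SmoothOn F.Phi
  smooth_A : F.SmoothOn F.A
  muHat_pos : ∀ R ∈ Ico 0 F.R₀, ∀ x ∈ Icc (-1 : ℝ) 1, 0 < F.muHat R x
  uHat_pos : ∀ R ∈ Ico 0 F.R₀, ∀ x ∈ Icc (-1 : ℝ) 1, 0 < F.uHat R x
  -- field equations outside the horizon
  field_eqs : ∀ R ∈ Ioo 0 F.R₀, ∀ θ ∈ Ioo 0 Real.pi, F.EinsteinMaxwellAt R θ
  -- boundary conditions at the horizon
  omega_const : ∃ ωh : ℝ, ∀ x ∈ Icc (-1 : ℝ) 1, F.omega 0 x = ωh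
  Phi_const : ∃ Φh : ℝ, ∀ x ∈ Icc (-1 : ℝ) 1, F.Phi 0 x = Φh
  muHat_uHat_const : ∃ k : ℝ, ∀ x ∈ Icc (-1 : ℝ) 1, F.muHat 0 x * F.uHat 0 x = k
  -- regularity conditions at the poles of the horizon and on the rotation axis
  north : F.muHat 0 1 = F.uHat 0 1
  south : F.muHat 0 (-1) = F.uHat 0 (-1)
  A_north : ∀ R ∈ Ico 0 F.R₀, F.A R 1 = 0
  A_south : ∀ R ∈ Ico 0 F.R₀, F.A R (-1) = 0

/-- The (one-sided) derivative `f_{,R}` at the horizon. -/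
def horizonDeriv (f : ℝ → ℝ → ℝ) (x : ℝ) : ℝ := derivWithin (fun R => f R x) (Ici 0) 0

/-- The horizon potential `U = ½ ln (û / û_N)`. -/
def potU (x : ℝ) : ℝ := (1 / 2) * Real.log (F.uHat 0 x / F.uN)

/-- The horizon potential `S = û / (2 √û_N) (Φ_{,R} - A_φ ω_{,R})`. -/
def potS (x : ℝ) : ℝ :=
  F.uHat 0 x / (2 * Real.sqrt F.uN) * (horizonDeriv F.Phi x - F.A 0 x * horizonDeriv F.omega x)

/-- The horizon potential `T = A_φ / √û_N`. -/
def potT (x : ℝ) : ℝ := F.A 0 x / Real.sqrt F.uN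

end HorizonFields

/-- On `[-1,1]`, the functions `S, T, U` are the horizon potentials of some degenerate black
hole. -/
def AreDegeneratePotentials (S T U : ℝ → ℝ) : Prop :=
  ∃ F : HorizonFields, F.IsDegenerateBlackHole ∧
    ∀ x ∈ Icc (-1 : ℝ) 1, S x = F.potS x ∧ T x = F.potT x ∧ U x = F.potU x

end DegenerateHorizon

end

/-! Lower bound. Put `ψ = ∫ S` (from `-1`) and choose the constant `w = ±M₂/c₁`. Then `I` is half
the integral of `U'²(1-x²) - 2xU' + (S²+T'²)e^{-2U} + w²e^{4U}(1-x²)` (`exists_functionalI_eq`).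
Introduce the twist potential by `t(-1) = 0` and `t' = 2we^{4U}(1-x²) - 2(ψT'-TS)`, the Ernst
potential `E = A + it` with `A = e^{2U}(1-x²)+ψ²+T²`, and `N = |E|²`. The integral is a renormalised
energy of the curve `(U,ψ,T,t)` in the complex hyperbolic plane, which starts at a boundary point.
Completing squares (`energy_density_identity`) writes the density as `1 - 2U' - 2/(1+x) + (log N)'`
plus nonnegative squares, the `defect`. For every triple of `X` one has `N ~ 4(1+x)²` at `x = -1`
(`tendsto_ernstSq_div`), so the divergent logarithms cancel and the integral is at least `2 +
log(N(1)/16)`. Finally `N(1) = 4c₃⁴ + 4(M₂c₁+2|c₂|)²`, and `M₂` is the least nonnegative number that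
makes this at least `16`. Hence `I ≥ 1`.

Equality. If `I = 1`, all squares vanish almost everywhere. With `ζ = ψ + iT` and `X = e^{2U}` this
yields the first order system `ζ' = 2Xζ/E`, `E' = 2XE²/N`, `w = 2t/N`, together with an equation for
`U'`. Its first integrals `ζ/conj E`, `t/N` and `X(1+x)²/N` make the solution algebraic, and the
conditions `U(±1) = 0`, `T(1) = 0` leave one parameter `g = √(-γ)` and two signs
(`firstOrder_solution`). Conversely, the energy density of the family is `1` minus a multiple of the
integrand of `c₁²`, and the `M₂` term compensates exactly this multiple.

Multipliers. The members of the family satisfy the Euler-Lagrange equations pointwise, so an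
integration by parts annihilates the first variation. The variation is affine in the multipliers,
and three test directions give uniqueness.

Euler-Lagrange equations. The relation `λ₁ = -λ₂²/8` supplies enough first integrals, all with
constants known from `x = -1`, to reduce the second order equations to the same first order system
(`family_of_eulerLagrange`).

Black holes. In the limit `R → 0` the field equations first force `ω_{,R}` and `Φ_{,R}` to be
constant along the horizon (`horizon_rigidity`) and then become the Euler-Lagrange equations with
`λ₁ = -λ₂²/8`. Conversely, the fields `nearHorizonFields`, in which only `ω` and `Φ` depend on `R`,
and linearly, are exact solutions that realise every member. -/

namespace DegenerateHorizon

open MeasureTheory Set Filter Topology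

/-! ### The explicit family, parametrised by `g = √(-γ)` -/

/-- The denominator `1 + g² + (1 - g²) x²`. -/
noncomputable def famD (g x : ℝ) : ℝ := 1 + g ^ 2 + (1 - g ^ 2) * x ^ 2

/-- The function `U` of the family. -/
noncomputable def famU (g x : ℝ) : ℝ := -(1 / 2) * Real.log (famD g x / 2)

/-- The function `T` of the family. -/
noncomputable def famT (g σ x : ℝ) : ℝ :=
  σ * g * Real.sqrt (1 - g ^ 4) * (1 - x ^ 2) / famD g x

/-- The function `S` of the family. -/
noncomputable def famS (g σ x : ℝ) : ℝ :=
  2 * σ * g * (1 + g ^ 2 - (1 - g ^ 2) * x ^ 2) / famD g x ^ 2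

/-- The derivative of `famU`. -/
noncomputable def famU' (g x : ℝ) : ℝ := -((1 - g ^ 2) * x) / famD g x

/-- The derivative of `famT`. -/
noncomputable def famT' (g σ x : ℝ) : ℝ :=
  -4 * σ * g * Real.sqrt (1 - g ^ 4) * x / famD g x ^ 2

theorem sq_of_sign {σ : ℝ} (h : σ ∈ ({1, -1} : Set ℝ)) : σ ^ 2 = 1 := by
  rcases h with rfl | h
  · norm_num
  · rw [mem_singleton_iff.1 h]; norm_num

section

variable {g : ℝ} (hg : g ∈ Icc (0 : ℝ) 1)

include hg

theorem famD_pos (x : ℝ) : 0 < famD g x := by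
  have h1 : g ^ 2 ≤ 1 := by nlinarith [hg.1, hg.2]
  have := mul_nonneg (sub_nonneg.2 h1) (sq_nonneg x)
  unfold famD
  nlinarith [sq_nonneg g]

theorem sq_sqrt_one_sub_pow_four : Real.sqrt (1 - g ^ 4) ^ 2 = 1 - g ^ 4 := by
  apply Real.sq_sqrt
  have h1 : g ^ 2 ≤ 1 := by nlinarith [hg.1, hg.2]
  nlinarith [sq_nonneg g]

theorem exp_two_famU (x : ℝ) : Real.exp (2 * famU g x) = 2 / famD g x := by
  have h := famD_pos hg x
  rw [famU, show 2 * (-(1 / 2) * Real.log (famD g x / 2)) = -Real.log (famD g x / 2) by ring,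
    Real.exp_neg, Real.exp_log (by positivity), inv_div]

theorem exp_neg_two_famU (x : ℝ) : Real.exp (-2 * famU g x) = famD g x / 2 := by
  rw [show -2 * famU g x = -(2 * famU g x) by ring, Real.exp_neg, exp_two_famU hg, inv_div]

theorem exp_four_famU (x : ℝ) : Real.exp (4 * famU g x) = 4 / famD g x ^ 2 := by
  rw [show 4 * famU g x = 2 * famU g x + 2 * famU g x by ring, Real.exp_add, exp_two_famU hg]
  ring

/-- The substitution `γ = -g²` removes the half-integer powers of `-γ`. The assumptions on `σT` and
`x` serve to evaluate `|t|`. -/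
theorem familyAt_iff {σS σT : ℝ} (hT : σT ∈ ({1, -1} : Set ℝ)) {x : ℝ} (hx : x ∈ Icc (-1 : ℝ) 1)
    (s t u : ℝ) :
    FamilyAt (-g ^ 2) σS σT x s t u ↔ s = famS g σS x ∧ t = famT g σT x ∧ u = famU g x := by
  have hD := famD_pos hg x
  have e1 : (1 + -g ^ 2) * x ^ 2 + 1 - -g ^ 2 = famD g x := by unfold famD; ring
  have e2 : 1 - -g ^ 2 + (1 + -g ^ 2) * x ^ 2 = famD g x := by unfold famD; ring
  have h4 : 0 ≤ 1 - g ^ 4 := by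
    rw [← sq_sqrt_one_sub_pow_four hg]; positivity
  have e3 : Real.sqrt (- -g ^ 2 * (1 - (-g ^ 2) ^ 2)) = g * Real.sqrt (1 - g ^ 4) := by
    rw [show - -g ^ 2 * (1 - (-g ^ 2) ^ 2) = g ^ 2 * (1 - g ^ 4) by ring,
      Real.sqrt_mul (sq_nonneg g), Real.sqrt_sq hg.1]
  have e4 : (- -g ^ 2) ^ (3 / 2 : ℝ) = g ^ 3 := by
    rw [neg_neg, ← Real.rpow_natCast g 2, ← Real.rpow_mul hg.1, ← Real.rpow_natCast g 3]
    norm_num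
  have e5 : Real.sqrt (1 - (-g ^ 2) ^ 2) = Real.sqrt (1 - g ^ 4) := by congr 1; ring
  have hx2 : 0 ≤ 1 - x ^ 2 := by nlinarith [hx.1, hx.2]
  have habs : |famT g σT x| = g * Real.sqrt (1 - g ^ 4) * (1 - x ^ 2) / famD g x := by
    have hnn : 0 ≤ g * Real.sqrt (1 - g ^ 4) * (1 - x ^ 2) / famD g x := by
      have := hg.1
      positivity
    rcases hT with rfl | hT
    · rw [famT, ← abs_of_nonneg hnn]; congr 1; ring
    · rw [mem_singleton_iff.1 hT, famT, ← abs_of_nonneg hnn, ← abs_neg]; congr 1; ring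
  -- The root occurs squared here, and `g² D + (1-g⁴)(1-x²) = 1 + g² - (1-g²)x²` with `D = famD g
  -- x`, so `S` is rational in `g` and `x`.
  have hS : σS * (g ^ 3 + Real.sqrt (1 - g ^ 4) * |famT g σT x|) * (2 / famD g x)
      = famS g σS x := by
    rw [habs, famS]
    have hc := sq_sqrt_one_sub_pow_four hg
    set c := Real.sqrt (1 - g ^ 4)
    field_simp
    rw [hc]
    unfold famD
    ring
  constructor
  · rintro ⟨h1, h2, h3⟩
    rw [e1] at h1
    rw [e2, e3] at h2
    rw [e4, e5] at h3
    have hu : u = famU g x := by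
      have := h1.trans (exp_two_famU hg x).symm
      have := Real.exp_injective this
      linarith
    have ht : t = famT g σT x := by rw [h2, famT]; ring
    refine ⟨?_, ht, hu⟩
    rw [h3, ht, h1, hS]
  · rintro ⟨rfl, rfl, rfl⟩
    refine ⟨?_, ?_, ?_⟩
    · rw [e1, exp_two_famU hg]
    · rw [e2, e3, famT]; ring
    · rw [e4, e5, exp_two_famU hg, hS]

omit hg in
theorem hasDerivAt_famD (x : ℝ) : HasDerivAt (famD g) (2 * (1 - g ^ 2) * x) x := by
  have := (((hasDerivAt_id x).pow 2).const_mul (1 - g ^ 2)).const_add (1 + g ^ 2)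
  refine this.congr_deriv ?_
  simp; ring

theorem hasDerivAt_famU (x : ℝ) : HasDerivAt (famU g) (famU' g x) x := by
  have hD := famD_pos hg x
  have := (((hasDerivAt_famD x).div_const 2).log (by positivity)).const_mul (-(1 / 2))
  refine this.congr_deriv ?_
  rw [famU']; field_simp

theorem hasDerivAt_famT (σ x : ℝ) : HasDerivAt (famT g σ) (famT' g σ x) x := by
  have hD := famD_pos hg x
  have h1 : HasDerivAt (fun x : ℝ => 1 - x ^ 2) (-(2 * x)) x := by
    simpa using ((hasDerivAt_id x).pow 2).const_sub 1
  have := (h1.const_mul (σ * g * Real.sqrt (1 - g ^ 4))).div (hasDerivAt_famD x) hD.ne'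
  refine this.congr_deriv ?_
  rw [famT', div_left_inj' (by positivity)]
  unfold famD; ring

theorem hasDerivAt_famU' (x : ℝ) : HasDerivAt (famU' g)
    (-(1 - g ^ 2) * (1 + g ^ 2 - (1 - g ^ 2) * x ^ 2) / famD g x ^ 2) x := by
  have hD := famD_pos hg x
  have := (((hasDerivAt_id x).const_mul (1 - g ^ 2)).neg).div (hasDerivAt_famD x) hD.ne'
  refine this.congr_deriv ?_
  rw [div_left_inj' (by positivity)]
  simp only [id, Pi.neg_apply]
  unfold famD; ring

theorem hasDerivAt_famT' (σ x : ℝ) : HasDerivAt (famT' g σ)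
    (-4 * σ * g * Real.sqrt (1 - g ^ 4) * (1 + g ^ 2 - 3 * (1 - g ^ 2) * x ^ 2) / famD g x ^ 3)
      x := by
  have hD := famD_pos hg x
  have := ((hasDerivAt_id x).const_mul (-4 * σ * g * Real.sqrt (1 - g ^ 4))).div
    ((hasDerivAt_famD x).fun_pow 2) (by positivity)
  refine this.congr_deriv ?_
  simp only [id]
  field_simp
  unfold famD
  push_cast
  ring

omit hg in
theorem contDiff_famD : ContDiff ℝ ∞ (famD g) := by
  unfold famD; fun_prop

theorem contDiff_famU : ContDiff ℝ ∞ (famU g) := by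
  unfold famU
  exact contDiff_const.mul ((contDiff_famD.div_const 2).log
    fun x => (by have := famD_pos hg x; positivity))

theorem contDiff_famT (σ : ℝ) : ContDiff ℝ ∞ (famT g σ) := by
  unfold famT
  exact ContDiff.div (by fun_prop) contDiff_famD fun x => (famD_pos hg x).ne'

theorem contDiff_famS (σ : ℝ) : ContDiff ℝ ∞ (famS g σ) := by
  unfold famS
  exact ContDiff.div (by fun_prop) (contDiff_famD.pow 2)
    fun x => pow_ne_zero _ (famD_pos hg x).ne'

omit hg in
theorem famU_one : famU g 1 = 0 := by
  rw [famU, famD]; norm_num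

omit hg in
theorem famU_neg_one : famU g (-1) = 0 := by
  rw [famU, famD]; norm_num

omit hg in
theorem famT_one (σ : ℝ) : famT g σ 1 = 0 := by
  rw [famT]; norm_num

omit hg in
theorem famT_neg_one (σ : ℝ) : famT g σ (-1) = 0 := by
  rw [famT]; norm_num

/-- The algebraic relation of the family that expresses the vanishing of the variation of `S`. -/
theorem famS_eq {σS σT : ℝ} (hT : σT ∈ ({1, -1} : Set ℝ)) (x : ℝ) :
    famS g σS x = (σS * σT * Real.sqrt (1 - g ^ 4) * famT g σT x + σS * g ^ 3)
      * (2 / famD g x) := by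
  have hD := famD_pos hg x
  have hc := sq_sqrt_one_sub_pow_four hg
  have hσ : σT ^ 2 = 1 := sq_of_sign hT
  rw [famS, famT]
  set c := Real.sqrt (1 - g ^ 4)
  field_simp
  rw [hc, hσ]
  unfold famD
  ring

/-- The Euler-Lagrange equation of the variation of `U`, with `λ₁ = -(1 - g⁴)/8`. -/
theorem fam_eqU {σS σT : ℝ} (hS : σS ∈ ({1, -1} : Set ℝ)) (hT : σT ∈ ({1, -1} : Set ℝ)) (x : ℝ) :
    -(-(1 - g ^ 2) * (1 + g ^ 2 - (1 - g ^ 2) * x ^ 2) / famD g x ^ 2) * (1 - x ^ 2)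
      + 2 * x * famU' g x + 1 - (famS g σS x ^ 2 + famT' g σT x ^ 2) * (famD g x / 2)
      - (1 / 2) * (1 - g ^ 4) * (1 - x ^ 2) * (4 / famD g x ^ 2) = 0 := by
  have hD := famD_pos hg x
  have hc := sq_sqrt_one_sub_pow_four hg
  have hσ : σT ^ 2 = 1 := sq_of_sign hT
  have hσ' : σS ^ 2 = 1 := sq_of_sign hS
  rw [famS, famT', famU']
  set c := Real.sqrt (1 - g ^ 4)
  field_simp
  rw [hc, hσ, hσ']
  unfold famD
  ring

/-- The Euler-Lagrange equation of the variation of `T`. -/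
theorem fam_eqT {σS σT : ℝ} (hS : σS ∈ ({1, -1} : Set ℝ)) (x : ℝ) :
    -(-4 * σT * g * Real.sqrt (1 - g ^ 4) * (1 + g ^ 2 - 3 * (1 - g ^ 2) * x ^ 2) / famD g x ^ 3)
      + 2 * famU' g x * famT' g σT x
      - σS * σT * Real.sqrt (1 - g ^ 4) * famS g σS x * (2 / famD g x) = 0 := by
  have hD := famD_pos hg x
  have hσ' : σS ^ 2 = 1 := sq_of_sign hS
  rw [famS, famT', famU']
  set c := Real.sqrt (1 - g ^ 4)
  field_simp
  rw [hσ']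
  unfold famD
  ring

/-- The integrand of the energy of the family, up to the contribution of `c₁`. -/
theorem fam_energy_density {σS σT : ℝ} (hS : σS ∈ ({1, -1} : Set ℝ))
    (hT : σT ∈ ({1, -1} : Set ℝ)) (x : ℝ) :
    famU' g x ^ 2 * (1 - x ^ 2) - 2 * x * famU' g x
      + (famS g σS x ^ 2 + famT' g σT x ^ 2) * (famD g x / 2)
      = 1 - (1 - g ^ 4) / 4 * (4 / famD g x ^ 2 * (1 - x ^ 2)) := by
  have hD := famD_pos hg x
  have hc := sq_sqrt_one_sub_pow_four hg
  have hσ : σT ^ 2 = 1 := sq_of_sign hT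
  have hσ' : σS ^ 2 = 1 := sq_of_sign hS
  rw [famS, famT', famU']
  set c := Real.sqrt (1 - g ^ 4)
  field_simp
  rw [hc, hσ, hσ']
  unfold famD
  ring

end

theorem exists_family_iff {P : ℝ → ℝ → ℝ → Prop} :
    (∃ γ ∈ Icc (-1 : ℝ) 0, ∃ σS ∈ ({1, -1} : Set ℝ), ∃ σT ∈ ({1, -1} : Set ℝ), P γ σS σT) ↔
    ∃ g ∈ Icc (0 : ℝ) 1, ∃ σS ∈ ({1, -1} : Set ℝ), ∃ σT ∈ ({1, -1} : Set ℝ),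
      P (-g ^ 2) σS σT := by
  constructor
  · rintro ⟨γ, hγ, h⟩
    refine ⟨Real.sqrt (-γ), ⟨Real.sqrt_nonneg _, Real.sqrt_le_one.2 (by linarith [hγ.1])⟩, ?_⟩
    rwa [Real.sq_sqrt (by linarith [hγ.2]), neg_neg]
  · rintro ⟨g, hg, h⟩
    exact ⟨-g ^ 2, ⟨by nlinarith [hg.1, hg.2], by nlinarith [hg.1, hg.2]⟩, h⟩

theorem inFamilyOn_iff {g : ℝ} (hg : g ∈ Icc (0 : ℝ) 1) {σS σT : ℝ} (hT : σT ∈ ({1, -1} : Set ℝ))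
    (S T U : ℝ → ℝ) :
    InFamilyOn (-g ^ 2) σS σT S T U ↔
      ∀ x ∈ Icc (-1 : ℝ) 1, S x = famS g σS x ∧ T x = famT g σT x ∧ U x = famU g x :=
  forall₂_congr fun _ hx => familyAt_iff hg hT hx _ _ _

theorem ae_mu_mem : ∀ᵐ x ∂mu, x ∈ Ioo (-1 : ℝ) 1 := ae_restrict_mem measurableSet_Ioo

theorem inFamilyAE_iff {g : ℝ} (hg : g ∈ Icc (0 : ℝ) 1) {σS σT : ℝ} (hT : σT ∈ ({1, -1} : Set ℝ))
    (S T U : ℝ → ℝ) :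
    InFamilyAE (-g ^ 2) σS σT S T U ↔
      S =ᵐ[mu] famS g σS ∧ T =ᵐ[mu] famT g σT ∧ U =ᵐ[mu] famU g := by
  rw [InFamilyAE]
  constructor
  · intro h
    have h' : ∀ᵐ x ∂mu, S x = famS g σS x ∧ T x = famT g σT x ∧ U x = famU g x := by
      filter_upwards [h, ae_mu_mem] with x hx hm
      exact (familyAt_iff hg hT (Ioo_subset_Icc_self hm) _ _ _).1 hx
    exact ⟨h'.mono fun x hx => hx.1, h'.mono fun x hx => hx.2.1, h'.mono fun x hx => hx.2.2⟩
  · rintro ⟨h1, h2, h3⟩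
    filter_upwards [h1, h2, h3, ae_mu_mem] with x h1 h2 h3 hm
    exact (familyAt_iff hg hT (Ioo_subset_Icc_self hm) _ _ _).2 ⟨h1, h2, h3⟩

/-! ### Sobolev functions on `(-1,1)` -/

instance : IsFiniteMeasure mu := by unfold mu; infer_instance

theorem mu_eq_Ioc : mu = volume.restrict (Ioc (-1 : ℝ) 1) :=
  Measure.restrict_congr_set Ioo_ae_eq_Ioc

theorem intervalIntegral_congr_mu {f g : ℝ → ℝ} (h : f =ᵐ[mu] g) :
    ∫ x in (-1)..1, f x = ∫ x in (-1)..1, g x := by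
  rw [intervalIntegral.integral_of_le (by norm_num), intervalIntegral.integral_of_le (by norm_num),
    ← mu_eq_Ioc]
  exact integral_congr_ae h

theorem integrable_mu_iff {f : ℝ → ℝ} :
    Integrable f mu ↔ IntervalIntegrable f volume (-1) 1 := by
  rw [intervalIntegrable_iff, uIoc_of_le (by norm_num), IntegrableOn, mu_eq_Ioc]

theorem MemL2.intervalIntegrable {f : ℝ → ℝ} (h : MemL2 f) : IntervalIntegrable f volume (-1) 1 :=
  integrable_mu_iff.1 (MemLp.integrable one_le_two h)

theorem MemL2.intervalIntegrable_sub {f : ℝ → ℝ} (h : MemL2 f) {a b : ℝ}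
    (ha : a ∈ Icc (-1 : ℝ) 1) (hb : b ∈ Icc (-1 : ℝ) 1) : IntervalIntegrable f volume a b :=
  h.intervalIntegrable.mono_set (by
    rw [uIcc_of_le (show (-1 : ℝ) ≤ 1 by norm_num)]
    exact uIcc_subset_Icc ha hb)

theorem MemL2.mul {f g : ℝ → ℝ} (hf : MemL2 f) (hg : MemL2 g) :
    IntervalIntegrable (fun x => f x * g x) volume (-1) 1 :=
  integrable_mu_iff.1 (MemLp.integrable_mul (p := 2) (q := 2) hf hg)

theorem MemL2.locallyIntegrableOn {f : ℝ → ℝ} (h : MemL2 f) :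
    LocallyIntegrableOn f (Ioo (-1) 1) :=
  IntegrableOn.locallyIntegrableOn (MemLp.integrable one_le_two h)

theorem memL2_of_continuousOn {f : ℝ → ℝ} (h : ContinuousOn f (Icc (-1) 1)) : MemL2 f := by
  obtain ⟨C, hC⟩ := isCompact_Icc.exists_bound_of_continuousOn h
  refine MemLp.of_bound ?_ C ?_
  · exact (h.mono Ioo_subset_Icc_self).aestronglyMeasurable measurableSet_Ioo
  · filter_upwards [ae_mu_mem] with x hx using hC x (Ioo_subset_Icc_self hx)

theorem IsTest.eq_zero {φ : ℝ → ℝ} (h : IsTest φ) {x : ℝ} (hx : x ∉ Ioo (-1 : ℝ) 1) : φ x = 0 :=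
  image_eq_zero_of_notMem_tsupport fun h' => hx (h.supp h')

theorem IsTest.eq_integral {φ : ℝ → ℝ} (h : IsTest φ) (x : ℝ) :
    φ x = ∫ y in (-1)..x, deriv φ y := by
  have hd : ContDiff ℝ 1 φ := h.smooth.of_le (by simp)
  rw [intervalIntegral.integral_deriv_eq_sub, h.eq_zero (x := -1) (by simp), sub_zero]
  · exact fun y _ => (hd.differentiable (by simp)) y
  · exact (hd.continuous_deriv le_rfl).intervalIntegrable _ _

/-- The fundamental lemma of the calculus of variations. It makes the arbitrary choice in
`weakDeriv` harmless. -/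
theorem HasWeakDeriv.ae_unique {u v g g' : ℝ → ℝ} (h : HasWeakDeriv u g) (h' : HasWeakDeriv v g')
    (huv : u =ᵐ[mu] v) : g =ᵐ[mu] g' := by
  have key := isOpen_Ioo.ae_eq_zero_of_integral_contDiff_smul_eq_zero (μ := volume)
    (h.locInt'.sub h'.locInt') (fun φ h1 h2 h3 => by
      have e1 := h.parts φ ⟨h1, h2, h3⟩
      have e2 := h'.parts φ ⟨h1, h2, h3⟩
      have e3 : ∫ x in Ioo (-1) 1, u x * deriv φ x = ∫ x in Ioo (-1) 1, v x * deriv φ x :=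
        integral_congr_ae (by filter_upwards [huv] with x hx; rw [hx])
      have hz : ∀ f : ℝ → ℝ, LocallyIntegrableOn f (Ioo (-1) 1) →
          IntegrableOn (fun x => f x * φ x) (Ioo (-1) 1) := fun f hf => by
        have h5 : IntegrableOn (fun x => f x * φ x) (tsupport φ) :=
          (hf.integrableOn_compact_subset h3 h2).mul_continuousOn h1.continuous.continuousOn h2
        refine (integrableOn_iff_integrable_of_support_subset (s := tsupport φ) ?_).1 h5
          |>.integrableOn
        exact (Function.support_mul_subset_right _ _).trans (subset_tsupport _)
      rw [← setIntegral_eq_integral_of_forall_compl_eq_zero (s := Ioo (-1) 1) (fun x hx => by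
        rw [IsTest.eq_zero ⟨h1, h2, h3⟩ hx, zero_smul])]
      have : ∀ x, φ x • (g - g') x = g x * φ x - g' x * φ x := fun x => by
        simp; ring
      simp_rw [this]
      rw [integral_sub (hz _ h.locInt') (hz _ h'.locInt')]
      linarith)
  rw [EventuallyEq, mu, ae_restrict_iff' measurableSet_Ioo]
  filter_upwards [key] with x hx hm
  exact sub_eq_zero.1 (hx hm)

theorem HasWeakDeriv.weakDeriv_ae_eq {u g : ℝ → ℝ} (h : HasWeakDeriv u g) :
    weakDeriv u =ᵐ[mu] g := by
  have hex : ∃ g, HasWeakDeriv u g := ⟨g, h⟩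
  rw [weakDeriv, dif_pos hex]
  exact hex.choose_spec.ae_unique h EventuallyEq.rfl

theorem MemW12.hasWeakDeriv {u : ℝ → ℝ} (h : MemW12 u) : HasWeakDeriv u (weakDeriv u) := by
  have hex : ∃ g, HasWeakDeriv u g := h.exists_deriv.imp fun _ h => h.1
  rw [weakDeriv, dif_pos hex]
  exact hex.choose_spec

theorem MemW12.memL2_weakDeriv {u : ℝ → ℝ} (h : MemW12 u) : MemL2 (weakDeriv u) := by
  obtain ⟨g, h1, h2⟩ := h.exists_deriv
  exact (memLp_congr_ae h1.weakDeriv_ae_eq).2 h2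

theorem LocallyIntegrableOn.congr_mu {u v : ℝ → ℝ} (h : LocallyIntegrableOn u (Ioo (-1) 1))
    (huv : u =ᵐ[mu] v) : LocallyIntegrableOn v (Ioo (-1) 1) := by
  rw [locallyIntegrableOn_iff isOpen_Ioo.isLocallyClosed] at h ⊢
  intro k hk hc
  refine (h k hk hc).congr_fun_ae ?_
  exact ae_restrict_of_ae_restrict_of_subset hk huv

theorem HasWeakDeriv.congr {u v g g' : ℝ → ℝ} (h : HasWeakDeriv u g) (huv : u =ᵐ[mu] v)
    (hg : g =ᵐ[mu] g') : HasWeakDeriv v g' where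
  locInt := LocallyIntegrableOn.congr_mu h.locInt huv
  locInt' := LocallyIntegrableOn.congr_mu h.locInt' hg
  parts φ hφ := by
    have := h.parts φ hφ
    rwa [integral_congr_ae (g := fun x => v x * deriv φ x)
        (by filter_upwards [huv] with x hx; rw [hx]),
      integral_congr_ae (f := fun x => g x * φ x) (g := fun x => g' x * φ x)
        (by filter_upwards [hg] with x hx; rw [hx])] at this

theorem MemW012.congr {u v : ℝ → ℝ} (h : MemW012 u) (huv : u =ᵐ[mu] v) : MemW012 v := by
  have hv : HasWeakDeriv v (weakDeriv u) := h.memW12.hasWeakDeriv.congr huv EventuallyEq.rfl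
  refine ⟨⟨(memLp_congr_ae huv).1 h.memW12.memL2, _, hv, h.memW12.memL2_weakDeriv⟩, ?_⟩
  intro ε hε
  obtain ⟨φ, h1, h2⟩ := h.approx ε hε
  refine ⟨φ, h1, ?_⟩
  rwa [← eLpNorm_congr_ae (f := fun x => u x - φ x) (by filter_upwards [huv] with x hx; rw [hx]),
    eLpNorm_congr_ae (f := fun x => weakDeriv v x - deriv φ x)
      (g := fun x => weakDeriv u x - deriv φ x)
      (by filter_upwards [hv.weakDeriv_ae_eq] with x hx; rw [hx])]

/-- `u` has, up to a null set, the primitive of `g ∈ L²` that vanishes at both ends. -/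
structure IsPrimitive (u g : ℝ → ℝ) : Prop where
  memL2 : MemL2 g
  integral_eq_zero : ∫ x in (-1)..1, g x = 0
  ae_eq : u =ᵐ[mu] fun x => ∫ y in (-1)..x, g y

/-- Hölder's inequality on an interval of length `2`; the sharp constant `√2` is rounded up to `2`.
-/
theorem abs_integral_le_eLpNorm {f : ℝ → ℝ} (hf : MemL2 f) {x : ℝ} (hx : x ∈ Icc (-1 : ℝ) 1) :
    |∫ y in (-1)..x, f y| ≤ 2 * (eLpNorm f 2 mu).toReal := by
  have h1 : ‖∫ y in (-1)..x, f y‖ ≤ ∫ y, ‖f y‖ ∂mu := by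
    rw [intervalIntegral.integral_of_le hx.1]
    refine (norm_integral_le_integral_norm _).trans ?_
    rw [mu_eq_Ioc]
    refine setIntegral_mono_set ?_ ?_ ?_
    · rw [IntegrableOn, ← mu_eq_Ioc]; exact (MemLp.integrable one_le_two hf).norm
    · exact Eventually.of_forall fun _ => norm_nonneg _
    · exact (Ioc_subset_Ioc_right hx.2).eventuallyLE
  have h2 := eLpNorm_le_eLpNorm_mul_rpow_measure_univ (p := 1) (q := 2) one_le_two
    hf.aestronglyMeasurable
  have h3 : mu univ = 2 := by
    rw [mu, Measure.restrict_apply_univ, Real.volume_Ioo]; norm_num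
  have h4 : (2 : ℝ≥0∞) ^ (1 / (1 : ℝ≥0∞).toReal - 1 / (2 : ℝ≥0∞).toReal) ≤ 2 := by
    calc (2 : ℝ≥0∞) ^ (1 / (1 : ℝ≥0∞).toReal - 1 / (2 : ℝ≥0∞).toReal) ≤ 2 ^ (1 : ℝ) := by
          apply ENNReal.rpow_le_rpow_of_exponent_le (by norm_num)
          norm_num
      _ = 2 := ENNReal.rpow_one 2
  rw [h3] at h2
  have h5 : eLpNorm f 1 mu ≤ 2 * eLpNorm f 2 mu := by
    rw [mul_comm]; exact h2.trans (by gcongr)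
  have h6 : (∫ y, ‖f y‖ ∂mu) = (eLpNorm f 1 mu).toReal := by
    rw [integral_norm_eq_lintegral_enorm hf.aestronglyMeasurable, eLpNorm_one_eq_lintegral_enorm]
  rw [← Real.norm_eq_abs]
  refine h1.trans ?_
  rw [h6]
  calc (eLpNorm f 1 mu).toReal ≤ (2 * eLpNorm f 2 mu).toReal :=
        ENNReal.toReal_mono (ENNReal.mul_ne_top (by norm_num) hf.eLpNorm_ne_top) h5
    _ = _ := by rw [ENNReal.toReal_mul]; norm_num

/-- A test function is the primitive of its derivative and vanishes at both ends. If the derivatives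
converge in `L²`, the primitives converge uniformly, so both properties survive in the closure. All
later calculus uses this continuous representative. -/
theorem MemW012.isPrimitive {u : ℝ → ℝ} (h : MemW012 u) : IsPrimitive u (weakDeriv u) := by
  have hg := h.memW12.memL2_weakDeriv
  have key : ∀ ε : ℝ, 0 < ε → ∃ φ, IsTest φ ∧ (eLpNorm (fun x => u x - φ x) 2 mu).toReal ≤ ε ∧
      ∀ x ∈ Icc (-1 : ℝ) 1, |φ x - ∫ y in (-1)..x, weakDeriv u y| ≤ 2 * ε := by
    intro ε hε
    obtain ⟨φ, h1, h2⟩ := h.approx (ENNReal.ofReal ε) (by simpa using hε)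
    have hd : ContDiff ℝ 1 φ := h1.smooth.of_le (by simp)
    have hL : MemL2 (fun x => weakDeriv u x - deriv φ x) :=
      MemLp.sub hg (memL2_of_continuousOn (hd.continuous_deriv le_rfl).continuousOn)
    refine ⟨φ, h1, ?_, fun x hx => ?_⟩
    · exact ENNReal.toReal_le_of_le_ofReal hε.le (le_self_add.trans h2.le)
    · rw [h1.eq_integral, ← intervalIntegral.integral_sub
        ((hd.continuous_deriv le_rfl).intervalIntegrable _ _)
        (hg.intervalIntegrable_sub (by norm_num) hx), ← abs_neg, ← intervalIntegral.integral_neg]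
      simp_rw [neg_sub]
      refine (abs_integral_le_eLpNorm hL hx).trans ?_
      gcongr
      exact ENNReal.toReal_le_of_le_ofReal hε.le (le_add_self.trans h2.le)
  have hcont : ContinuousOn (fun x => ∫ y in (-1)..x, weakDeriv u y) (Icc (-1) 1) := by
    have := hg.intervalIntegrable.absolutelyContinuousOnInterval_intervalIntegral (c := -1)
      (by simp) |>.continuousOn
    rwa [uIcc_of_le (by norm_num)] at this
  refine ⟨hg, ?_, ?_⟩
  · refine abs_eq_zero.1 (le_antisymm (le_of_forall_pos_le_add fun ε hε => ?_) (abs_nonneg _))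
    obtain ⟨φ, h1, -, h3⟩ := key (ε / 2) (by positivity)
    have := h3 1 (by norm_num)
    rw [h1.eq_zero (by norm_num), zero_sub, abs_neg] at this
    linarith
  · have hGL := memL2_of_continuousOn hcont
    have hz : eLpNorm (u - fun x => ∫ y in (-1)..x, weakDeriv u y) 2 mu = 0 := by
      have hm : MemL2 (u - fun x => ∫ y in (-1)..x, weakDeriv u y) :=
        MemLp.sub h.memW12.memL2 hGL
      rw [← ENNReal.toReal_eq_zero_iff _ |>.trans (or_iff_left hm.eLpNorm_ne_top)]
      refine le_antisymm (le_of_forall_pos_le_add fun ε hε => ?_) ENNReal.toReal_nonneg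
      -- The `L²` error is `ε/5`; the uniform error `2ε/5` costs at most another factor `2` in `L²`,
      -- and the sum is `ε`.
      obtain ⟨φ, h1, h2, h3⟩ := key (ε / 5) (by positivity)
      have hφ : MemL2 φ := memL2_of_continuousOn h1.smooth.continuous.continuousOn
      have e1 : u - (fun x => ∫ y in (-1)..x, weakDeriv u y)
          = (u - φ) + (φ - fun x => ∫ y in (-1)..x, weakDeriv u y) := by
        ext x; simp
      have hA : MemLp (u - φ) 2 mu := MemLp.sub h.memW12.memL2 hφ
      have hB : MemLp (φ - fun x => ∫ y in (-1)..x, weakDeriv u y) 2 mu := MemLp.sub hφ hGL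
      have hb : eLpNorm (φ - fun x => ∫ y in (-1)..x, weakDeriv u y) 2 mu
          ≤ ENNReal.ofReal (2 * (2 * (ε / 5))) := by
        refine (eLpNorm_le_of_ae_bound (C := 2 * (ε / 5)) ?_).trans ?_
        · filter_upwards [ae_mu_mem] with x hx using h3 x (Ioo_subset_Icc_self hx)
        · have h3 : mu univ = 2 := by
            rw [mu, Measure.restrict_apply_univ, Real.volume_Ioo]; norm_num
          rw [h3, ENNReal.ofReal_mul (p := 2) (q := 2 * (ε / 5)) (by norm_num)]
          refine mul_le_mul' ?_ le_rfl
          calc (2 : ℝ≥0∞) ^ ((2 : ℝ≥0∞).toReal)⁻¹ ≤ 2 ^ (1 : ℝ) := by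
                apply ENNReal.rpow_le_rpow_of_exponent_le (by norm_num)
                norm_num
            _ = ENNReal.ofReal 2 := by simp
      rw [e1, zero_add]
      have h2' : (eLpNorm (u - φ) 2 mu).toReal ≤ ε / 5 := h2
      calc (eLpNorm ((u - φ) + (φ - fun x => ∫ y in (-1)..x, weakDeriv u y)) 2 mu).toReal
          ≤ (eLpNorm (u - φ) 2 mu
            + eLpNorm (φ - fun x => ∫ y in (-1)..x, weakDeriv u y) 2 mu).toReal :=
            ENNReal.toReal_mono (ENNReal.add_ne_top.2 ⟨hA.eLpNorm_ne_top, hB.eLpNorm_ne_top⟩)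
              (eLpNorm_add_le hA.aestronglyMeasurable hB.aestronglyMeasurable one_le_two)
        _ = _ := ENNReal.toReal_add hA.eLpNorm_ne_top hB.eLpNorm_ne_top
        _ ≤ ε / 5 + 2 * (2 * (ε / 5)) := by
            gcongr
            exact ENNReal.toReal_le_of_le_ofReal (by positivity) hb
        _ ≤ ε := by linarith
    have := (eLpNorm_eq_zero_iff (MemLp.sub h.memW12.memL2 hGL).aestronglyMeasurable
      (by norm_num)).1 hz
    filter_upwards [this] with x hx
    exact sub_eq_zero.1 hx

theorem hasWeakDeriv_of_contDiff {f : ℝ → ℝ} (hf : ContDiff ℝ 1 f) :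
    HasWeakDeriv f (deriv f) where
  locInt := (memL2_of_continuousOn hf.continuous.continuousOn).locallyIntegrableOn
  locInt' := (memL2_of_continuousOn (hf.continuous_deriv le_rfl).continuousOn).locallyIntegrableOn
  parts φ hφ := by
    have hφ' : ContDiff ℝ 1 φ := hφ.smooth.of_le (by simp)
    have := intervalIntegral.integral_mul_deriv_eq_deriv_mul (a := -1) (b := 1) (u := f) (v := φ)
      (fun x _ => (hf.differentiable (by simp) x).hasDerivAt)
      (fun x _ => (hφ'.differentiable (by simp) x).hasDerivAt)
      ((hf.continuous_deriv le_rfl).intervalIntegrable _ _)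
      ((hφ'.continuous_deriv le_rfl).intervalIntegrable _ _)
    rw [hφ.eq_zero (x := -1) (by simp), hφ.eq_zero (x := 1) (by simp),
      intervalIntegral.integral_of_le (by norm_num), intervalIntegral.integral_of_le (by norm_num),
      integral_Ioc_eq_integral_Ioo, integral_Ioc_eq_integral_Ioo] at this
    linarith

theorem weakDeriv_of_contDiff {f : ℝ → ℝ} (hf : ContDiff ℝ 1 f) :
    weakDeriv f =ᵐ[mu] deriv f :=
  (hasWeakDeriv_of_contDiff hf).weakDeriv_ae_eq

/-- The mean value theorem from the nearer end point, and `1 - |x| ≤ 1 - x²`. The factor `1 - x²`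
will absorb the `1/δ` in the derivative of the cut-off. -/
theorem exists_bound_of_contDiff {f : ℝ → ℝ} (hf : ContDiff ℝ 1 f) (h1 : f 1 = 0)
    (h2 : f (-1) = 0) :
    ∃ L, 0 ≤ L ∧ (∀ x ∈ Icc (-1 : ℝ) 1, |deriv f x| ≤ L) ∧
      ∀ x ∈ Icc (-1 : ℝ) 1, |f x| ≤ L * (1 - x ^ 2) := by
  obtain ⟨L, hL⟩ := isCompact_Icc.exists_bound_of_continuousOn
    (hf.continuous_deriv le_rfl).continuousOn (s := Icc (-1 : ℝ) 1)
  have hL0 : 0 ≤ L := (norm_nonneg _).trans (hL 0 (by norm_num))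
  refine ⟨L, hL0, hL, fun x hx => ?_⟩
  have key : ∀ y ∈ Icc (-1 : ℝ) 1, ‖f x - f y‖ ≤ L * ‖x - y‖ := fun y hy =>
    (convex_Icc (-1 : ℝ) 1).norm_image_sub_le_of_norm_deriv_le
      (fun z _ => hf.differentiable (by simp) z) hL hy hx
  rcases le_total 0 x with h0 | h0
  · have := key 1 (by norm_num)
    rw [h1, sub_zero, Real.norm_eq_abs, Real.norm_eq_abs, abs_of_nonpos (show x - 1 ≤ 0 by linarith [hx.2])] at this
    refine this.trans (mul_le_mul_of_nonneg_left ?_ hL0)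
    nlinarith [hx.2]
  · have := key (-1) (by norm_num)
    rw [h2, sub_zero, Real.norm_eq_abs, Real.norm_eq_abs, abs_of_nonneg (show 0 ≤ x - -1 by linarith [hx.1])] at this
    refine this.trans (mul_le_mul_of_nonneg_left ?_ hL0)
    nlinarith [hx.1]

theorem deriv_smoothTransition_eq_zero_of_gt {y : ℝ} (hy : 1 < y) :
    deriv Real.smoothTransition y = 0 := by
  have : Real.smoothTransition =ᶠ[𝓝 y] fun _ => 1 := by
    filter_upwards [lt_mem_nhds hy] with z hz using Real.smoothTransition.one_of_one_le hz.le
  rw [this.deriv_eq, deriv_const]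

/-- The cut-off function that is `1` where `1 - x² ≥ 2δ` and `0` where `1 - x² ≤ δ`. -/
noncomputable def cutoff (δ x : ℝ) : ℝ := Real.smoothTransition ((1 - x ^ 2) / δ - 1)

theorem contDiff_cutoff (δ : ℝ) : ContDiff ℝ ∞ (cutoff δ) :=
  Real.smoothTransition.contDiff.comp (by fun_prop)

theorem deriv_cutoff (δ x : ℝ) :
    deriv (cutoff δ) x = deriv Real.smoothTransition ((1 - x ^ 2) / δ - 1) * (-(2 * x) / δ) := by
  have h1 : HasDerivAt (fun x : ℝ => (1 - x ^ 2) / δ - 1) (-(2 * x) / δ) x := by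
    have := ((((hasDerivAt_id x).fun_pow 2).const_sub 1).div_const δ).sub_const 1
    refine this.congr_deriv ?_
    simp
  have h2 : HasDerivAt Real.smoothTransition
      (deriv Real.smoothTransition ((1 - x ^ 2) / δ - 1)) ((1 - x ^ 2) / δ - 1) :=
    (Real.smoothTransition.contDiff (n := 1).differentiable (by simp) _).hasDerivAt
  exact (HasDerivAt.comp x h2 h1).deriv

theorem isTest_mul_cutoff {f : ℝ → ℝ} (hf : ContDiff ℝ ∞ f) {δ : ℝ} (hδ : 0 < δ) :
    IsTest (fun x => f x * cutoff δ x) := by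
  have hc : IsClosed {x : ℝ | δ ≤ 1 - x ^ 2} :=
    isClosed_le continuous_const (by fun_prop)
  have hs : tsupport (fun x => f x * cutoff δ x) ⊆ {x : ℝ | δ ≤ 1 - x ^ 2} := by
    refine closure_minimal (fun x hx => ?_) hc
    by_contra hlt
    refine hx ?_
    have : cutoff δ x = 0 := by
      apply Real.smoothTransition.zero_of_nonpos
      rw [sub_nonpos, div_le_one hδ]
      exact (not_le.1 hlt).le
    simp [this]
  have hI : {x : ℝ | δ ≤ 1 - x ^ 2} ⊆ Ioo (-1) 1 := fun x hx => by
    have hx' : δ ≤ 1 - x ^ 2 := hx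
    exact ⟨by nlinarith, by nlinarith⟩
  refine ⟨hf.mul (contDiff_cutoff δ), ?_, hs.trans hI⟩
  exact HasCompactSupport.of_support_subset_isCompact isCompact_Icc
    ((subset_tsupport _).trans (hs.trans (hI.trans Ioo_subset_Icc_self)))

theorem mu_boundary_layer_le {δ : ℝ} :
    mu {x : ℝ | 1 - x ^ 2 ≤ 2 * δ} ≤ ENNReal.ofReal (4 * δ) := by
  have hm : MeasurableSet {x : ℝ | 1 - x ^ 2 ≤ 2 * δ} :=
    measurableSet_le (by fun_prop) measurable_const
  rw [mu, Measure.restrict_apply hm]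
  have hsub : {x : ℝ | 1 - x ^ 2 ≤ 2 * δ} ∩ Ioo (-1) 1 ⊆
      Icc (-1) (-1 + 2 * δ) ∪ Icc (1 - 2 * δ) 1 := by
    rintro x ⟨hx, h1, h2⟩
    have hx' : 1 - x ^ 2 ≤ 2 * δ := hx
    rcases le_total 0 x with h0 | h0
    · right; exact ⟨by nlinarith, h2.le⟩
    · left; exact ⟨h1.le, by nlinarith⟩
  refine (measure_mono hsub).trans ((measure_union_le _ _).trans ?_)
  rw [Real.volume_Icc, Real.volume_Icc]
  rcases le_total 0 δ with hδ | hδ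
  · rw [← ENNReal.ofReal_add (by linarith) (by linarith)]
    exact ENNReal.ofReal_le_ofReal (by linarith)
  · rw [ENNReal.ofReal_of_nonpos (by linarith), ENNReal.ofReal_of_nonpos (by linarith)]
    simp

/-- Multiplication by `cutoff δ` changes `f` and `f'` only in a boundary layer of measure at most
`4δ`, and there by a bounded amount, so the error in `W^{1,2}` is of order `√δ`. -/
theorem memW012_of_contDiff {f : ℝ → ℝ} (hf : ContDiff ℝ ∞ f) (h1 : f 1 = 0) (h2 : f (-1) = 0) :
    MemW012 f := by
  have hf1 : ContDiff ℝ 1 f := hf.of_le (by simp)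
  refine ⟨⟨memL2_of_continuousOn hf.continuous.continuousOn, _, hasWeakDeriv_of_contDiff hf1,
    memL2_of_continuousOn (hf1.continuous_deriv le_rfl).continuousOn⟩, ?_⟩
  obtain ⟨L, hL0, hL1, hL2⟩ := exists_bound_of_contDiff hf1 h1 h2
  obtain ⟨K, hK⟩ := isCompact_Icc.exists_bound_of_continuousOn
    (Real.smoothTransition.contDiff (n := 1).continuous_deriv le_rfl).continuousOn
    (s := Icc (-1 : ℝ) 1)
  have hK0 : 0 ≤ K := (norm_nonneg _).trans (hK 0 (by norm_num))
  -- The first term bounds `f'(1-χ)` and the second `fχ'`: in the layer `|f| ≤ 2Lδ`, while `|χ'| ≤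
  -- 2K/δ`.
  set C : ℝ := L + L * 2 * K * 2
  have hC0 : 0 ≤ C := by positivity
  have key : ∀ δ : ℝ, 0 < δ → eLpNorm (fun x => f x - f x * cutoff δ x) 2 mu
      + eLpNorm (fun x => weakDeriv f x - deriv (fun x => f x * cutoff δ x) x) 2 mu
      ≤ 2 * (ENNReal.ofReal C * ENNReal.ofReal (4 * δ) ^ (1 / 2 : ℝ)) := by
    intro δ hδ
    have hm : MeasurableSet {x : ℝ | 1 - x ^ 2 ≤ 2 * δ} :=
      measurableSet_le (by fun_prop) measurable_const
    have bound : ∀ h : ℝ → ℝ, (∀ᵐ x ∂mu, ‖h x‖ ≤ ‖({x : ℝ | 1 - x ^ 2 ≤ 2 * δ}.indicator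
        (fun _ => C)) x‖) →
        eLpNorm h 2 mu ≤ ENNReal.ofReal C * ENNReal.ofReal (4 * δ) ^ (1 / 2 : ℝ) := by
      intro h hh
      refine (eLpNorm_mono_ae hh).trans ?_
      rw [eLpNorm_indicator_const hm (by norm_num) (by norm_num), Real.enorm_eq_ofReal hC0]
      refine mul_le_mul' le_rfl ?_
      rw [ENNReal.toReal_ofNat]
      exact ENNReal.rpow_le_rpow mu_boundary_layer_le (by norm_num)
    have h01 : ∀ x, |1 - cutoff δ x| ≤ 1 := fun x => by
      have ha := Real.smoothTransition.nonneg ((1 - x ^ 2) / δ - 1)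
      have hb := Real.smoothTransition.le_one ((1 - x ^ 2) / δ - 1)
      rw [abs_le, cutoff]; constructor <;> linarith
    have hone : ∀ x, ¬ (1 - x ^ 2 ≤ 2 * δ) → cutoff δ x = 1 := fun x hx => by
      apply Real.smoothTransition.one_of_one_le
      rw [le_sub_iff_add_le, le_div_iff₀ hδ]
      linarith
    rw [two_mul]
    refine add_le_add (bound _ ?_) (bound _ ?_)
    · filter_upwards [ae_mu_mem] with x hx
      by_cases hb : 1 - x ^ 2 ≤ 2 * δ
      · rw [indicator_of_mem (show x ∈ {x : ℝ | 1 - x ^ 2 ≤ 2 * δ} from hb), Real.norm_eq_abs,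
          Real.norm_eq_abs, abs_of_nonneg hC0,
          show f x - f x * cutoff δ x = f x * (1 - cutoff δ x) by ring, abs_mul]
        have e1 := hL2 x (Ioo_subset_Icc_self hx)
        have e2 : L * (1 - x ^ 2) ≤ L := by nlinarith [sq_nonneg x]
        calc |f x| * |1 - cutoff δ x| ≤ L * 1 :=
              mul_le_mul (e1.trans e2) (h01 x) (abs_nonneg _) hL0
          _ ≤ C := by
              have : 0 ≤ L * 2 * K * 2 := by positivity
              simp only [C]; linarith
      · rw [hone x hb]; simp
    · filter_upwards [ae_mu_mem, weakDeriv_of_contDiff hf1] with x hx hw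
      have hd : deriv (fun x => f x * cutoff δ x) x
          = deriv f x * cutoff δ x + f x * deriv (cutoff δ) x :=
        deriv_fun_mul (hf1.differentiable (by simp) x)
          ((contDiff_cutoff δ).differentiable (by simp) x)
      rw [hw, hd, deriv_cutoff]
      by_cases hb : 1 - x ^ 2 ≤ 2 * δ
      · rw [indicator_of_mem (show x ∈ {x : ℝ | 1 - x ^ 2 ≤ 2 * δ} from hb), Real.norm_eq_abs,
          Real.norm_eq_abs, abs_of_nonneg hC0]
        set y := (1 - x ^ 2) / δ - 1
        have hx2 : 0 ≤ 1 - x ^ 2 := by nlinarith [hx.1, hx.2]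
        have hy : y ∈ Icc (-1 : ℝ) 1 := by
          constructor
          · have : 0 ≤ (1 - x ^ 2) / δ := by positivity
            simp only [y]; linarith
          · simp only [y]
            rw [sub_le_iff_le_add, div_le_iff₀ hδ]
            linarith
        have e1 := hL2 x (Ioo_subset_Icc_self hx)
        have e3 := hL1 x (Ioo_subset_Icc_self hx)
        have e4 := hK y hy
        rw [Real.norm_eq_abs] at e4
        have e5 : |-(2 * x) / δ| ≤ 2 / δ := by
          rw [abs_div, abs_of_pos hδ, abs_neg, abs_mul, abs_two]
          gcongr
          have : |x| ≤ 1 := abs_le.2 ⟨hx.1.le, hx.2.le⟩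
          linarith
        have e6 : |f x| ≤ L * (2 * δ) := e1.trans (mul_le_mul_of_nonneg_left hb hL0)
        have e7 : |f x * (deriv Real.smoothTransition y * (-(2 * x) / δ))| ≤ L * 2 * K * 2 := by
          rw [abs_mul, abs_mul]
          calc |f x| * (|deriv Real.smoothTransition y| * |-(2 * x) / δ|)
              ≤ (L * (2 * δ)) * (K * (2 / δ)) := by gcongr
            _ = L * 2 * K * 2 := by field_simp
        have e8 : |deriv f x * (1 - cutoff δ x)| ≤ L := by
          rw [abs_mul]
          calc |deriv f x| * |1 - cutoff δ x| ≤ L * 1 := mul_le_mul e3 (h01 x) (abs_nonneg _) hL0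
            _ = L := mul_one L
        calc _ = |deriv f x * (1 - cutoff δ x)
              - f x * (deriv Real.smoothTransition y * (-(2 * x) / δ))| := by congr 1; ring
          _ ≤ _ := (abs_sub _ _).trans (add_le_add e8 e7)
      · have hy : 1 < (1 - x ^ 2) / δ - 1 := by
          rw [lt_sub_iff_add_lt, lt_div_iff₀ hδ]
          linarith [not_le.1 hb]
        rw [hone x hb, deriv_smoothTransition_eq_zero_of_gt hy]
        simp
  intro ε hε
  have hlim : Tendsto (fun δ : ℝ => 2 * (ENNReal.ofReal C * ENNReal.ofReal (4 * δ) ^ (1 / 2 : ℝ)))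
      (𝓝[>] 0) (𝓝 0) := by
    have t1 : Tendsto (fun δ : ℝ => ENNReal.ofReal (4 * δ) ^ (1 / 2 : ℝ)) (𝓝 0)
        (𝓝 (ENNReal.ofReal (4 * 0) ^ (1 / 2 : ℝ))) :=
      (ENNReal.continuous_rpow_const.comp (ENNReal.continuous_ofReal.comp
        (continuous_const.mul continuous_id))).tendsto 0
    rw [mul_zero, ENNReal.ofReal_zero, ENNReal.zero_rpow_of_pos (by norm_num)] at t1
    have t2 := ENNReal.Tendsto.const_mul (a := ENNReal.ofReal C) t1 (Or.inr ENNReal.ofReal_ne_top)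
    have t3 := ENNReal.Tendsto.const_mul (a := 2) t2 (Or.inr (by norm_num))
    simp only [mul_zero] at t3
    exact t3.mono_left nhdsWithin_le_nhds
  obtain ⟨δ, h3, h4⟩ := ((hlim.eventually (gt_mem_nhds hε)).and self_mem_nhdsWithin).exists
  exact ⟨_, isTest_mul_cutoff hf h4, (key δ h4).trans_lt h3⟩

theorem HasWeakDeriv.add_const_mul {u v g k : ℝ → ℝ} (hu : HasWeakDeriv u g)
    (hv : HasWeakDeriv v k) (hu2 : MemL2 u) (hv2 : MemL2 v) (hg : MemL2 g) (hk : MemL2 k) (t : ℝ) :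
    HasWeakDeriv (fun x => u x + t * v x) (fun x => g x + t * k x) := by
  have a1 : MemL2 (fun x => u x + t * v x) := MemLp.add hu2 (MemLp.const_mul hv2 t)
  have a2 : MemL2 (fun x => g x + t * k x) := MemLp.add hg (MemLp.const_mul hk t)
  refine ⟨a1.locallyIntegrableOn, a2.locallyIntegrableOn, fun φ hφ => ?_⟩
  have b1 : MemL2 φ := memL2_of_continuousOn hφ.smooth.continuous.continuousOn
  have b2 : MemL2 (deriv φ) := memL2_of_continuousOn
    ((hφ.smooth.of_le (m := 1) (by simp)).continuous_deriv le_rfl).continuousOn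
  have i : ∀ {p q : ℝ → ℝ}, MemL2 p → MemL2 q → IntegrableOn (fun x => p x * q x) (Ioo (-1) 1) :=
    fun hp hq => integrable_mu_iff.2 (hp.mul hq)
  simp_rw [add_mul, mul_assoc]
  rw [integral_add (i hu2 b2) ((i hv2 b2).const_mul t),
    integral_add (i hg b1) ((i hk b1).const_mul t), integral_const_mul, integral_const_mul,
    hu.parts φ hφ, hv.parts φ hφ]
  ring

theorem MemW12.weakDeriv_add_const_mul {u v : ℝ → ℝ} (hu : MemW12 u) (hv : MemW12 v) (t : ℝ) :
    weakDeriv (fun x => u x + t * v x) =ᵐ[mu] fun x => weakDeriv u x + t * weakDeriv v x :=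
  (hu.hasWeakDeriv.add_const_mul hv.hasWeakDeriv hu.memL2 hv.memL2 hu.memL2_weakDeriv
    hv.memL2_weakDeriv t).weakDeriv_ae_eq

theorem weakDeriv_congr {u v : ℝ → ℝ} (hu : MemW12 u) (h : u =ᵐ[mu] v) :
    weakDeriv u =ᵐ[mu] weakDeriv v :=
  (hu.hasWeakDeriv.congr h EventuallyEq.rfl).weakDeriv_ae_eq.symm

/-! ### Absolutely continuous functions with a given derivative -/

/-- `f` is absolutely continuous on the interval from `a` to `b` and has derivative `f'` almost
everywhere there. -/
structure IsACWith (f f' : ℝ → ℝ) (a b : ℝ) : Prop where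
  ac : AbsolutelyContinuousOnInterval f a b
  ae : ∀ᵐ x, x ∈ uIcc a b → HasDerivAt f (f' x) x

namespace IsACWith

variable {f f' g g' : ℝ → ℝ} {a b : ℝ}

theorem primitive {c : ℝ} (h : IntervalIntegrable f volume a b) (hc : c ∈ uIcc a b) :
    IsACWith (fun x => ∫ y in c..x, f y) f a b :=
  ⟨h.absolutelyContinuousOnInterval_intervalIntegral hc,
    h.ae_hasDerivAt_integral.mono fun _ hx hm => hx hm c hc⟩

theorem mono (h : IsACWith f f' a b) {c d : ℝ} (hs : uIcc c d ⊆ uIcc a b) : IsACWith f f' c d :=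
  ⟨h.ac.mono hs, h.ae.mono fun _ hx hm => hx (hs hm)⟩

theorem add (hf : IsACWith f f' a b) (hg : IsACWith g g' a b) :
    IsACWith (fun x => f x + g x) (fun x => f' x + g' x) a b :=
  ⟨hf.ac.add hg.ac, by
    filter_upwards [hf.ae, hg.ae] with x h1 h2 hm using (h1 hm).fun_add (h2 hm)⟩

theorem mul (hf : IsACWith f f' a b) (hg : IsACWith g g' a b) :
    IsACWith (fun x => f x * g x) (fun x => f' x * g x + f x * g' x) a b :=
  ⟨hf.ac.mul hg.ac, by
    filter_upwards [hf.ae, hg.ae] with x h1 h2 hm using (h1 hm).fun_mul (h2 hm)⟩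

theorem of_contDiff (hf : ContDiff ℝ 1 f) : IsACWith f (deriv f) a b :=
  ⟨hf.contDiffOn.absolutelyContinuousOnInterval,
    Eventually.of_forall fun x _ => (hf.differentiable (by simp) x).hasDerivAt⟩

/-- On the convex set `s` the bounded derivative makes `F` Lipschitz, and Lipschitz functions
preserve absolute continuity. The set allows for `exp` and `log`, which are Lipschitz only on part
of the line. -/
theorem comp {F F' : ℝ → ℝ} {s : Set ℝ} {K : ℝ} (hf : IsACWith f f' a b) (hs : Convex ℝ s)
    (hfs : ∀ x ∈ uIcc a b, f x ∈ s) (hF : ∀ y ∈ s, HasDerivAt F (F' y) y)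
    (hK : ∀ y ∈ s, |F' y| ≤ K) :
    IsACWith (fun x => F (f x)) (fun x => F' (f x) * f' x) a b := by
  refine ⟨?_, ?_⟩
  · have hLip : ∀ x ∈ uIcc a b, ∀ y ∈ uIcc a b, dist (F (f x)) (F (f y)) ≤ K * dist (f x) (f y) := by
      intro x hx y hy
      rw [dist_eq_norm, dist_eq_norm]
      exact hs.norm_image_sub_le_of_norm_hasDerivWithin_le
        (fun z hz => (hF z hz).hasDerivWithinAt) hK (hfs y hy) (hfs x hx)
    have h0 := hf.ac
    rw [absolutelyContinuousOnInterval_iff] at h0 ⊢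
    intro ε hε
    have hK0 : 0 ≤ K := (abs_nonneg _).trans (hK _ (hfs a left_mem_uIcc))
    obtain ⟨δ, hδ, h1⟩ := h0 (ε / (K + 1)) (by positivity)
    refine ⟨δ, hδ, fun E hE hlt => ?_⟩
    have h2 := h1 E hE hlt
    have hm : ∀ i ∈ Finset.range E.1, (E.2 i).1 ∈ uIcc a b ∧ (E.2 i).2 ∈ uIcc a b := by
      intro i hi
      exact hE.1 i hi
    calc ∑ i ∈ Finset.range E.1, dist (F (f (E.2 i).1)) (F (f (E.2 i).2))
        ≤ ∑ i ∈ Finset.range E.1, K * dist (f (E.2 i).1) (f (E.2 i).2) :=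
          Finset.sum_le_sum fun i hi => hLip _ (hm i hi).1 _ (hm i hi).2
      _ = K * ∑ i ∈ Finset.range E.1, dist (f (E.2 i).1) (f (E.2 i).2) := by
          rw [Finset.mul_sum]
      _ ≤ K * (ε / (K + 1)) := mul_le_mul_of_nonneg_left h2.le hK0
      _ < ε := by
          rw [mul_div_assoc', div_lt_iff₀ (by positivity)]
          nlinarith
  · filter_upwards [hf.ae] with x hx hm
    exact (hF _ (hfs x hm)).comp x (hx hm)

theorem exp (hf : IsACWith f f' a b) :
    IsACWith (fun x => Real.exp (f x)) (fun x => Real.exp (f x) * f' x) a b := by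
  obtain ⟨C, hC⟩ := hf.ac.exists_bound
  exact hf.comp (convex_Iic C) (fun x hx => (le_abs_self _).trans (hC x hx))
    (fun y _ => Real.hasDerivAt_exp y) (K := Real.exp C)
    (fun y hy => by rw [abs_of_pos (Real.exp_pos y)]; exact Real.exp_le_exp.2 hy)

theorem log (hf : IsACWith f f' a b) (hpos : ∀ x ∈ uIcc a b, 0 < f x) :
    IsACWith (fun x => Real.log (f x)) (fun x => (f x)⁻¹ * f' x) a b := by
  obtain ⟨x₀, h0, hmin⟩ := isCompact_uIcc.exists_isMinOn nonempty_uIcc hf.ac.continuousOn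
  have h1 := hpos x₀ h0
  exact hf.comp (convex_Ici (f x₀)) (fun x hx => hmin hx)
    (fun y hy => Real.hasDerivAt_log (h1.trans_le hy).ne') (K := (f x₀)⁻¹)
    (fun y hy => by
      rw [abs_of_pos (inv_pos.2 (h1.trans_le hy))]; exact inv_anti₀ h1 hy)

theorem congr_deriv (hf : IsACWith f f' a b) (h : ∀ x ∈ uIcc a b, f' x = g' x) :
    IsACWith f g' a b :=
  ⟨hf.ac, hf.ae.mono fun x hx hm => h x hm ▸ hx hm⟩

theorem congr_fun (hf : IsACWith f f' a b) (h : ∀ x, f x = g x) : IsACWith g f' a b := by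
  have : f = g := funext h
  rwa [← this]

theorem deriv_ae_eq (hf : IsACWith f f' a b) :
    ∀ᵐ x, x ∈ uIoc a b → deriv f x = f' x := by
  filter_upwards [hf.ae] with x hx hm using (hx (uIoc_subset_uIcc hm)).deriv

theorem intervalIntegrable (hf : IsACWith f f' a b) : IntervalIntegrable f' volume a b :=
  hf.ac.intervalIntegrable_deriv.congr_ae
    ((ae_restrict_iff' measurableSet_uIoc).2 hf.deriv_ae_eq)

theorem integral_eq (hf : IsACWith f f' a b) : ∫ x in a..b, f' x = f b - f a := by
  rw [← hf.ac.integral_deriv_eq_sub]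
  exact (intervalIntegral.integral_congr_ae hf.deriv_ae_eq).symm

theorem continuousOn (hf : IsACWith f f' a b) : ContinuousOn f (uIcc a b) := hf.ac.continuousOn

end IsACWith

/-! ### A first order lower bound for the energy density

The energy is the (renormalised) energy of a curve in the complex hyperbolic plane, and the bound is
obtained by completing the square with the gradient of the Busemann function of the initial point of
the curve. -/

/-- The last fraction on the left is `(log N)'` written out. The right-hand squares are chosen so
that the terms linear in the velocities `υ, s, τ, w` agree; the remaining terms agree because the
Busemann function has a gradient of constant length. -/
theorem energy_density_identity {x X υ s τ w ψ T t A N : ℝ} (h1 : 1 - x ^ 2 ≠ 0) (h2 : 1 + x ≠ 0)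
    (hX : X ≠ 0) (hA : A = X * (1 - x ^ 2) + ψ ^ 2 + T ^ 2) (hN : N = A ^ 2 + t ^ 2)
    (hN0 : N ≠ 0) :
    υ ^ 2 * (1 - x ^ 2) - 2 * x * υ + (s ^ 2 + τ ^ 2) / X + w ^ 2 * (X ^ 2 * (1 - x ^ 2))
      - 1 + 2 * υ + 2 / (1 + x)
      - (2 * A * (2 * υ * (X * (1 - x ^ 2)) - 2 * x * X + 2 * ψ * s + 2 * T * τ)
          + 2 * t * (2 * w * (X ^ 2 * (1 - x ^ 2)) - 2 * (ψ * τ - T * s))) / N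
    = (1 - x ^ 2) * (υ - (x + 2 * (X * (1 - x ^ 2)) * A / N - 1) / (1 - x ^ 2)) ^ 2
      + (s - 2 * X * (ψ * A + t * T) / N) ^ 2 / X + (τ - 2 * X * (T * A - t * ψ) / N) ^ 2 / X
      + X ^ 2 * (1 - x ^ 2) * (w - 2 * t / N) ^ 2 := by
  have h3 : 1 - x ^ 2 = (1 + x) * (1 - x) := by ring
  have h4 : 1 - x ≠ 0 := fun h => h1 (by rw [h3, h, mul_zero])
  have hz : ψ ^ 2 = A - X * (1 - x ^ 2) - T ^ 2 := by rw [hA]; ring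
  have e1 : (ψ * A + t * T) ^ 2 + (T * A - t * ψ) ^ 2 = (A - X * (1 - x ^ 2)) * N := by
    rw [hN]; linear_combination (A ^ 2 + t ^ 2) * hz
  have e2 : 2 / (1 + x) = 1 + (1 - 2 * x + x ^ 2) / (1 - x ^ 2) := by
    rw [h3]; field_simp; ring
  have f1 : ∀ v p : ℝ, (v - 2 * X * p) ^ 2 / X = v ^ 2 / X - 4 * v * p + 4 * X * p ^ 2 := by
    intro v p; field_simp; ring
  have f2 : ∀ b : ℝ, (1 - x ^ 2) * (υ - b / (1 - x ^ 2)) ^ 2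
      = (1 - x ^ 2) * υ ^ 2 - 2 * υ * b + b ^ 2 / (1 - x ^ 2) := by
    intro b; field_simp; ring
  -- This is the eikonal equation: with `h = X(1-x²)`, the square `(1 - 2hA/N)²` plus `4h` times the
  -- left-hand side equals `1`.
  have f3 : ((ψ * A + t * T) / N) ^ 2 + ((T * A - t * ψ) / N) ^ 2 + X * (1 - x ^ 2) * (t / N) ^ 2
      = A / N - X * (1 - x ^ 2) * (A / N) ^ 2 := by
    rw [div_pow, div_pow, ← add_div, e1]
    field_simp
    rw [hN]; ring
  have f4 : (x + 2 * (X * (1 - x ^ 2)) * A / N - 1) ^ 2 / (1 - x ^ 2)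
      = (1 - 2 * x + x ^ 2) / (1 - x ^ 2) + 4 * (x - 1) * X * (A / N)
        + 4 * X ^ 2 * (1 - x ^ 2) * (A / N) ^ 2 := by
    generalize hY : 1 - x ^ 2 = Y at h1 ⊢
    field_simp
    ring
  rw [e2, f2, f4]
  simp only [mul_div_assoc (2 * X), f1]
  linear_combination (-4 * X) * f3

/-- The primitive that vanishes at `-1`. -/
noncomputable def prim (f : ℝ → ℝ) (x : ℝ) : ℝ := ∫ y in (-1)..x, f y

theorem uIcc_neg_one_one : uIcc (-1 : ℝ) 1 = Icc (-1) 1 := uIcc_of_le (by norm_num)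

theorem prim_neg_one (f : ℝ → ℝ) : prim f (-1) = 0 := intervalIntegral.integral_same

theorem isACWith_prim {f : ℝ → ℝ} (h : IntervalIntegrable f volume (-1) 1) :
    IsACWith (prim f) f (-1) 1 :=
  IsACWith.primitive h left_mem_uIcc

theorem isACWith_one_sub_sq {a b : ℝ} : IsACWith (fun x => 1 - x ^ 2) (fun x => -2 * x) a b := by
  refine (IsACWith.of_contDiff (f := fun x : ℝ => 1 - x ^ 2) (by fun_prop)).congr_deriv ?_
  intro x _
  have : HasDerivAt (fun x : ℝ => 1 - x ^ 2) (-(2 * x)) x := by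
    simpa using ((hasDerivAt_id x).fun_pow 2).const_sub 1
  rw [this.deriv]; ring

/-- The Cauchy-Schwarz inequality, obtained from the nonnegative variance of `f` around its mean `m`
on `(-1,x)`. -/
theorem prim_sq_le {f : ℝ → ℝ} (hf : MemL2 f) {x : ℝ} (hx : x ∈ Ioc (-1 : ℝ) 1) :
    prim f x ^ 2 ≤ (1 + x) * prim (fun y => f y ^ 2) x := by
  have hx0 : 0 < 1 + x := by linarith [hx.1]
  have i1 : IntervalIntegrable f volume (-1) x :=
    hf.intervalIntegrable_sub (by norm_num) ⟨hx.1.le, hx.2⟩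
  have i2 : IntervalIntegrable (fun y => f y ^ 2) volume (-1) x := by
    refine IntervalIntegrable.mono_set (hf.mul hf |>.congr_ae ?_) ?_ (b := 1) (a := -1)
    · exact Eventually.of_forall fun y => by simp [sq]
    · rw [uIcc_neg_one_one]; exact uIcc_subset_Icc (by norm_num) ⟨hx.1.le, hx.2⟩
  set m := prim f x / (1 + x)
  have h0 : 0 ≤ ∫ y in (-1)..x, (f y - m) ^ 2 :=
    intervalIntegral.integral_nonneg hx.1.le fun y _ => sq_nonneg _
  have h1 : ∫ y in (-1)..x, (f y - m) ^ 2
      = prim (fun y => f y ^ 2) x - 2 * m * prim f x + m ^ 2 * (1 + x) := by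
    simp_rw [sub_sq, mul_right_comm 2 _ m]
    rw [intervalIntegral.integral_add (i2.sub (i1.const_mul _)) (by simp),
      intervalIntegral.integral_sub i2 (i1.const_mul _), intervalIntegral.integral_const_mul,
      intervalIntegral.integral_const, prim, prim]
    simp only [smul_eq_mul]; ring
  rw [h1] at h0
  have h2 : m * (1 + x) = prim f x := div_mul_cancel₀ _ hx0.ne'
  nlinarith

/-! ### The curve with velocities `S`, `T'`, `U'` and rotation parameter `w`. -/

section Curve

variable (s τ υ : ℝ → ℝ) (w : ℝ)

/-- The derivative of the twist potential. -/
noncomputable def twist' (x : ℝ) : ℝ :=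
  2 * w * (Real.exp (4 * prim υ x) * (1 - x ^ 2)) - 2 * (prim s x * τ x - prim τ x * s x)

/-- The twist potential. -/
noncomputable def twist : ℝ → ℝ := prim (twist' s τ υ w)

/-- The real part of the Ernst potential. -/
noncomputable def ernstRe (x : ℝ) : ℝ :=
  Real.exp (2 * prim υ x) * (1 - x ^ 2) + prim s x ^ 2 + prim τ x ^ 2

/-- The derivative of the real part of the Ernst potential. -/
noncomputable def ernstRe' (x : ℝ) : ℝ :=
  2 * υ x * (Real.exp (2 * prim υ x) * (1 - x ^ 2)) - 2 * x * Real.exp (2 * prim υ x)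
    + 2 * prim s x * s x + 2 * prim τ x * τ x

/-- The squared modulus of the Ernst potential. -/
noncomputable def ernstSq (x : ℝ) : ℝ := ernstRe s τ υ x ^ 2 + twist s τ υ w x ^ 2

/-- The energy density, including the rotational part. -/
noncomputable def energyDensity (x : ℝ) : ℝ :=
  υ x ^ 2 * (1 - x ^ 2) - 2 * x * υ x + (s x ^ 2 + τ x ^ 2) * Real.exp (-2 * prim υ x)
    + w ^ 2 * (Real.exp (4 * prim υ x) * (1 - x ^ 2))

/-- The deviation from the first order system. -/
noncomputable def defect (x : ℝ) : ℝ :=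
  (1 - x ^ 2) * (υ x - (x + 2 * (Real.exp (2 * prim υ x) * (1 - x ^ 2)) * ernstRe s τ υ x
      / ernstSq s τ υ w x - 1) / (1 - x ^ 2)) ^ 2
    + (s x - 2 * Real.exp (2 * prim υ x) * (prim s x * ernstRe s τ υ x
        + twist s τ υ w x * prim τ x) / ernstSq s τ υ w x) ^ 2 / Real.exp (2 * prim υ x)
    + (τ x - 2 * Real.exp (2 * prim υ x) * (prim τ x * ernstRe s τ υ x
        - twist s τ υ w x * prim s x) / ernstSq s τ υ w x) ^ 2 / Real.exp (2 * prim υ x)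
    + Real.exp (2 * prim υ x) ^ 2 * (1 - x ^ 2)
      * (w - 2 * twist s τ υ w x / ernstSq s τ υ w x) ^ 2

variable {s τ υ w}

theorem exp_four_eq (u : ℝ) : Real.exp (4 * u) = Real.exp (2 * u) ^ 2 := by
  rw [← Real.exp_nat_mul]; push_cast; ring_nf

theorem defect_nonneg {x : ℝ} (hx : x ∈ Icc (-1 : ℝ) 1) : 0 ≤ defect s τ υ w x := by
  have : 0 ≤ 1 - x ^ 2 := by nlinarith [hx.1, hx.2]
  unfold defect
  positivity

theorem ernstRe_pos {x : ℝ} (hx : x ∈ Ioo (-1 : ℝ) 1) : 0 < ernstRe s τ υ x := by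
  have : 0 < 1 - x ^ 2 := by nlinarith [hx.1, hx.2]
  unfold ernstRe
  positivity

theorem ernstSq_pos {x : ℝ} (hx : x ∈ Ioo (-1 : ℝ) 1) : 0 < ernstSq s τ υ w x := by
  have := ernstRe_pos (s := s) (τ := τ) (υ := υ) hx
  unfold ernstSq
  positivity

/-- The identity in the form to be integrated: apart from the energy density, all terms on the right
are derivatives of `x`, `2U`, `2 log(1+x)` and `log N`. -/
theorem defect_eq {x : ℝ} (hx : x ∈ Ioo (-1 : ℝ) 1) :
    defect s τ υ w x = energyDensity s τ υ w x - 1 + 2 * υ x + 2 * (1 + x)⁻¹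
      - (ernstSq s τ υ w x)⁻¹ * (2 * ernstRe s τ υ x * ernstRe' s τ υ x
        + 2 * twist s τ υ w x * twist' s τ υ w x) := by
  have h1 : 1 - x ^ 2 ≠ 0 := by nlinarith [hx.1, hx.2]
  have h2 : 1 + x ≠ 0 := by linarith [hx.1]
  have := energy_density_identity (υ := υ x) (s := s x) (τ := τ x) (w := w) h1 h2
    (Real.exp_ne_zero (2 * prim υ x)) (A := ernstRe s τ υ x) (ψ := prim s x) (T := prim τ x)
    (t := twist s τ υ w x) rfl rfl (ernstSq_pos hx).ne'
  change _ = defect s τ υ w x at this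
  rw [← this, energyDensity, twist', exp_four_eq, ernstRe',
    show -2 * prim υ x = -(2 * prim υ x) by ring, Real.exp_neg]
  simp only [div_eq_mul_inv, ernstSq]
  ring

/-! ### Integration of the defect and the behaviour at the initial point. -/

section Regularity

variable (hs : MemL2 s) (hτ : MemL2 τ) (hυ : MemL2 υ)

include hs hτ hυ

theorem intervalIntegrable_twist' : IntervalIntegrable (twist' s τ υ w) volume (-1) 1 := by
  have c1 := (isACWith_prim hs.intervalIntegrable).continuousOn
  have c2 := (isACWith_prim hτ.intervalIntegrable).continuousOn
  have c3 := (isACWith_prim hυ.intervalIntegrable).continuousOn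
  have i1 : IntervalIntegrable (fun x => 2 * w * (Real.exp (4 * prim υ x) * (1 - x ^ 2)))
      volume (-1) 1 := ContinuousOn.intervalIntegrable (by fun_prop)
  exact i1.sub (((hτ.intervalIntegrable.continuousOn_mul c1).sub
    (hs.intervalIntegrable.continuousOn_mul c2)).const_mul 2)

theorem isACWith_twist : IsACWith (twist s τ υ w) (twist' s τ υ w) (-1) 1 :=
  isACWith_prim (intervalIntegrable_twist' hs hτ hυ)

theorem isACWith_ernstRe : IsACWith (ernstRe s τ υ) (ernstRe' s τ υ) (-1) 1 := by
  have a1 := isACWith_prim hs.intervalIntegrable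
  have a2 := isACWith_prim hτ.intervalIntegrable
  have a3 := isACWith_prim hυ.intervalIntegrable
  have a4 := (a3.add a3).exp
  refine ((((a4.mul isACWith_one_sub_sq).add (a1.mul a1)).add (a2.mul a2)).congr_deriv ?_).congr_fun
    ?_
  · intro x _
    rw [ernstRe', two_mul (prim υ x)]; ring
  · intro x
    rw [ernstRe, two_mul (prim υ x)]; ring

theorem isACWith_ernstSq : IsACWith (ernstSq s τ υ w)
    (fun x => 2 * ernstRe s τ υ x * ernstRe' s τ υ x
      + 2 * twist s τ υ w x * twist' s τ υ w x) (-1) 1 := by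
  have a1 := isACWith_ernstRe hs hτ hυ
  have a2 := isACWith_twist (w := w) hs hτ hυ
  refine (((a1.mul a1).add (a2.mul a2)).congr_deriv fun x _ => ?_).congr_fun fun x => ?_
  · ring
  · rw [ernstSq]; ring

theorem intervalIntegrable_energyDensity :
    IntervalIntegrable (energyDensity s τ υ w) volume (-1) 1 := by
  have c3 := (isACWith_prim hυ.intervalIntegrable).continuousOn
  have i : ∀ {f : ℝ → ℝ}, MemL2 f → IntervalIntegrable (fun x => f x ^ 2) volume (-1) 1 := by
    intro f hf; simpa only [sq] using hf.mul hf
  have i1 : IntervalIntegrable (fun x => w ^ 2 * (Real.exp (4 * prim υ x) * (1 - x ^ 2)))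
      volume (-1) 1 := ContinuousOn.intervalIntegrable (by fun_prop)
  exact ((((i hυ).mul_continuousOn (by fun_prop)).sub
    (hυ.intervalIntegrable.continuousOn_mul (by fun_prop))).add
    (((i hs).add (i hτ)).mul_continuousOn (by fun_prop))).add i1

/-- The interval starts at `a > -1` because `log N` and `log(1+x)` diverge at `-1`. At `1` the term
`ψ²+T²+t²` may vanish, whence the hypothesis `hN`. -/
theorem integral_defect (hN : 0 < ernstSq s τ υ w 1) {a : ℝ} (ha : a ∈ Ioo (-1 : ℝ) 1) :
    IntervalIntegrable (defect s τ υ w) volume a 1 ∧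
    ∫ x in a..1, defect s τ υ w x = (∫ x in a..1, energyDensity s τ υ w x) - (1 - a)
      + 2 * (prim υ 1 - prim υ a) + 2 * (Real.log 2 - Real.log (1 + a))
      - (Real.log (ernstSq s τ υ w 1) - Real.log (ernstSq s τ υ w a)) := by
  have hsub : uIcc a 1 ⊆ uIcc (-1) 1 := by
    rw [uIcc_neg_one_one]; exact uIcc_subset_Icc (Ioo_subset_Icc_self ha) (by norm_num)
  have hmem : ∀ x ∈ uIcc a 1, -1 < x ∧ x ≤ 1 := by
    intro x hx; rw [uIcc_of_le ha.2.le] at hx; exact ⟨ha.1.trans_le hx.1, hx.2⟩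
  have hpos : ∀ x ∈ uIcc a 1, 0 < ernstSq s τ υ w x := by
    intro x hx
    obtain ⟨h1, h2⟩ := hmem x hx
    rcases h2.eq_or_lt with rfl | h2
    · exact hN
    · exact ernstSq_pos ⟨h1, h2⟩
  have l1 := ((isACWith_ernstSq (w := w) hs hτ hυ).mono hsub).log hpos
  have l2 := (isACWith_prim hυ.intervalIntegrable).mono hsub
  have l3 : IsACWith (fun x => Real.log (1 + x)) (fun x => (1 + x)⁻¹ * 1) a 1 := by
    refine IsACWith.log ((IsACWith.of_contDiff (by fun_prop)).congr_deriv fun x _ => ?_) ?_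
    · exact ((hasDerivAt_id x).const_add 1).deriv
    · intro x hx; linarith [(hmem x hx).1]
  have i0 := (intervalIntegrable_energyDensity (w := w) hs hτ hυ).mono_set hsub
  have i1 : IntervalIntegrable (fun _ : ℝ => (1 : ℝ)) volume a 1 := by simp
  have key : ∀ x ∈ Ioo a 1, defect s τ υ w x = energyDensity s τ υ w x - 1 + 2 * υ x
      + 2 * ((1 + x)⁻¹ * 1) - (ernstSq s τ υ w x)⁻¹ * (2 * ernstRe s τ υ x * ernstRe' s τ υ x
        + 2 * twist s τ υ w x * twist' s τ υ w x) := by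
    intro x hx
    rw [mul_one]
    exact defect_eq ⟨ha.1.trans hx.1, hx.2⟩
  -- The pointwise identity divides by `1 - x²`, so the end point `x = 1` is discarded as a null
  -- set.
  have key' : ∀ᵐ x, x ∈ uIoc a 1 → energyDensity s τ υ w x - 1 + 2 * υ x
      + 2 * ((1 + x)⁻¹ * 1) - (ernstSq s τ υ w x)⁻¹ * (2 * ernstRe s τ υ x * ernstRe' s τ υ x
        + 2 * twist s τ υ w x * twist' s τ υ w x) = defect s τ υ w x := by
    have : ∀ᵐ x : ℝ, x ≠ 1 := Measure.ae_ne volume 1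
    filter_upwards [this] with x h1 hx
    rw [uIoc_of_le ha.2.le] at hx
    exact (key x ⟨hx.1, lt_of_le_of_ne hx.2 h1⟩).symm
  have ii := (((i0.sub i1).add (l2.intervalIntegrable.const_mul 2)).add
    (l3.intervalIntegrable.const_mul 2)).sub l1.intervalIntegrable
  refine ⟨ii.congr_ae ((ae_restrict_iff' measurableSet_uIoc).2 key'), ?_⟩
  rw [← intervalIntegral.integral_congr_ae key',
    intervalIntegral.integral_sub (((i0.sub i1).add (l2.intervalIntegrable.const_mul 2)).add
      (l3.intervalIntegrable.const_mul 2)) l1.intervalIntegrable,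
    intervalIntegral.integral_add ((i0.sub i1).add (l2.intervalIntegrable.const_mul 2))
      (l3.intervalIntegrable.const_mul 2),
    intervalIntegral.integral_add (i0.sub i1) (l2.intervalIntegrable.const_mul 2),
    intervalIntegral.integral_sub i0 i1, intervalIntegral.integral_const_mul,
    intervalIntegral.integral_const_mul, l1.integral_eq, l2.integral_eq, l3.integral_eq]
  norm_num

/-- Since `U(-1) = 0`, the term `e^{2U}(1-x²)` behaves like `2(1+x)`. By Cauchy-Schwarz `ψ²` and
`T²` are at most `(1+x)` times integrals over `(-1,x)`, which tend to `0`; the same smallness gives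
`t = o(1+x)`. The limit is thus the same for all triples. -/
theorem tendsto_ernstSq_div :
    Tendsto (fun x => ernstSq s τ υ w x / (1 + x) ^ 2) (𝓝[>] (-1)) (𝓝 4) := by
  have hIoc : ∀ᶠ x : ℝ in 𝓝[>] (-1), x ∈ Ioc (-1 : ℝ) 1 :=
    Ioc_mem_nhdsGT (by norm_num)
  have i : ∀ {f : ℝ → ℝ}, MemL2 f → IntervalIntegrable (fun x => f x ^ 2) volume (-1) 1 := by
    intro f hf; simpa only [sq] using hf.mul hf
  have a3 := isACWith_prim hυ.intervalIntegrable
  have lim : ∀ {f : ℝ → ℝ}, ContinuousOn f (uIcc (-1) 1) →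
      Tendsto f (𝓝[>] (-1)) (𝓝 (f (-1))) := by
    intro f hf
    rw [uIcc_neg_one_one] at hf
    exact ((hf (-1) (by norm_num)).mono_left (nhdsWithin_le_of_mem
      (mem_of_superset (Ioc_mem_nhdsGT (by norm_num)) Ioc_subset_Icc_self)))
  set ε : ℝ → ℝ := fun x => prim (fun y => s y ^ 2) x + prim (fun y => τ y ^ 2) x
  have hε : Tendsto ε (𝓝[>] (-1)) (𝓝 0) := by
    have := (lim (isACWith_prim (i hs)).continuousOn).add (lim (isACWith_prim (i hτ)).continuousOn)
    simpa [prim_neg_one] using this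
  have hnn : ∀ (f : ℝ → ℝ) {x : ℝ}, x ∈ Ioc (-1 : ℝ) 1 → 0 ≤ prim (fun y => f y ^ 2) x :=
    fun f x hx => intervalIntegral.integral_nonneg hx.1.le fun y _ => sq_nonneg _
  have hmono : ∀ {f : ℝ → ℝ}, MemL2 f → ∀ {y x : ℝ}, y ∈ Ioc (-1 : ℝ) 1 → x ∈ Ioc (-1 : ℝ) 1 →
      y ≤ x → prim (fun y => f y ^ 2) y ≤ prim (fun y => f y ^ 2) x := by
    intro f hf y x hy hx hyx
    refine intervalIntegral.integral_mono_interval le_rfl hy.1.le hyx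
      (Eventually.of_forall fun y => sq_nonneg _) ((i hf).mono_set ?_)
    rw [uIcc_neg_one_one]; exact uIcc_subset_Icc (by norm_num) ⟨hx.1.le, hx.2⟩
  -- the quotients of the squares
  have hsq : ∀ {f : ℝ → ℝ}, MemL2 f → (∀ x ∈ Ioc (-1 : ℝ) 1, prim (fun y => f y ^ 2) x ≤ ε x) →
      Tendsto (fun x => prim f x ^ 2 / (1 + x)) (𝓝[>] (-1)) (𝓝 0) := by
    intro f hf hle
    refine squeeze_zero' ?_ ?_ hε
    · filter_upwards [hIoc] with x hx
      have : 0 < 1 + x := by linarith [hx.1]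
      positivity
    · filter_upwards [hIoc] with x hx
      have : 0 < 1 + x := by linarith [hx.1]
      rw [div_le_iff₀ this, mul_comm]
      exact (prim_sq_le hf hx).trans (mul_le_mul_of_nonneg_left (hle x hx) this.le)
  have hsle : ∀ x ∈ Ioc (-1 : ℝ) 1, prim (fun y => s y ^ 2) x ≤ ε x := fun x hx => by
    have := hnn τ hx; simp only [ε]; linarith
  have hτle : ∀ x ∈ Ioc (-1 : ℝ) 1, prim (fun y => τ y ^ 2) x ≤ ε x := fun x hx => by
    have := hnn s hx; simp only [ε]; linarith
  have hA : Tendsto (fun x => ernstRe s τ υ x / (1 + x)) (𝓝[>] (-1)) (𝓝 2) := by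
    have l1 : Tendsto (fun x => Real.exp (2 * prim υ x) * (1 - x)) (𝓝[>] (-1))
        (𝓝 (Real.exp (2 * prim υ (-1)) * (1 - -1))) := by
      have c := a3.continuousOn
      exact lim (f := fun x => Real.exp (2 * prim υ x) * (1 - x)) (by fun_prop)
    have l2 := (l1.add (hsq hs hsle)).add (hsq hτ hτle)
    rw [prim_neg_one] at l2
    norm_num at l2
    refine l2.congr' ?_
    filter_upwards [hIoc] with x hx
    have : 1 + x ≠ 0 := by linarith [hx.1]
    rw [ernstRe]
    field_simp
    ring
  have ht : Tendsto (fun x => twist s τ υ w x / (1 + x)) (𝓝[>] (-1)) (𝓝 0) := by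
    have c : ContinuousOn (fun x => 2 * w * Real.exp (4 * prim υ x)) (Icc (-1) 1) := by
      have := a3.continuousOn
      rw [uIcc_neg_one_one] at this
      fun_prop
    obtain ⟨C, hC⟩ := isCompact_Icc.exists_bound_of_continuousOn c
    have hC0 : 0 ≤ C := (norm_nonneg _).trans (hC 0 (by norm_num))
    -- Young's inequality with weight `1+x`, because the primitive of `f` is of order `√(1+x)`
    -- whereas `k` is only square integrable.
    have prod : ∀ {f k : ℝ → ℝ}, MemL2 f → MemL2 k →
        (∀ x ∈ Ioc (-1 : ℝ) 1, prim (fun y => f y ^ 2) x ≤ ε x) →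
        ∀ x ∈ Ioc (-1 : ℝ) 1, ∀ y ∈ Ioc (-1 : ℝ) x,
        |prim f y * k y| ≤ (1 / 2) * (ε x + (1 + x) * k y ^ 2) := by
      intro f k hf hk hfe x hx y hy
      have hx0 : 0 < 1 + x := by linarith [hx.1]
      have hyI : y ∈ Ioc (-1 : ℝ) 1 := ⟨hy.1, hy.2.trans hx.2⟩
      have e1 : prim f y ^ 2 ≤ (1 + x) * ε x :=
        (prim_sq_le hf hyI).trans (mul_le_mul (by linarith [hy.2])
          ((hmono hf hyI hx hy.2).trans (hfe x hx)) (hnn f hyI) hx0.le)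
      have e2 : |prim f y * k y| * (1 + x) ≤ (1 / 2) * (prim f y ^ 2 + ((1 + x) * k y) ^ 2) := by
        rw [abs_mul]
        have := two_mul_le_add_sq |prim f y| |(1 + x) * k y|
        rw [sq_abs, sq_abs, abs_mul (1 + x), abs_of_pos hx0] at this
        nlinarith
      have e3 : |prim f y * k y| * (1 + x) ≤ (1 / 2) * (ε x + (1 + x) * k y ^ 2) * (1 + x) := by
        refine e2.trans ?_
        nlinarith
      exact le_of_mul_le_mul_right e3 hx0
    -- Of the `3ε`, two come from the bounds on the squared primitives and one from integrating `s²
    -- + τ²`.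
    have bound : ∀ x ∈ Ioc (-1 : ℝ) 1, |twist s τ υ w x| ≤ (1 + x) * (2 * C * (1 + x) + 3 * ε x) := by
      intro x hx
      have hx0 : 0 < 1 + x := by linarith [hx.1]
      have hsub : uIcc (-1) x ⊆ uIcc (-1) 1 := by
        rw [uIcc_neg_one_one]; exact uIcc_subset_Icc (by norm_num) ⟨hx.1.le, hx.2⟩
      have i1 := (i hs).mono_set hsub
      have i2 := (i hτ).mono_set hsub
      have hi : IntervalIntegrable (fun y => (2 * C * (1 + x) + 2 * ε x)
          + ((1 + x) * τ y ^ 2 + (1 + x) * s y ^ 2)) volume (-1) x :=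
        IntervalIntegrable.add (by simp) ((i2.const_mul _).add (i1.const_mul _))
      have h1 : ‖∫ y in (-1)..x, twist' s τ υ w y‖ ≤ ∫ y in (-1)..x, ((2 * C * (1 + x) + 2 * ε x)
          + ((1 + x) * τ y ^ 2 + (1 + x) * s y ^ 2)) := by
        refine intervalIntegral.norm_integral_le_of_norm_le hx.1.le
          (Eventually.of_forall fun y hy => ?_) hi
        have b1 := prod hs hτ hsle x hx y hy
        have b2 := prod hτ hs hτle x hx y hy
        have b3 := hC y ⟨hy.1.le, hy.2.trans hx.2⟩
        have b4 : |1 - y ^ 2| ≤ 2 * (1 + x) := by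
          have := hy.1
          have h2 := hy.2
          have h3 := hx.2
          rw [abs_of_nonneg (by nlinarith)]; nlinarith
        have b5 : |2 * w * (Real.exp (4 * prim υ y) * (1 - y ^ 2))| ≤ C * (2 * (1 + x)) := by
          rw [← mul_assoc, abs_mul]
          exact mul_le_mul b3 b4 (abs_nonneg _) hC0
        rw [twist', Real.norm_eq_abs]
        rw [abs_le] at *
        constructor <;> linarith [b1.1, b1.2, b2.1, b2.2, b5.1, b5.2]
      rw [intervalIntegral.integral_add (by simp) ((i2.const_mul _).add (i1.const_mul _)),
        intervalIntegral.integral_add (i2.const_mul _) (i1.const_mul _),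
        intervalIntegral.integral_const, intervalIntegral.integral_const_mul,
        intervalIntegral.integral_const_mul] at h1
      refine h1.trans (le_of_eq ?_)
      simp only [ε, prim, smul_eq_mul]
      ring
    rw [tendsto_zero_iff_norm_tendsto_zero]
    have lx : Tendsto (fun x : ℝ => 1 + x) (𝓝[>] (-1)) (𝓝 (1 + -1)) :=
      lim (f := fun x => 1 + x) (by fun_prop)
    have lim2 : Tendsto (fun x => 2 * C * (1 + x) + 3 * ε x) (𝓝[>] (-1)) (𝓝 0) := by
      have := (lx.const_mul (2 * C)).add (hε.const_mul 3)
      simpa using this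
    refine squeeze_zero' (Eventually.of_forall fun _ => norm_nonneg _) ?_ lim2
    filter_upwards [hIoc] with x hx
    have hx0 : 0 < 1 + x := by linarith [hx.1]
    rw [norm_div, Real.norm_eq_abs, Real.norm_eq_abs, abs_of_pos hx0, div_le_iff₀ hx0, mul_comm]
    exact bound x hx
  have := (hA.pow 2).add (ht.pow 2)
  norm_num at this
  refine this.congr fun x => ?_
  rw [ernstSq, add_div, div_pow, div_pow]

/-- The divergent terms combine into `log(N(a)/(1+a)²)`, which tends to `log 4`. Together with `2
log 2` this is the `log 16` in the limit. -/
theorem tendsto_integral_defect (hU : prim υ 1 = 0) (hN : 0 < ernstSq s τ υ w 1) :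
    Tendsto (fun a => ∫ x in a..1, defect s τ υ w x) (𝓝[>] (-1))
      (𝓝 ((∫ x in (-1)..1, energyDensity s τ υ w x) - 2 - Real.log (ernstSq s τ υ w 1 / 16))) := by
  have hIoo : ∀ᶠ x : ℝ in 𝓝[>] (-1), x ∈ Ioo (-1 : ℝ) 1 := Ioo_mem_nhdsGT (by norm_num)
  have lim : ∀ {f : ℝ → ℝ}, ContinuousOn f (uIcc (-1) 1) →
      Tendsto f (𝓝[>] (-1)) (𝓝 (f (-1))) := by
    intro f hf
    rw [uIcc_neg_one_one] at hf
    exact ((hf (-1) (by norm_num)).mono_left (nhdsWithin_le_of_mem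
      (mem_of_superset (Ioc_mem_nhdsGT (by norm_num)) Ioc_subset_Icc_self)))
  have ie := intervalIntegrable_energyDensity (w := w) hs hτ hυ
  have l1 := lim (isACWith_prim ie).continuousOn
  have l2 := lim (isACWith_prim hυ.intervalIntegrable).continuousOn
  have l3 := (tendsto_ernstSq_div (w := w) hs hτ hυ).log (by norm_num)
  have l4 : Tendsto (fun x : ℝ => x) (𝓝[>] (-1)) (𝓝 (-1)) := lim (f := fun x => x) (by fun_prop)
  have := (((((l1.const_sub (prim (energyDensity s τ υ w) 1)).sub (l4.const_sub 1)).add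
    ((l2.const_sub (prim υ 1)).const_mul 2)).add_const (2 * Real.log 2)).sub_const
      (Real.log (ernstSq s τ υ w 1))).add l3
  have e : prim (energyDensity s τ υ w) 1 - prim (energyDensity s τ υ w) (-1) - (1 - -1)
      + 2 * (prim υ 1 - prim υ (-1)) + 2 * Real.log 2 - Real.log (ernstSq s τ υ w 1) + Real.log 4
      = (∫ x in (-1)..1, energyDensity s τ υ w x) - 2 - Real.log (ernstSq s τ υ w 1 / 16) := by
    rw [hU, prim_neg_one, prim_neg_one, prim, Real.log_div hN.ne' (by norm_num),
      show (16 : ℝ) = 4 ^ 2 by norm_num, Real.log_pow, show (4 : ℝ) = 2 ^ 2 by norm_num,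
      Real.log_pow]
    push_cast; ring
  rw [e] at this
  refine this.congr' ?_
  filter_upwards [hIoo] with a ha
  rw [(integral_defect hs hτ hυ hN ha).2]
  have h1 : 0 < 1 + a := by linarith [ha.1]
  have h2 : ∫ x in a..1, energyDensity s τ υ w x
      = prim (energyDensity s τ υ w) 1 - prim (energyDensity s τ υ w) a := by
    have hsub : uIcc (-1) a ⊆ uIcc (-1) 1 := by
      rw [uIcc_neg_one_one]; exact uIcc_subset_Icc (by norm_num) (Ioo_subset_Icc_self ha)
    exact (intervalIntegral.integral_interval_sub_left ie (ie.mono_set hsub)).symm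
  rw [h2, Real.log_div (ernstSq_pos ha).ne' (by positivity), Real.log_pow]
  push_cast; ring

theorem two_add_log_le_integral_energyDensity (hU : prim υ 1 = 0) (hN : 0 < ernstSq s τ υ w 1) :
    2 + Real.log (ernstSq s τ υ w 1 / 16) ≤ ∫ x in (-1)..1, energyDensity s τ υ w x := by
  have hIoo : ∀ᶠ x : ℝ in 𝓝[>] (-1), x ∈ Ioo (-1 : ℝ) 1 := Ioo_mem_nhdsGT (by norm_num)
  have := ge_of_tendsto (tendsto_integral_defect hs hτ hυ hU hN) (b := 0) (by
    filter_upwards [hIoo] with a ha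
    exact intervalIntegral.integral_nonneg ha.2.le fun x hx => defect_nonneg
      ⟨ha.1.le.trans hx.1, hx.2⟩)
  linarith

/-- The integral of the nonnegative defect over `(a,1)` grows as `a` decreases to `-1`, and its
limit is nonpositive. So all these integrals vanish. -/
theorem defect_ae_eq_zero (hU : prim υ 1 = 0) (hN : 16 ≤ ernstSq s τ υ w 1)
    (he : ∫ x in (-1)..1, energyDensity s τ υ w x = 2) :
    ∀ᵐ x, x ∈ Ioo (-1 : ℝ) 1 → defect s τ υ w x = 0 := by
  have hN0 : 0 < ernstSq s τ υ w 1 := by linarith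
  have hlim := tendsto_integral_defect hs hτ hυ hU hN0
  have hle : (∫ x in (-1)..1, energyDensity s τ υ w x) - 2 - Real.log (ernstSq s τ υ w 1 / 16)
      ≤ 0 := by
    rw [he]
    have := Real.log_nonneg (show 1 ≤ ernstSq s τ υ w 1 / 16 by linarith)
    linarith
  have hz : ∀ a ∈ Ioo (-1 : ℝ) 1, ∫ x in a..1, defect s τ υ w x ≤ 0 := by
    intro a ha
    refine le_trans (ge_of_tendsto hlim ?_) hle
    filter_upwards [Ioo_mem_nhdsGT ha.1] with b hb
    refine intervalIntegral.integral_mono_interval hb.2.le ha.2.le le_rfl ?_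
      (integral_defect hs hτ hυ hN0 ⟨hb.1, hb.2.trans ha.2⟩).1
    refine (ae_restrict_iff' measurableSet_Ioc).2 (Eventually.of_forall fun x hx => ?_)
    exact defect_nonneg ⟨hb.1.le.trans hx.1.le, hx.2⟩
  have hae : ∀ a ∈ Ioo (-1 : ℝ) 1, ∀ᵐ x, x ∈ Ioc a 1 → defect s τ υ w x = 0 := by
    intro a ha
    have hnn : 0 ≤ᵐ[volume.restrict (Ioc a 1)] defect s τ υ w :=
      (ae_restrict_iff' measurableSet_Ioc).2 (Eventually.of_forall fun x hx =>
        defect_nonneg ⟨ha.1.le.trans hx.1.le, hx.2⟩)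
    have hint := (integral_defect hs hτ hυ hN0 ha).1
    have h0 : ∫ x in a..1, defect s τ υ w x = 0 := le_antisymm (hz a ha)
      (intervalIntegral.integral_nonneg_of_ae_restrict ha.2.le (by
        refine (ae_restrict_iff' measurableSet_Icc).2 (Eventually.of_forall fun x hx =>
          defect_nonneg ⟨ha.1.le.trans hx.1, hx.2⟩)))
    rw [intervalIntegral.integral_eq_zero_iff_of_le_of_nonneg_ae ha.2.le hnn hint] at h0
    exact (ae_restrict_iff' measurableSet_Ioc).1 h0
  have hall : ∀ᵐ x, ∀ n : ℕ, x ∈ Ioc (-1 + 1 / ((n : ℝ) + 1)) 1 → defect s τ υ w x = 0 := by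
    refine ae_all_iff.2 fun n => ?_
    rcases Nat.eq_zero_or_pos n with rfl | hn
    · exact (hae 0 (by norm_num)).mono fun x hx h => hx (by simpa using h)
    · refine hae _ ⟨?_, ?_⟩
      · have : (0 : ℝ) < 1 / ((n : ℝ) + 1) := by positivity
        linarith
      · have : 1 / ((n : ℝ) + 1) ≤ 1 := by
          rw [div_le_one (by positivity)]; linarith [(Nat.cast_nonneg n : (0 : ℝ) ≤ n)]
        linarith
  filter_upwards [hall] with x hx hm
  obtain ⟨n, hn⟩ := exists_nat_one_div_lt (show 0 < x + 1 by linarith [hm.1])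
  exact hx n ⟨by linarith, hm.2.le⟩

end Regularity

end Curve

/-! ### Solution of the first order system -/

theorem exists_const_of_hasDerivAt_zero {f : ℝ → ℝ} {a b : ℝ}
    (h : ∀ x ∈ Ioo a b, HasDerivAt f 0 x) : ∃ c, ∀ x ∈ Ioo a b, f x = c := by
  rcases (Ioo a b).eq_empty_or_nonempty with he | ⟨y, hy⟩
  · exact ⟨0, fun x hx => by simp [he] at hx⟩
  · refine ⟨f y, fun x hx => ?_⟩
    exact isOpen_Ioo.is_const_of_deriv_eq_zero isPreconnected_Ioo
      (fun z hz => (h z hz).differentiableAt.differentiableWithinAt)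
      (fun z hz => (h z hz).deriv) hx hy

theorem eqOn_Icc_of_eqOn_Ioo {f k : ℝ → ℝ} {a b : ℝ} (hab : a < b)
    (hf : ContinuousOn f (Icc a b)) (hk : ContinuousOn k (Icc a b))
    (h : ∀ x ∈ Ioo a b, f x = k x) : ∀ x ∈ Icc a b, f x = k x :=
  Set.EqOn.of_subset_closure h hf hk Ioo_subset_Icc_self (by rw [closure_Ioo hab.ne])

/-- `(S, T, U)` with the potential `ψ` of `S` and the twist potential `t` solve the first order
system at `x`, where `X = e^{2U}` and `w` is the rotation parameter. -/
structure FirstOrderAt (w : ℝ) (S T U ψ t : ℝ → ℝ) (x A N : ℝ) : Prop where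
  eqA : A = Real.exp (2 * U x) * (1 - x ^ 2) + ψ x ^ 2 + T x ^ 2
  eqN : N = A ^ 2 + t x ^ 2
  eqw : w = 2 * t x / N
  eqS : S x = 2 * Real.exp (2 * U x) * (ψ x * A + t x * T x) / N
  derivU : HasDerivAt U ((x + 2 * (Real.exp (2 * U x) * (1 - x ^ 2)) * A / N - 1) / (1 - x ^ 2)) x
  derivψ : HasDerivAt ψ (2 * Real.exp (2 * U x) * (ψ x * A + t x * T x) / N) x
  derivT : HasDerivAt T (2 * Real.exp (2 * U x) * (T x * A - t x * ψ x) / N) x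
  derivt : HasDerivAt t (2 * w * (Real.exp (2 * U x) ^ 2 * (1 - x ^ 2))
    - 2 * (ψ x * (2 * Real.exp (2 * U x) * (T x * A - t x * ψ x) / N)
      - T x * (2 * Real.exp (2 * U x) * (ψ x * A + t x * T x) / N))) x

section Solve

variable {w : ℝ} {S T U ψ t A N : ℝ → ℝ}

theorem FirstOrderAt.pos {x A N : ℝ} (h : FirstOrderAt w S T U ψ t x A N)
    (hx : x ∈ Ioo (-1 : ℝ) 1) : 0 < A ∧ 0 < N := by
  have h1 : 0 < 1 - x ^ 2 := by nlinarith [hx.1, hx.2]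
  have hA : 0 < A := by rw [h.eqA]; positivity
  exact ⟨hA, by rw [h.eqN]; positivity⟩

/-- With `E = A + it` and `X = e^{2U}` the system gives `E' = 2XE²/N`; these are the derivatives of
the real part and of `|E|²`. Consequently `(1/E)' = -2X/N` is real. -/
theorem FirstOrderAt.hasDerivAt (h : ∀ x ∈ Ioo (-1 : ℝ) 1, FirstOrderAt w S T U ψ t x (A x) (N x))
    {x : ℝ} (hx : x ∈ Ioo (-1 : ℝ) 1) :
    HasDerivAt A (2 * Real.exp (2 * U x) * (A x ^ 2 - t x ^ 2) / N x) x ∧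
      HasDerivAt N (4 * Real.exp (2 * U x) * A x) x := by
  have h1 : 0 < 1 - x ^ 2 := by nlinarith [hx.1, hx.2]
  have hev : ∀ᶠ y in 𝓝 x, y ∈ Ioo (-1 : ℝ) 1 := isOpen_Ioo.mem_nhds hx
  obtain ⟨eqA, eqN, eqw, -, dU, dψ, dT, dt⟩ := h x hx
  obtain ⟨hA, hN⟩ := (h x hx).pos hx
  have hsq : HasDerivAt (fun x : ℝ => 1 - x ^ 2) (-(2 * x)) x := by
    simpa using ((hasDerivAt_id x).fun_pow 2).const_sub 1
  have dA : HasDerivAt A (2 * Real.exp (2 * U x) * (A x ^ 2 - t x ^ 2) / N x) x := by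
    have := ((((dU.const_mul 2).exp.fun_mul hsq).fun_add (dψ.fun_pow 2)).fun_add
      (dT.fun_pow 2)).congr_of_eventuallyEq (f₁ := A) (hev.mono fun y hy => (h y hy).eqA)
    refine this.congr_deriv ?_
    have hz : ψ x ^ 2 = A x - Real.exp (2 * U x) * (1 - x ^ 2) - T x ^ 2 := by rw [eqA]; ring
    generalize Real.exp (2 * U x) = X at *
    generalize hY : 1 - x ^ 2 = Y at *
    push_cast
    field_simp
    linear_combination (2 * X * A x) * hz - X * eqN
  refine ⟨dA, ?_⟩
  have := ((dA.fun_pow 2).fun_add (dt.fun_pow 2)).congr_of_eventuallyEq (f₁ := N)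
    (hev.mono fun y hy => (h y hy).eqN)
  refine this.congr_deriv ?_
  have hz : ψ x ^ 2 = A x - Real.exp (2 * U x) * (1 - x ^ 2) - T x ^ 2 := by rw [eqA]; ring
  rw [eqw]
  generalize Real.exp (2 * U x) = X at *
  generalize hY : 1 - x ^ 2 = Y at *
  push_cast
  field_simp
  linear_combination (8 * X * t x ^ 2) * hz - (4 * X * A x) * eqN

/-- For `ζ = ψ + iT` one has `ζ' = 2Xζ/E`, so the inversion `ζ/conj E = p + iq` is constant, as is
`t/N = w/2`. With the third first integral `κ`, all functions follow algebraically and only the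
boundary conditions remain to be imposed. -/
theorem firstOrder_solution (h : ∀ x ∈ Ioo (-1 : ℝ) 1, FirstOrderAt w S T U ψ t x (A x) (N x))
    (cU : ContinuousOn U (Icc (-1) 1)) (cT : ContinuousOn T (Icc (-1) 1))
    (hU1 : U (-1) = 0) (hU2 : U 1 = 0) (hT : T 1 = 0) :
    ∃ g ∈ Icc (0 : ℝ) 1, ∃ σS ∈ ({1, -1} : Set ℝ), ∃ σT ∈ ({1, -1} : Set ℝ),
      ∀ x ∈ Ioo (-1 : ℝ) 1, S x = famS g σS x ∧ T x = famT g σT x ∧ U x = famU g x := by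
  -- the conserved quantities
  obtain ⟨p, hp⟩ : ∃ p, ∀ x ∈ Ioo (-1 : ℝ) 1, ψ x * (A x / N x) - T x * w / 2 = p := by
    refine exists_const_of_hasDerivAt_zero fun x hx => ?_
    obtain ⟨dA, dN⟩ := FirstOrderAt.hasDerivAt h hx
    obtain ⟨eqA, eqN, eqw, -, dU, dψ, dT, dt⟩ := h x hx
    obtain ⟨hA, hN⟩ := (h x hx).pos hx
    refine ((dψ.fun_mul (dA.fun_div dN hN.ne')).fun_sub
      ((dT.mul_const w).div_const 2)).congr_deriv ?_
    rw [eqw]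
    field_simp
    ring
  obtain ⟨q, hq⟩ : ∃ q, ∀ x ∈ Ioo (-1 : ℝ) 1, T x * (A x / N x) + ψ x * w / 2 = q := by
    refine exists_const_of_hasDerivAt_zero fun x hx => ?_
    obtain ⟨dA, dN⟩ := FirstOrderAt.hasDerivAt h hx
    obtain ⟨eqA, eqN, eqw, -, dU, dψ, dT, dt⟩ := h x hx
    obtain ⟨hA, hN⟩ := (h x hx).pos hx
    refine ((dT.fun_mul (dA.fun_div dN hN.ne')).fun_add
      ((dψ.mul_const w).div_const 2)).congr_deriv ?_
    rw [eqw]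
    field_simp
    ring
  obtain ⟨κ, hκ⟩ : ∃ κ, ∀ x ∈ Ioo (-1 : ℝ) 1, Real.exp (2 * U x) * (1 + x) ^ 2 / N x = κ := by
    refine exists_const_of_hasDerivAt_zero fun x hx => ?_
    obtain ⟨dA, dN⟩ := FirstOrderAt.hasDerivAt h hx
    obtain ⟨eqA, eqN, eqw, -, dU, dψ, dT, dt⟩ := h x hx
    obtain ⟨hA, hN⟩ := (h x hx).pos hx
    have d1 : HasDerivAt (fun x : ℝ => (1 + x) ^ 2) (2 * (1 + x)) x := by
      simpa using ((hasDerivAt_id x).const_add 1).fun_pow 2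
    refine (((dU.const_mul 2).exp.fun_mul d1).fun_div dN hN.ne').congr_deriv ?_
    have h1 : 1 - x ≠ 0 := by linarith [hx.2]
    have h2 : 1 + x ≠ 0 := by linarith [hx.1]
    rw [show 1 - x ^ 2 = (1 + x) * (1 - x) by ring]
    field_simp
    ring
  obtain ⟨P, hP⟩ : ∃ P, P = p ^ 2 + q ^ 2 := ⟨_, rfl⟩
  -- The first relation is `|1/E|² = 1/N`. The second divides the definition of `A` by `N` and uses
  -- `(ψ²+T²)/N = |ζ/conj E|² = P`.
  have hPN : ∀ x ∈ Ioo (-1 : ℝ) 1, 1 / N x = (A x / N x) ^ 2 + w ^ 2 / 4 ∧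
      A x / N x * (1 + x) = P * (1 + x) + κ * (1 - x) := by
    intro x hx
    obtain ⟨eqA, eqN, eqw, -, -, -, -, -⟩ := h x hx
    obtain ⟨hA, hN⟩ := (h x hx).pos hx
    have e1 : 1 / N x = (A x / N x) ^ 2 + w ^ 2 / 4 := by
      rw [eqw]; field_simp; linear_combination 4 * eqN
    refine ⟨e1, ?_⟩
    have e2 : P = (ψ x ^ 2 + T x ^ 2) * (1 / N x) := by
      rw [hP, ← hp x hx, ← hq x hx, e1]; ring
    rw [e2, ← hκ x hx]
    field_simp
    rw [eqA]; ring
  -- Elimination of `A` and `N` leaves an equation for `U` without denominators, which extends by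
  -- continuity to the end points, where `U = 0` fixes `κ` and `w²`.
  have hX : ∀ x ∈ Ioo (-1 : ℝ) 1, Real.exp (2 * U x)
      * ((P * (1 + x) + κ * (1 - x)) ^ 2 + w ^ 2 / 4 * (1 + x) ^ 2) = κ := by
    intro x hx
    obtain ⟨e1, e2⟩ := hPN x hx
    rw [← e2, ← hκ x hx]
    linear_combination (-Real.exp (2 * U x) * (1 + x) ^ 2) * e1
  have hX' := eqOn_Icc_of_eqOn_Ioo (by norm_num) (by fun_prop) continuousOn_const hX
  have hκ1 : κ = 1 / 4 := by
    have e := hX' (-1) (by norm_num)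
    have hκ0 : κ ≠ 0 := by
      rw [← hκ 0 (by norm_num)]
      have := ((h 0 (by norm_num)).pos (by norm_num)).2
      positivity
    rw [hU1] at e
    norm_num at e
    have : κ * (4 * κ - 1) = 0 := by linear_combination e
    rcases mul_eq_zero.1 this with h0 | h0
    · exact absurd h0 hκ0
    · linarith
  have hw : w ^ 2 = 1 / 4 - 4 * P ^ 2 := by
    have e := hX' 1 (by norm_num)
    rw [hU2] at e
    norm_num at e
    linarith
  have hP0 : 0 ≤ P := by rw [hP]; positivity
  have hP1 : P ≤ 1 / 4 := by nlinarith [sq_nonneg w]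
  -- The parameter of the family is `γ = -g² = -4P`; `w² ≥ 0` becomes `g ≤ 1`.
  obtain ⟨g, hg⟩ : ∃ g, g = 2 * Real.sqrt P := ⟨_, rfl⟩
  have hg2 : g ^ 2 = 4 * P := by rw [hg, mul_pow, Real.sq_sqrt hP0]; norm_num
  have hg0 : 0 ≤ g := by rw [hg]; positivity
  have hgI : g ∈ Icc (0 : ℝ) 1 := ⟨hg0, by nlinarith⟩
  have hPg : P = g ^ 2 / 4 := by linarith
  have hexp : ∀ x ∈ Ioo (-1 : ℝ) 1, Real.exp (2 * U x) = 2 / famD g x := by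
    intro x hx
    have hD := famD_pos hgI x
    have e := hX x hx
    rw [hw, hκ1, hPg] at e
    rw [eq_div_iff hD.ne']
    unfold famD
    linear_combination 8 * e
  have hUfam : ∀ x ∈ Ioo (-1 : ℝ) 1, U x = famU g x := by
    intro x hx
    have := Real.exp_injective ((hexp x hx).trans (exp_two_famU hgI x).symm)
    linarith
  have hN : ∀ x ∈ Ioo (-1 : ℝ) 1, N x = 8 * (1 + x) ^ 2 / famD g x := by
    intro x hx
    have hD := famD_pos hgI x
    have e := hκ x hx
    have := ((h x hx).pos hx).2
    rw [hexp x hx, hκ1] at e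
    field_simp at e ⊢
    linarith
  have hT0 : ∀ x ∈ Ioo (-1 : ℝ) 1, T x * famD g x
      = 8 * (1 + x) * (q * (P * (1 + x) + κ * (1 - x)) - p * w / 2 * (1 + x)) := by
    intro x hx
    have hD := famD_pos hgI x
    obtain ⟨e1, e2⟩ := hPN x hx
    have hN0 := ((h x hx).pos hx).2
    have e3 : q * (A x / N x) - p * w / 2 = T x * (1 / N x) := by
      rw [← hp x hx, ← hq x hx, e1]; ring
    have e4 : T x = (q * (A x / N x) - p * w / 2) * N x := by
      rw [e3]; field_simp
    have e5 : N x * famD g x = 8 * (1 + x) ^ 2 := by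
      rw [hN x hx]; field_simp
    linear_combination famD g x * e4 + (q * (A x / N x) - p * w / 2) * e5 + 8 * (1 + x) * q * e2
  -- This is the condition `T(1) = 0` inserted into `hT0`.
  have hqP : 2 * q * P = p * w := by
    have e : T 1 * famD g 1 = _ := eqOn_Icc_of_eqOn_Ioo (by norm_num)
      (cT.mul (contDiff_famD (g := g)).continuous.continuousOn) (by fun_prop) hT0 1 (by norm_num)
    rw [hT] at e
    norm_num at e
    linarith
  have hTq : ∀ x ∈ Ioo (-1 : ℝ) 1, T x = 2 * q * (1 - x ^ 2) / famD g x := by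
    intro x hx
    have hD := famD_pos hgI x
    rw [eq_div_iff hD.ne', hT0 x hx, hκ1]
    linear_combination (4 * (1 + x) ^ 2) * hqP
  have hSp : ∀ x ∈ Ioo (-1 : ℝ) 1, S x = (2 * w * T x + 2 * p) * (2 / famD g x) := by
    intro x hx
    obtain ⟨eqA, eqN, eqw, eqS, -, -, -, -⟩ := h x hx
    obtain ⟨hA, hN⟩ := (h x hx).pos hx
    rw [eqS, ← hexp x hx, ← hp x hx, eqw]
    field_simp
    ring
  have hsig : ∀ a b : ℝ, a ^ 2 = b ^ 2 → ∃ σ ∈ ({1, -1} : Set ℝ), a = σ * b := by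
    intro a b hab
    rcases sq_eq_sq_iff_eq_or_eq_neg.1 hab with h | h
    · exact ⟨1, by simp, by rw [h, one_mul]⟩
    · exact ⟨-1, by simp, by rw [h]; ring⟩
  have hc := sq_sqrt_one_sub_pow_four hgI
  -- Squaring `2qP = pw` and inserting `p² + q² = P` and `w² = 1/4 - 4P²` determines `p²` and `q²`;
  -- only their signs stay free.
  have hp2 : p ^ 2 = (g ^ 3 / 2) ^ 2 := by
    have e1 : P * (4 * P ^ 2) = p ^ 2 * (4 * P ^ 2 + w ^ 2) := by
      linear_combination (4 * P ^ 2) * hP + (2 * q * P + p * w) * hqP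
    rw [hw] at e1
    have e2 : p ^ 2 = 16 * P ^ 3 := by linear_combination -4 * e1
    rw [e2, hPg]; ring
  have hq2 : q ^ 2 = (g * Real.sqrt (1 - g ^ 4) / 2) ^ 2 := by
    have e1 : q ^ 2 = P - p ^ 2 := by rw [hP]; ring
    rw [e1, hp2, hPg]; linear_combination (-(g ^ 2 / 4)) * hc
  obtain ⟨σS, hσS, hpS⟩ := hsig _ _ hp2
  obtain ⟨σT, hσT, hqT⟩ := hsig _ _ hq2
  have hTfam : ∀ x ∈ Ioo (-1 : ℝ) 1, T x = famT g σT x := by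
    intro x hx
    rw [hTq x hx, hqT, famT]; ring
  refine ⟨g, hgI, σS, hσS, σT, hσT, fun x hx => ⟨?_, hTfam x hx, hUfam x hx⟩⟩
  rw [famS_eq hgI hσT, hSp x hx, ← hTfam x hx, hpS]
  -- For `g = 0` the relation `2qP = pw` does not fix the sign of `w`, but `S` and `T` vanish then.
  rcases hg0.eq_or_lt with h0 | h0
  · have : T x = 0 := by rw [hTfam x hx, famT, ← h0]; simp
    rw [this, ← h0]; ring
  · have e : 2 * w = σS * σT * Real.sqrt (1 - g ^ 4) := by
      have e1 := hqP
      rw [hPg, hqT, hpS] at e1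
      have e2 : g ^ 3 * (2 * w) = g ^ 3 * (σS * σT * Real.sqrt (1 - g ^ 4)) := by
        have := sq_of_sign hσS
        linear_combination (-4 * σS) * e1 - (2 * w * g ^ 3) * this
      exact mul_left_cancel₀ (by positivity) e2
    rw [e]; ring

end Solve

/-! ### The minimum of the functional -/

/-- Regularity bootstrap: the vanishing defect gives the first order equations only almost
everywhere, but their right-hand sides are continuous, so the primitives are classically
differentiable. -/
theorem hasDerivAt_prim_of_ae_eq {f k : ℝ → ℝ} (hf : IntervalIntegrable f volume (-1) 1)
    (hk : ContinuousOn k (Ioo (-1) 1)) (h : ∀ᵐ x, x ∈ Ioo (-1 : ℝ) 1 → f x = k x) {x : ℝ}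
    (hx : x ∈ Ioo (-1 : ℝ) 1) : HasDerivAt (prim f) (k x) x := by
  have hae : ∀ {y : ℝ}, y ∈ Ioo (-1 : ℝ) 1 → ∀ᵐ z, z ∈ uIoc (-1) y → f z = k z := by
    intro y hy
    filter_upwards [h] with z hz hm
    rw [uIoc_of_le hy.1.le] at hm
    exact hz ⟨hm.1, hm.2.trans_lt hy.2⟩
  have hi : IntervalIntegrable k volume (-1) x := by
    refine (hf.mono_set ?_).congr_ae ((ae_restrict_iff' measurableSet_uIoc).2 (hae hx))
    rw [uIcc_neg_one_one]
    exact uIcc_subset_Icc (by norm_num) (Ioo_subset_Icc_self hx)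
  have hd := intervalIntegral.integral_hasDerivAt_right hi
    (hk.stronglyMeasurableAtFilter isOpen_Ioo x hx) (hk.continuousAt (isOpen_Ioo.mem_nhds hx))
  refine hd.congr_of_eventuallyEq ?_
  filter_upwards [isOpen_Ioo.mem_nhds hx] with y hy
  exact intervalIntegral.integral_congr_ae (hae hy)

theorem integral_exp_pos {u : ℝ → ℝ} (hu : ContinuousOn u (Icc (-1) 1)) :
    0 < ∫ x in (-1)..1, Real.exp (4 * u x) * (1 - x ^ 2) := by
  refine intervalIntegral.intervalIntegral_pos_of_pos_on ?_ ?_ (by norm_num)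
  · refine ContinuousOn.intervalIntegrable ?_
    rw [uIcc_neg_one_one]
    fun_prop
  · intro x hx
    have : 0 < 1 - x ^ 2 := by nlinarith [hx.1, hx.2]
    positivity

theorem c₁_sq {u v : ℝ → ℝ} (hv : ContinuousOn v (Icc (-1) 1)) (h : u =ᵐ[mu] v) :
    c₁ u ^ 2 = (∫ x in (-1)..1, Real.exp (4 * v x) * (1 - x ^ 2)) ∧ 0 < c₁ u := by
  have e : ∫ x in (-1)..1, Real.exp (4 * u x) * (1 - x ^ 2)
      = ∫ x in (-1)..1, Real.exp (4 * v x) * (1 - x ^ 2) :=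
    intervalIntegral_congr_mu (by filter_upwards [h] with x hx; rw [hx])
  rw [c₁, e]
  exact ⟨Real.sq_sqrt (integral_exp_pos hv).le, Real.sqrt_pos.2 (integral_exp_pos hv)⟩

theorem continuousOn_prim {f : ℝ → ℝ} (hf : MemL2 f) : ContinuousOn (prim f) (Icc (-1) 1) := by
  have := (isACWith_prim hf.intervalIntegrable).continuousOn
  rwa [uIcc_neg_one_one] at this

/-- Integration of `(ψT)'`, whose boundary terms vanish because `T(±1) = 0`. -/
theorem integral_prim_mul {s τ : ℝ → ℝ} (hs : MemL2 s) (hτ : MemL2 τ) (h1 : prim τ 1 = 0) :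
    ∫ x in (-1)..1, (prim s x * τ x - prim τ x * s x)
      = -2 * ∫ x in (-1)..1, s x * prim τ x := by
  have a1 := isACWith_prim hs.intervalIntegrable
  have a2 := isACWith_prim hτ.intervalIntegrable
  have h := (a1.mul a2).integral_eq
  have i1 : IntervalIntegrable (fun x => s x * prim τ x) volume (-1) 1 :=
    hs.intervalIntegrable.mul_continuousOn a2.continuousOn
  have i2 : IntervalIntegrable (fun x => prim s x * τ x) volume (-1) 1 :=
    hτ.intervalIntegrable.continuousOn_mul a1.continuousOn
  have i3 : IntervalIntegrable (fun x => prim τ x * s x) volume (-1) 1 :=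
    hs.intervalIntegrable.continuousOn_mul a2.continuousOn
  rw [intervalIntegral.integral_add i1 i2, h1, prim_neg_one] at h
  have e : ∫ x in (-1)..1, prim τ x * s x = ∫ x in (-1)..1, s x * prim τ x := by
    simp_rw [mul_comm]
  rw [intervalIntegral.integral_sub i2 i3, e]
  linarith

/-- The end value is `2wc₁² + 4c₂`; through it the constraint quantities enter `N(1)`. -/
theorem twist_one {s τ υ : ℝ → ℝ} (hs : MemL2 s) (hτ : MemL2 τ) (hυ : MemL2 υ)
    (h1 : prim τ 1 = 0) (w : ℝ) :
    twist s τ υ w 1 = 2 * w * (∫ x in (-1)..1, Real.exp (4 * prim υ x) * (1 - x ^ 2))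
      + 4 * ∫ x in (-1)..1, s x * prim τ x := by
  have c3 := (isACWith_prim hυ.intervalIntegrable).continuousOn
  have i1 : IntervalIntegrable (fun x => Real.exp (4 * prim υ x) * (1 - x ^ 2))
      volume (-1) 1 := ContinuousOn.intervalIntegrable (by fun_prop)
  have i2 : IntervalIntegrable (fun x => prim s x * τ x - prim τ x * s x) volume (-1) 1 :=
    (hτ.intervalIntegrable.continuousOn_mul (isACWith_prim hs.intervalIntegrable).continuousOn).sub
      (hs.intervalIntegrable.continuousOn_mul (isACWith_prim hτ.intervalIntegrable).continuousOn)
  rw [twist, prim]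
  simp only [twist']
  rw [intervalIntegral.integral_sub (i1.const_mul _) (i2.const_mul _),
    intervalIntegral.integral_const_mul, intervalIntegral.integral_const_mul,
    integral_prim_mul hs hτ h1]
  ring

/-- On `X`, the functional is half of the energy of a curve with a constant rotation parameter,
whose end point satisfies the constraint. -/
theorem exists_functionalI_eq {S T U : ℝ → ℝ} (h : MemX S T U) :
    ∃ w, functionalI S T U
        = (1 / 2) * ∫ x in (-1)..1, energyDensity S (weakDeriv T) (weakDeriv U) w x ∧
      16 ≤ ernstSq S (weakDeriv T) (weakDeriv U) w 1 := by
  have hT := h.memT.isPrimitive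
  have hU := h.memU.isPrimitive
  have hTe : T =ᵐ[mu] prim (weakDeriv T) := hT.ae_eq
  have hUe : U =ᵐ[mu] prim (weakDeriv U) := hU.ae_eq
  have hT1 : prim (weakDeriv T) 1 = 0 := hT.integral_eq_zero
  obtain ⟨hc1, hc1pos⟩ := c₁_sq (continuousOn_prim hU.memL2) hUe
  have hc2 : c₂ S T = ∫ x in (-1)..1, S x * prim (weakDeriv T) x :=
    intervalIntegral_congr_mu (by filter_upwards [hTe] with x hx; rw [hx])
  have hc3 : prim S 1 ^ 2 = 2 * c₃ S ^ 2 := by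
    rw [c₃, mul_pow, div_pow, Real.sq_sqrt (by norm_num), prim]; ring
  -- The rotation parameter gets the sign of `c₂`, so that both contributions to the twist at `1`
  -- add up in modulus.
  obtain ⟨σ, hσ, hσ2⟩ : ∃ σ : ℝ, σ ^ 2 = 1 ∧ c₂ S T = σ * |c₂ S T| := by
    rcases le_total 0 (c₂ S T) with h0 | h0
    · exact ⟨1, by norm_num, by rw [abs_of_nonneg h0, one_mul]⟩
    · exact ⟨-1, by norm_num, by rw [abs_of_nonpos h0]; ring⟩
  set w := σ * (M₂ S T U / c₁ U) with hw
  have hwc : w ^ 2 * c₁ U ^ 2 = M₂ S T U ^ 2 := by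
    rw [hw, mul_pow, hσ, div_pow]; field_simp
  refine ⟨w, ?_, ?_⟩
  · have c3 := (isACWith_prim hU.memL2.intervalIntegrable).continuousOn
    have i1 : IntervalIntegrable (fun x => Real.exp (4 * prim (weakDeriv U) x) * (1 - x ^ 2))
      volume (-1) 1 := ContinuousOn.intervalIntegrable (by fun_prop)
    have i2 := intervalIntegrable_energyDensity (w := w) h.memS hT.memL2 hU.memL2
    have e : ∫ x in (-1)..1, ((weakDeriv U x) ^ 2 * (1 - x ^ 2) - 2 * x * weakDeriv U x
        + ((S x) ^ 2 + (weakDeriv T x) ^ 2) * Real.exp (-2 * U x))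
        = ∫ x in (-1)..1, (energyDensity S (weakDeriv T) (weakDeriv U) w x
          - w ^ 2 * (Real.exp (4 * prim (weakDeriv U) x) * (1 - x ^ 2))) :=
      intervalIntegral_congr_mu (by
        filter_upwards [hUe] with x hx
        rw [hx, energyDensity]; ring)
    rw [functionalI, energy, e, intervalIntegral.integral_sub i2 (i1.const_mul _),
      intervalIntegral.integral_const_mul, ← hc1, hwc]
    ring
  · have ht := twist_one h.memS hT.memL2 hU.memL2 hT1 w
    rw [← hc1, ← hc2] at ht
    have ht' : twist S (weakDeriv T) (weakDeriv U) w 1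
        = 2 * σ * (M₂ S T U * c₁ U + 2 * |c₂ S T|) := by
      rw [ht, hw]
      have : M₂ S T U / c₁ U * c₁ U ^ 2 = M₂ S T U * c₁ U := by field_simp
      linear_combination (2 * σ) * this + 4 * hσ2
    have hA : ernstRe S (weakDeriv T) (weakDeriv U) 1 = 2 * c₃ S ^ 2 := by
      rw [ernstRe, hT1, hc3]; norm_num
    -- Here the definition of `M₂` enters. It gives `N(1) = 4c₃⁴ + 4(M₂c₁+2|c₂|)² ≥ 4c₃⁴ + 4M₁ ≥
    -- 16`.
    have hJ : Real.sqrt (M₁ S) ≤ M₂ S T U * c₁ U + 2 * |c₂ S T| := by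
      have : (Real.sqrt (M₁ S) - 2 * |c₂ S T|) / c₁ U ≤ M₂ S T U := le_max_right _ _
      rw [div_le_iff₀ hc1pos] at this
      linarith
    have hM1 : Real.sqrt (M₁ S) ^ 2 = M₁ S := Real.sq_sqrt (le_max_left _ _)
    have hM1' : 4 - c₃ S ^ 4 ≤ M₁ S := le_max_right _ _
    have hJ2 : M₁ S ≤ (M₂ S T U * c₁ U + 2 * |c₂ S T|) ^ 2 := by
      rw [← hM1]; exact pow_le_pow_left₀ (Real.sqrt_nonneg _) hJ 2
    rw [ernstSq, hA, ht', mul_pow, mul_pow, mul_pow, hσ]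
    nlinarith

theorem one_le_functionalI {S T U : ℝ → ℝ} (h : MemX S T U) : 1 ≤ functionalI S T U := by
  obtain ⟨w, h1, h2⟩ := exists_functionalI_eq h
  have h3 := two_add_log_le_integral_energyDensity h.memS h.memT.isPrimitive.memL2
    h.memU.isPrimitive.memL2 h.memU.isPrimitive.integral_eq_zero (by linarith)
  have := Real.log_nonneg (show 1 ≤ ernstSq S (weakDeriv T) (weakDeriv U) w 1 / 16 by linarith)
  linarith

/-- Equality forces the defect to vanish almost everywhere; each of its four squares then gives one
first order equation, to be upgraded to an equation at every point. -/
theorem family_of_functionalI_eq_one {S T U : ℝ → ℝ} (h : MemX S T U)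
    (hI : functionalI S T U = 1) :
    ∃ g ∈ Icc (0 : ℝ) 1, ∃ σS ∈ ({1, -1} : Set ℝ), ∃ σT ∈ ({1, -1} : Set ℝ),
      InFamilyAE (-g ^ 2) σS σT S T U := by
  obtain ⟨w, h1, h2⟩ := exists_functionalI_eq h
  have hS := h.memS
  have hτ := h.memT.isPrimitive.memL2
  have hυ := h.memU.isPrimitive.memL2
  have hTe : T =ᵐ[mu] prim (weakDeriv T) := h.memT.isPrimitive.ae_eq
  have hUe : U =ᵐ[mu] prim (weakDeriv U) := h.memU.isPrimitive.ae_eq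
  have hT1 : prim (weakDeriv T) 1 = 0 := h.memT.isPrimitive.integral_eq_zero
  have hU1 : prim (weakDeriv U) 1 = 0 := h.memU.isPrimitive.integral_eq_zero
  have hdef := defect_ae_eq_zero hS hτ hυ hU1 h2 (by linarith)
  generalize weakDeriv T = τ at *
  generalize weakDeriv U = υ at *
  have hsys : ∀ᵐ x, x ∈ Ioo (-1 : ℝ) 1 →
      υ x = (x + 2 * (Real.exp (2 * prim υ x) * (1 - x ^ 2)) * ernstRe S τ υ x
        / ernstSq S τ υ w x - 1) / (1 - x ^ 2) ∧
      S x = 2 * Real.exp (2 * prim υ x) * (prim S x * ernstRe S τ υ x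
        + twist S τ υ w x * prim τ x) / ernstSq S τ υ w x ∧
      τ x = 2 * Real.exp (2 * prim υ x) * (prim τ x * ernstRe S τ υ x
        - twist S τ υ w x * prim S x) / ernstSq S τ υ w x ∧
      w = 2 * twist S τ υ w x / ernstSq S τ υ w x := by
    filter_upwards [hdef] with x hx hm
    have hz := hx hm
    have hY : 0 < 1 - x ^ 2 := by nlinarith [hm.1, hm.2]
    have hX := Real.exp_pos (2 * prim υ x)
    rw [defect] at hz
    have n1 : ∀ v : ℝ, 0 ≤ (1 - x ^ 2) * v ^ 2 := fun v => by positivity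
    have n2 : ∀ v : ℝ, 0 ≤ v ^ 2 / Real.exp (2 * prim υ x) := fun v => by positivity
    have n3 : ∀ v : ℝ, 0 ≤ Real.exp (2 * prim υ x) ^ 2 * (1 - x ^ 2) * v ^ 2 :=
      fun v => by positivity
    rw [add_eq_zero_iff_of_nonneg (add_nonneg (add_nonneg (n1 _) (n2 _)) (n2 _)) (n3 _),
      add_eq_zero_iff_of_nonneg (add_nonneg (n1 _) (n2 _)) (n2 _),
      add_eq_zero_iff_of_nonneg (n1 _) (n2 _)] at hz
    obtain ⟨⟨⟨z1, z2⟩, z3⟩, z4⟩ := hz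
    refine ⟨sub_eq_zero.1 ?_, sub_eq_zero.1 ?_, sub_eq_zero.1 ?_, sub_eq_zero.1 ?_⟩
    · simpa [hY.ne'] using z1
    · simpa using z2
    · simpa using z3
    · simpa [hY.ne'] using z4
  have cU := continuousOn_prim hυ
  have cT := continuousOn_prim hτ
  have cψ := continuousOn_prim hS
  have ct : ContinuousOn (twist S τ υ w) (Icc (-1) 1) := by
    have := (isACWith_twist (w := w) hS hτ hυ).continuousOn
    rwa [uIcc_neg_one_one] at this
  have cA : ContinuousOn (ernstRe S τ υ) (Icc (-1) 1) := by
    unfold ernstRe; fun_prop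
  have cN : ContinuousOn (ernstSq S τ υ w) (Icc (-1) 1) := by
    unfold ernstSq; fun_prop
  have hsub : Ioo (-1 : ℝ) 1 ⊆ Icc (-1) 1 := Ioo_subset_Icc_self
  have hN0 : ∀ x ∈ Ioo (-1 : ℝ) 1, ernstSq S τ υ w x ≠ 0 := fun x hx => (ernstSq_pos hx).ne'
  have hY0 : ∀ x ∈ Ioo (-1 : ℝ) 1, 1 - x ^ 2 ≠ 0 := fun x hx => by nlinarith [hx.1, hx.2]
  replace cU := cU.mono hsub
  replace cT := cT.mono hsub
  replace cψ := cψ.mono hsub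
  replace ct := ct.mono hsub
  replace cA := cA.mono hsub
  replace cN := cN.mono hsub
  have kS : ContinuousOn (fun x => 2 * Real.exp (2 * prim υ x) * (prim S x * ernstRe S τ υ x
        + twist S τ υ w x * prim τ x) / ernstSq S τ υ w x) (Ioo (-1) 1) :=
    ContinuousOn.div (by fun_prop) cN hN0
  have kT : ContinuousOn (fun x => 2 * Real.exp (2 * prim υ x) * (prim τ x * ernstRe S τ υ x
        - twist S τ υ w x * prim S x) / ernstSq S τ υ w x) (Ioo (-1) 1) :=
    ContinuousOn.div (by fun_prop) cN hN0
  have kU : ContinuousOn (fun x => (x + 2 * (Real.exp (2 * prim υ x) * (1 - x ^ 2))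
      * ernstRe S τ υ x / ernstSq S τ υ w x - 1) / (1 - x ^ 2)) (Ioo (-1) 1) :=
    ContinuousOn.div (ContinuousOn.sub (continuousOn_id.add
      (ContinuousOn.div (by fun_prop) cN hN0)) continuousOn_const) (by fun_prop) hY0
  -- Two continuous functions that agree almost everywhere on an open set agree on all of it.
  have hw : ∀ x ∈ Ioo (-1 : ℝ) 1, w = 2 * twist S τ υ w x / ernstSq S τ υ w x := by
    refine Measure.eqOn_open_of_ae_eq (μ := volume) (f := fun _ => w) ?_ isOpen_Ioo
      continuousOn_const (ContinuousOn.div (by fun_prop) cN hN0)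
    rw [EventuallyEq, ae_restrict_iff' measurableSet_Ioo]
    exact hsys.mono fun x hx hm => (hx hm).2.2.2
  -- `S` is only a class in `L²`; it is replaced by the continuous representative that the first
  -- order system provides.
  have hsol := firstOrder_solution (w := w) (S := fun x => 2 * Real.exp (2 * prim υ x)
      * (prim S x * ernstRe S τ υ x + twist S τ υ w x * prim τ x) / ernstSq S τ υ w x)
    (T := prim τ) (U := prim υ) (ψ := prim S) (t := twist S τ υ w) (A := ernstRe S τ υ)
    (N := ernstSq S τ υ w) (fun x hx => ⟨rfl, rfl, hw x hx, rfl,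
      hasDerivAt_prim_of_ae_eq hυ.intervalIntegrable kU
        (hsys.mono fun x hx hm => (hx hm).1) hx,
      hasDerivAt_prim_of_ae_eq hS.intervalIntegrable kS
        (hsys.mono fun x hx hm => (hx hm).2.1) hx,
      hasDerivAt_prim_of_ae_eq hτ.intervalIntegrable kT
        (hsys.mono fun x hx hm => (hx hm).2.2.1) hx,
      hasDerivAt_prim_of_ae_eq (k := fun x => 2 * w * (Real.exp (2 * prim υ x) ^ 2 * (1 - x ^ 2))
        - 2 * (prim S x * (2 * Real.exp (2 * prim υ x) * (prim τ x * ernstRe S τ υ x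
          - twist S τ υ w x * prim S x) / ernstSq S τ υ w x)
          - prim τ x * (2 * Real.exp (2 * prim υ x) * (prim S x * ernstRe S τ υ x
          + twist S τ υ w x * prim τ x) / ernstSq S τ υ w x)))
        (intervalIntegrable_twist' hS hτ hυ)
        (ContinuousOn.sub (by fun_prop) (ContinuousOn.mul continuousOn_const
          (ContinuousOn.sub (cψ.mul kT) (cT.mul kS))))
        (hsys.mono fun x hx hm => by
          rw [twist', ← (hx hm).2.1, ← (hx hm).2.2.1, exp_four_eq]) hx⟩)
    (continuousOn_prim hυ) (continuousOn_prim hτ) (prim_neg_one _) hU1 hT1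
  obtain ⟨g, hg, σS, hσS, σT, hσT, hfam⟩ := hsol
  refine ⟨g, hg, σS, hσS, σT, hσT, (inFamilyAE_iff hg hσT S T U).2 ⟨?_, ?_, ?_⟩⟩
  · have : ∀ᵐ x ∂mu, x ∈ Ioo (-1 : ℝ) 1 → _ := ae_restrict_of_ae hsys
    filter_upwards [this, ae_mu_mem] with x hx hm
    rw [(hx hm).2.1]
    exact (hfam x hm).1
  · filter_upwards [hTe, ae_mu_mem] with x hx hm
    rw [hx]; exact (hfam x hm).2.1
  · filter_upwards [hUe, ae_mu_mem] with x hx hm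
    rw [hx]; exact (hfam x hm).2.2

/-! ### The members of the family belong to `X` and attain the value `1`. -/

section

variable {g : ℝ} (hg : g ∈ Icc (0 : ℝ) 1)

include hg

theorem memW012_famU : MemW012 (famU g) :=
  memW012_of_contDiff (contDiff_famU hg) famU_one famU_neg_one

theorem memW012_famT (σ : ℝ) : MemW012 (famT g σ) :=
  memW012_of_contDiff (contDiff_famT hg σ) (famT_one σ) (famT_neg_one σ)

theorem memX_of_inFamilyAE {σS σT : ℝ} (hT : σT ∈ ({1, -1} : Set ℝ)) {S T U : ℝ → ℝ}
    (h : InFamilyAE (-g ^ 2) σS σT S T U) : MemX S T U := by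
  obtain ⟨h1, h2, h3⟩ := (inFamilyAE_iff hg hT S T U).1 h
  exact ⟨(memLp_congr_ae h1).2 (memL2_of_continuousOn (contDiff_famS hg σS).continuous.continuousOn),
    (memW012_famT hg σT).congr h2.symm, (memW012_famU hg).congr h3.symm⟩

theorem weakDeriv_famU : weakDeriv (famU g) =ᵐ[mu] famU' g :=
  (weakDeriv_of_contDiff ((contDiff_famU hg).of_le (by simp))).trans
    (Eventually.of_forall fun x => (hasDerivAt_famU hg x).deriv)

theorem weakDeriv_famT (σ : ℝ) : weakDeriv (famT g σ) =ᵐ[mu] famT' g σ :=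
  (weakDeriv_of_contDiff ((contDiff_famT hg σ).of_le (by simp))).trans
    (Eventually.of_forall fun x => (hasDerivAt_famT hg σ x).deriv)

theorem integral_famS (σ : ℝ) : ∫ x in (-1)..1, famS g σ x = 2 * σ * g := by
  have hd : ∀ x, HasDerivAt (fun x => 2 * σ * g * x / famD g x) (famS g σ x) x := by
    intro x
    have hD := famD_pos hg x
    refine (((hasDerivAt_id x).const_mul (2 * σ * g)).fun_div (hasDerivAt_famD x)
      hD.ne').congr_deriv ?_
    rw [famS, div_left_inj' (by positivity)]
    simp only [id]
    unfold famD; ring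
  rw [intervalIntegral.integral_eq_sub_of_hasDerivAt (fun x _ => hd x)
    ((contDiff_famS hg σ).continuous.intervalIntegrable _ _), famD, famD]
  ring

/-- The total angular momentum of the family. -/
theorem integral_fam_angular_momentum :
    (∫ x in (-1)..1, 4 / famD g x ^ 2 * (1 - x ^ 2))
      + 4 * (∫ x in (-1)..1, 2 * g ^ 2 * (1 + g ^ 2 - (1 - g ^ 2) * x ^ 2) * (1 - x ^ 2)
        / famD g x ^ 3) = 4 := by
  have hne : ∀ x, famD g x ≠ 0 := fun x => (famD_pos hg x).ne'
  have cD : Continuous (famD g) := contDiff_famD.continuous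
  have i1 : IntervalIntegrable (fun x => 4 / famD g x ^ 2 * (1 - x ^ 2)) volume (-1) 1 :=
    Continuous.intervalIntegrable (Continuous.mul (Continuous.div continuous_const (cD.pow 2)
      fun x => pow_ne_zero _ (hne x)) (by fun_prop)) _ _
  have i2 : IntervalIntegrable (fun x => 2 * g ^ 2 * (1 + g ^ 2 - (1 - g ^ 2) * x ^ 2)
      * (1 - x ^ 2) / famD g x ^ 3) volume (-1) 1 :=
    Continuous.intervalIntegrable (Continuous.div (by fun_prop) (cD.pow 3)
      fun x => pow_ne_zero _ (hne x)) _ _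
  rw [← intervalIntegral.integral_const_mul, ← intervalIntegral.integral_add i1 (i2.const_mul 4),
    intervalIntegral.integral_eq_sub_of_hasDerivAt
    -- Each integral alone may involve an arctangent, but the sum has a rational odd primitive with
    -- value `8/4 = 2` at `1`.
    (f := fun x => (4 * (1 + 2 * g ^ 2) * x + 4 * (1 - 2 * g ^ 2) * x ^ 3) / famD g x ^ 2) ?_
    (i1.add (i2.const_mul 4))]
  · rw [famD, famD]; ring
  · intro x _
    have hD := famD_pos hg x
    have d1 : HasDerivAt (fun x => 4 * (1 + 2 * g ^ 2) * x + 4 * (1 - 2 * g ^ 2) * x ^ 3)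
        (4 * (1 + 2 * g ^ 2) + 4 * (1 - 2 * g ^ 2) * (3 * x ^ 2)) x := by
      have := ((hasDerivAt_id x).const_mul (4 * (1 + 2 * g ^ 2))).fun_add
        (((hasDerivAt_id x).fun_pow 3).const_mul (4 * (1 - 2 * g ^ 2)))
      simpa using this
    refine (d1.fun_div ((hasDerivAt_famD x).fun_pow 2) (by positivity)).congr_deriv ?_
    push_cast
    field_simp
    unfold famD
    ring

/-- `c₁` need not be evaluated: with `c = √(1-g⁴)` the energy is `1 - c²c₁²/8` and `M₂ = cc₁/2`, so
`c₁` cancels. -/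
theorem functionalI_of_inFamilyAE {σS σT : ℝ} (hS : σS ∈ ({1, -1} : Set ℝ))
    (hT : σT ∈ ({1, -1} : Set ℝ)) {S T U : ℝ → ℝ}
    (h : InFamilyAE (-g ^ 2) σS σT S T U) : functionalI S T U = 1 := by
  have hX := memX_of_inFamilyAE hg hT h
  obtain ⟨h1, h2, h3⟩ := (inFamilyAE_iff hg hT S T U).1 h
  have h2' := (weakDeriv_congr hX.memT.memW12 h2).trans (weakDeriv_famT hg σT)
  have h3' := (weakDeriv_congr hX.memU.memW12 h3).trans (weakDeriv_famU hg)
  have hc := sq_sqrt_one_sub_pow_four hg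
  have hc0 := Real.sqrt_nonneg (1 - g ^ 4)
  have hne : ∀ x, famD g x ≠ 0 := fun x => (famD_pos hg x).ne'
  have cD : Continuous (famD g) := contDiff_famD.continuous
  have i1 : IntervalIntegrable (fun x => 4 / famD g x ^ 2 * (1 - x ^ 2)) volume (-1) 1 :=
    Continuous.intervalIntegrable (Continuous.mul (Continuous.div continuous_const (cD.pow 2)
      fun x => pow_ne_zero _ (hne x)) (by fun_prop)) _ _
  obtain ⟨hc1, hc1pos⟩ := c₁_sq (contDiff_famU hg).continuous.continuousOn h3
  simp_rw [exp_four_famU hg] at hc1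
  have hang := integral_fam_angular_momentum hg
  set c := Real.sqrt (1 - g ^ 4)
  set K := ∫ x in (-1)..1, 2 * g ^ 2 * (1 + g ^ 2 - (1 - g ^ 2) * x ^ 2) * (1 - x ^ 2)
        / famD g x ^ 3 with hK
  rw [← hc1] at hang
  have hK0 : 0 ≤ K := by
    refine intervalIntegral.integral_nonneg (by norm_num) fun x hx => ?_
    have hD := famD_pos hg x
    have e1 : 0 ≤ 1 - x ^ 2 := by nlinarith [hx.1, hx.2]
    have e2 : 0 ≤ 1 + g ^ 2 - (1 - g ^ 2) * x ^ 2 := by nlinarith [sq_nonneg g, sq_nonneg (g * x)]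
    positivity
  have hE : energy S T U = (1 / 2) * (2 - c ^ 2 / 4 * c₁ U ^ 2) := by
    have e : ∫ x in (-1)..1, ((weakDeriv U x) ^ 2 * (1 - x ^ 2) - 2 * x * weakDeriv U x
        + ((S x) ^ 2 + (weakDeriv T x) ^ 2) * Real.exp (-2 * U x))
        = ∫ x in (-1)..1, (1 - (1 - g ^ 4) / 4 * (4 / famD g x ^ 2 * (1 - x ^ 2))) :=
      intervalIntegral_congr_mu (by
        filter_upwards [h1, h2', h3, h3'] with x e1 e2 e3 e4
        rw [e1, e2, e3, e4, exp_neg_two_famU hg, fam_energy_density hg hS hT])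
    rw [energy, e, intervalIntegral.integral_sub (by simp) (i1.const_mul _),
      intervalIntegral.integral_const_mul, ← hc1, ← hc]
    norm_num
  have hc2 : |c₂ S T| = c * K := by
    have e : c₂ S T = σS * σT * (c * K) := by
      rw [c₂, hK, ← mul_assoc, ← intervalIntegral.integral_const_mul]
      refine intervalIntegral_congr_mu ?_
      filter_upwards [h1, h2] with x e1 e2
      have hD := famD_pos hg x
      rw [e1, e2, famS, famT]
      simp only [c]
      field_simp
    rw [e, abs_mul, abs_of_nonneg (show 0 ≤ c * K by positivity)]
    have : |σS * σT| = 1 := by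
      rw [← sq_eq_sq₀ (abs_nonneg _) zero_le_one, sq_abs, mul_pow, sq_of_sign hS, sq_of_sign hT]
      norm_num
    rw [this, one_mul]
  have hc3 : c₃ S ^ 2 = 2 * g ^ 2 := by
    have e : ∫ x in (-1)..1, S x = 2 * σS * g := by
      rw [intervalIntegral_congr_mu h1, integral_famS hg]
    rw [c₃, e, mul_pow, div_pow, Real.sq_sqrt (by norm_num), mul_pow, mul_pow, sq_of_sign hS]
    ring
  have hM1 : Real.sqrt (M₁ S) = 2 * c := by
    have e : M₁ S = (2 * c) ^ 2 := by
      have e' : 4 - c₃ S ^ 4 = (2 * c) ^ 2 := by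
        rw [mul_pow, hc]
        linear_combination (-(c₃ S ^ 2) - 2 * g ^ 2) * hc3
      rw [M₁, e', max_eq_right (sq_nonneg _)]
    rw [e, Real.sqrt_sq (by positivity)]
  have hM2 : M₂ S T U = c * c₁ U / 2 := by
    -- The numerator is `2c(1-K)`, and `c₁² + 4K = 4`.
    have e : (Real.sqrt (M₁ S) - 2 * |c₂ S T|) / c₁ U = c * c₁ U / 2 := by
      rw [hM1, hc2, div_eq_iff hc1pos.ne']
      linear_combination (-c / 2) * hang
    rw [M₂, e, max_eq_right (by positivity)]
  rw [functionalI, hE, hM2]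
  ring

end

theorem memX_and_functionalI_eq_one_iff (S T U : ℝ → ℝ) :
    (MemX S T U ∧ functionalI S T U = 1) ↔
      ∃ γ ∈ Icc (-1 : ℝ) 0, ∃ σS ∈ ({1, -1} : Set ℝ), ∃ σT ∈ ({1, -1} : Set ℝ),
        InFamilyAE γ σS σT S T U := by
  rw [exists_family_iff (P := fun γ σS σT => InFamilyAE γ σS σT S T U)]
  constructor
  · rintro ⟨h1, h2⟩
    exact family_of_functionalI_eq_one h1 h2
  · rintro ⟨g, hg, σS, hS, σT, hT, h⟩
    exact ⟨memX_of_inFamilyAE hg hT h, functionalI_of_inFamilyAE hg hS hT h⟩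

theorem isLeast_functionalI :
    IsLeast {r : ℝ | ∃ S T U : ℝ → ℝ, MemX S T U ∧ functionalI S T U = r} 1 := by
  constructor
  · have h0 : (0 : ℝ) ∈ Icc (0 : ℝ) 1 := by norm_num
    have h1 : (1 : ℝ) ∈ ({1, -1} : Set ℝ) := by simp
    have h := (inFamilyAE_iff (σS := 1) h0 h1 (famS 0 1) (famT 0 1) (famU 0)).2
      ⟨EventuallyEq.rfl, EventuallyEq.rfl, EventuallyEq.rfl⟩
    exact ⟨_, _, _, memX_of_inFamilyAE h0 h1 h, functionalI_of_inFamilyAE h0 h1 h1 h⟩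
  · rintro r ⟨S, T, U, h, rfl⟩
    exact one_le_functionalI h

/-! ### The first variation of the Lagrangian -/

theorem intervalIntegral_eq_mu (f : ℝ → ℝ) : ∫ x in (-1)..1, f x = ∫ x, f x ∂mu := by
  rw [intervalIntegral.integral_of_le (by norm_num), mu_eq_Ioc]

/-- Essentially bounded functions on `(-1,1)`. -/
structure EssBdd (k : ℝ → ℝ) : Prop where
  aesm : AEStronglyMeasurable k mu
  bound : ∃ C, ∀ᵐ x ∂mu, ‖k x‖ ≤ C

theorem essBdd_of_continuousOn {k : ℝ → ℝ} (h : ContinuousOn k (Icc (-1) 1)) : EssBdd k := by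
  obtain ⟨C, hC⟩ := isCompact_Icc.exists_bound_of_continuousOn h
  refine ⟨(memL2_of_continuousOn h).aestronglyMeasurable, C, ?_⟩
  filter_upwards [ae_mu_mem] with x hx using hC x (Ioo_subset_Icc_self hx)

/-- The one-dimensional Sobolev embedding, through the continuous primitive. -/
theorem MemW012.essBdd {u : ℝ → ℝ} (h : MemW012 u) : EssBdd u := by
  have hp := h.isPrimitive
  obtain ⟨-, C, hC⟩ := essBdd_of_continuousOn (continuousOn_prim hp.memL2)
  refine ⟨h.memW12.memL2.aestronglyMeasurable, C, ?_⟩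
  filter_upwards [hC, hp.ae_eq] with x h1 h2
  rw [h2]; exact h1

theorem EssBdd.exp_const_mul {k : ℝ → ℝ} (h : EssBdd k) (a : ℝ) :
    EssBdd (fun x => Real.exp (a * k x)) := by
  obtain ⟨h1, C, hC⟩ := h
  refine ⟨Real.continuous_exp.comp_aestronglyMeasurable (h1.const_mul a), Real.exp (|a| * C), ?_⟩
  filter_upwards [hC] with x hx
  rw [Real.norm_eq_abs, Real.abs_exp, Real.exp_le_exp]
  refine (le_abs_self _).trans ?_
  rw [abs_mul]
  exact mul_le_mul_of_nonneg_left hx (abs_nonneg a)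

theorem EssBdd.mul {k l : ℝ → ℝ} (h : EssBdd k) (h' : EssBdd l) : EssBdd (fun x => k x * l x) := by
  obtain ⟨h1, C, hC⟩ := h
  obtain ⟨h2, D, hD⟩ := h'
  refine ⟨h1.mul h2, C * D, ?_⟩
  filter_upwards [hC, hD] with x h3 h4
  rw [norm_mul]
  exact mul_le_mul h3 h4 (norm_nonneg _) ((norm_nonneg _).trans h3)

theorem Integrable.mul_essBdd {f k : ℝ → ℝ} (hf : Integrable f mu) (hk : EssBdd k) :
    Integrable (fun x => f x * k x) mu := by
  obtain ⟨h1, C, hC⟩ := hk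
  exact hf.mul_bdd h1 hC

theorem EssBdd.integrable {k : ℝ → ℝ} (h : EssBdd k) : Integrable k mu := by
  simpa using Integrable.mul_essBdd (integrable_const (1 : ℝ)) h

theorem MemL2.integrable_mul {f k : ℝ → ℝ} (hf : MemL2 f) (hk : MemL2 k) :
    Integrable (fun x => f x * k x) mu :=
  integrable_mu_iff.2 (hf.mul hk)

/-- Along a line in `X` the Lagrangian depends on `t` polynomially except for factors `e^{tk}` with
`k` a multiple of the bounded function `ψ`. For `|t| < 1` the derivative is dominated by `Ce^C|f|`.
-/
theorem hasDerivAt_integral_mul_exp {f k : ℝ → ℝ} (hf : Integrable f mu) (hk : EssBdd k) :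
    HasDerivAt (fun t : ℝ => ∫ x, f x * Real.exp (t * k x) ∂mu) (∫ x, f x * k x ∂mu) 0 := by
  obtain ⟨h1, C, hC⟩ := hk
  have hm : ∀ t : ℝ, Integrable (fun x => f x * Real.exp (t * k x)) mu := fun t =>
    Integrable.mul_essBdd hf (EssBdd.exp_const_mul ⟨h1, C, hC⟩ t)
  have key := (hasDerivAt_integral_of_dominated_loc_of_deriv_le (μ := mu) (𝕜 := ℝ)
    (F := fun t x => f x * Real.exp (t * k x))
    (F' := fun t x => f x * (Real.exp (t * k x) * k x)) (x₀ := (0 : ℝ))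
    (s := Metric.ball 0 1) (bound := fun x => ‖f x‖ * (Real.exp C * C))
    (Metric.ball_mem_nhds _ one_pos)
    (Eventually.of_forall fun t => (hm t).aestronglyMeasurable) (hm 0)
    (hf.aestronglyMeasurable.mul ((Real.continuous_exp.comp_aestronglyMeasurable
      (h1.const_mul 0)).mul h1)) ?_ (hf.norm.mul_const _) ?_).2
  · simpa using key
  · filter_upwards [hC] with x hx t ht
    have ht' : |t| ≤ 1 := by
      rw [Metric.mem_ball, dist_zero_right] at ht
      exact ht.le
    have hx' : |k x| ≤ C := hx
    rw [norm_mul, norm_mul, Real.norm_eq_abs (Real.exp _), Real.abs_exp]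
    refine mul_le_mul_of_nonneg_left ?_ (norm_nonneg _)
    refine mul_le_mul (Real.exp_le_exp.2 ?_) hx (norm_nonneg _) (Real.exp_pos _).le
    refine (le_abs_self _).trans ?_
    rw [abs_mul]
    nlinarith [abs_nonneg t, abs_nonneg (k x)]
  · refine Eventually.of_forall fun x t _ => ?_
    have : HasDerivAt (fun t : ℝ => t * k x) (k x) t := by
      simpa using (hasDerivAt_id t).mul_const (k x)
    exact this.exp.const_mul (f x)

/-- The first variation of the Lagrangian at `(S,T,U)` in the direction `(ρ,φ,ψ)`. -/
noncomputable def firstVariation (l₁ l₂ l₃ : ℝ) (S T U ρ φ ψ : ℝ → ℝ) : ℝ :=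
  (∫ x, ((1 - x ^ 2) * (weakDeriv U x * weakDeriv ψ x) - x * weakDeriv ψ x) ∂mu)
    - (∫ x, (S x ^ 2 + weakDeriv T x ^ 2) * Real.exp (-2 * U x) * ψ x ∂mu)
    + (∫ x, (S x * ρ x + weakDeriv T x * weakDeriv φ x) * Real.exp (-2 * U x) ∂mu)
    + 4 * l₁ * (∫ x, Real.exp (4 * U x) * (1 - x ^ 2) * ψ x ∂mu)
    + l₂ * (∫ x, (ρ x * T x + S x * φ x) ∂mu) + l₃ * ∫ x, ρ x ∂mu

/-! ### Differentiability of the Lagrangian along lines in `X`. -/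

section Variation

variable {S T U ρ φ ψ : ℝ → ℝ} (h : MemX S T U) (h' : MemX ρ φ ψ)

include h h'

theorem hasDerivAt_energy : HasDerivAt (fun t : ℝ => energy (fun x => S x + t * ρ x)
      (fun x => T x + t * φ x) (fun x => U x + t * ψ x))
    ((∫ x, ((1 - x ^ 2) * (weakDeriv U x * weakDeriv ψ x) - x * weakDeriv ψ x) ∂mu)
    - (∫ x, (S x ^ 2 + weakDeriv T x ^ 2) * Real.exp (-2 * U x) * ψ x ∂mu)
    + (∫ x, (S x * ρ x + weakDeriv T x * weakDeriv φ x) * Real.exp (-2 * U x) ∂mu)) 0 := by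
  have wU := fun t => h.memU.memW12.weakDeriv_add_const_mul h'.memU.memW12 t
  have wT := fun t => h.memT.memW12.weakDeriv_add_const_mul h'.memT.memW12 t
  have mU := h.memU.memW12.memL2_weakDeriv
  have mT := h.memT.memW12.memL2_weakDeriv
  have mψ := h'.memU.memW12.memL2_weakDeriv
  have mφ := h'.memT.memW12.memL2_weakDeriv
  have bU := h.memU.essBdd
  have bψ := h'.memU.essBdd
  have bE : EssBdd (fun x => Real.exp (-2 * U x)) := bU.exp_const_mul (-2)
  have bk : EssBdd (fun x => -2 * ψ x) :=
    (essBdd_of_continuousOn continuousOn_const).mul bψ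
  have b1 : EssBdd (fun x => 1 - x ^ 2) := essBdd_of_continuousOn (by fun_prop)
  have bx : EssBdd (fun x => x) := essBdd_of_continuousOn (by fun_prop)
  have sqI : ∀ {p q : ℝ → ℝ}, MemL2 p → MemL2 q → ∀ {p' q' : ℝ → ℝ}, MemL2 p' → MemL2 q' →
      Integrable (fun x => (p x * q x + p' x * q' x) * Real.exp (-2 * U x)) mu :=
    fun hp hq _ _ hp' hq' =>
      Integrable.mul_essBdd ((hp.integrable_mul hq).add (hp'.integrable_mul hq')) bE
  have I0 := sqI h.memS h.memS mT mT
  have I1 := sqI h.memS h'.memS mT mφ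
  have I2 := sqI h'.memS h'.memS mφ mφ
  have J0 : Integrable (fun x => weakDeriv U x * weakDeriv U x * (1 - x ^ 2)
      - 2 * (weakDeriv U x * x)) mu := (Integrable.mul_essBdd (mU.integrable_mul mU) b1).sub
    ((Integrable.mul_essBdd (MemLp.integrable one_le_two mU) bx).const_mul 2)
  have J1 : Integrable (fun x => weakDeriv U x * weakDeriv ψ x * (1 - x ^ 2)
      - weakDeriv ψ x * x) mu := (Integrable.mul_essBdd (mU.integrable_mul mψ) b1).sub
    (Integrable.mul_essBdd (MemLp.integrable one_le_two mψ) bx)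
  have J2 := Integrable.mul_essBdd (mψ.integrable_mul mψ) b1
  have G0 := hasDerivAt_integral_mul_exp I0 bk
  have G1 := hasDerivAt_integral_mul_exp I1 bk
  have G2 := hasDerivAt_integral_mul_exp I2 bk
  have bt : ∀ t : ℝ, EssBdd (fun x => Real.exp (t * (-2 * ψ x))) := fun t => bk.exp_const_mul t
  -- The `U'` part is quadratic in `t`; the rest is a quadratic polynomial in `t` times `e^{-2tψ}`
  -- under the integral. Terms with `t²` do not contribute at `t = 0`.
  have expand : ∀ t : ℝ, energy (fun x => S x + t * ρ x) (fun x => T x + t * φ x)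
      (fun x => U x + t * ψ x) = (1 / 2) * (
        ((∫ x, (weakDeriv U x * weakDeriv U x * (1 - x ^ 2) - 2 * (weakDeriv U x * x)) ∂mu)
        + (2 * t) * (∫ x, (weakDeriv U x * weakDeriv ψ x * (1 - x ^ 2) - weakDeriv ψ x * x) ∂mu)
        + t ^ 2 * ∫ x, weakDeriv ψ x * weakDeriv ψ x * (1 - x ^ 2) ∂mu)
        + ((∫ x, (S x * S x + weakDeriv T x * weakDeriv T x) * Real.exp (-2 * U x)
            * Real.exp (t * (-2 * ψ x)) ∂mu)
        + (2 * t) * (∫ x, (S x * ρ x + weakDeriv T x * weakDeriv φ x) * Real.exp (-2 * U x)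
            * Real.exp (t * (-2 * ψ x)) ∂mu)
        + t ^ 2 * ∫ x, (ρ x * ρ x + weakDeriv φ x * weakDeriv φ x) * Real.exp (-2 * U x)
            * Real.exp (t * (-2 * ψ x)) ∂mu)) := by
    intro t
    rw [energy, intervalIntegral_eq_mu]
    congr 1
    have K0 := Integrable.mul_essBdd I0 (bt t)
    have K1 := Integrable.mul_essBdd I1 (bt t)
    have K2 := Integrable.mul_essBdd I2 (bt t)
    rw [integral_congr_ae (g := fun x =>
      ((weakDeriv U x * weakDeriv U x * (1 - x ^ 2) - 2 * (weakDeriv U x * x))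
        + 2 * t * (weakDeriv U x * weakDeriv ψ x * (1 - x ^ 2) - weakDeriv ψ x * x)
        + t ^ 2 * (weakDeriv ψ x * weakDeriv ψ x * (1 - x ^ 2)))
      + ((S x * S x + weakDeriv T x * weakDeriv T x) * Real.exp (-2 * U x)
            * Real.exp (t * (-2 * ψ x))
        + 2 * t * ((S x * ρ x + weakDeriv T x * weakDeriv φ x) * Real.exp (-2 * U x)
            * Real.exp (t * (-2 * ψ x)))
        + t ^ 2 * ((ρ x * ρ x + weakDeriv φ x * weakDeriv φ x) * Real.exp (-2 * U x)
            * Real.exp (t * (-2 * ψ x)))))]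
    · have A1 : ∀ {p q r : ℝ → ℝ}, Integrable p mu → Integrable q mu → Integrable r mu →
          ∀ a b : ℝ, Integrable (fun x => p x + a * q x + b * r x) mu ∧
            ∫ x, (p x + a * q x + b * r x) ∂mu
              = (∫ x, p x ∂mu) + a * (∫ x, q x ∂mu) + b * ∫ x, r x ∂mu := by
        intro p q r hp hq hr a b
        have i1 : Integrable (fun x => p x + a * q x) mu := hp.add (hq.const_mul a)
        refine ⟨i1.add (hr.const_mul b), ?_⟩
        rw [integral_add i1 (hr.const_mul b), integral_add hp (hq.const_mul a),
          integral_const_mul, integral_const_mul]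
      rw [integral_add (A1 J0 J1 J2 _ _).1 (A1 K0 K1 K2 _ _).1, (A1 J0 J1 J2 _ _).2,
        (A1 K0 K1 K2 _ _).2]
    · filter_upwards [wU t, wT t] with x e1 e2
      rw [e1, e2, show -2 * (U x + t * ψ x) = -2 * U x + t * (-2 * ψ x) by ring, Real.exp_add]
      ring
  have e := funext expand
  rw [e]
  have d1 : HasDerivAt (fun t : ℝ => 2 * t) 2 0 := by simpa using (hasDerivAt_id (0 : ℝ)).const_mul 2
  have d2 : HasDerivAt (fun t : ℝ => t ^ 2) 0 0 := by simpa using (hasDerivAt_id (0 : ℝ)).fun_pow 2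
  have := (((((d1.mul_const (∫ x, (weakDeriv U x * weakDeriv ψ x * (1 - x ^ 2)
      - weakDeriv ψ x * x) ∂mu)).const_add
        (∫ x, (weakDeriv U x * weakDeriv U x * (1 - x ^ 2) - 2 * (weakDeriv U x * x)) ∂mu)).fun_add
    (d2.mul_const (∫ x, weakDeriv ψ x * weakDeriv ψ x * (1 - x ^ 2) ∂mu)))).fun_add
    ((G0.fun_add (d1.fun_mul G1)).fun_add (d2.fun_mul G2))).const_mul (1 / 2)
  refine this.congr_deriv ?_
  simp only [mul_zero, zero_mul, Real.exp_zero, mul_one, add_zero, zero_pow two_ne_zero]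
  have f1 : ∫ x, (weakDeriv U x * weakDeriv ψ x * (1 - x ^ 2) - weakDeriv ψ x * x) ∂mu
      = ∫ x, ((1 - x ^ 2) * (weakDeriv U x * weakDeriv ψ x) - x * weakDeriv ψ x) ∂mu := by
    congr 1; ext x; ring
  have f2 : ∫ x, (S x * S x + weakDeriv T x * weakDeriv T x) * Real.exp (-2 * U x) * (-2 * ψ x) ∂mu
      = -2 * ∫ x, (S x ^ 2 + weakDeriv T x ^ 2) * Real.exp (-2 * U x) * ψ x ∂mu := by
    rw [← integral_const_mul]; congr 1; ext x; ring
  rw [f1, f2]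
  ring

theorem hasDerivAt_lagrangian (l₁ l₂ l₃ : ℝ) :
    HasDerivAt (fun t : ℝ => lagrangian l₁ l₂ l₃ (fun x => S x + t * ρ x)
      (fun x => T x + t * φ x) (fun x => U x + t * ψ x))
      (firstVariation l₁ l₂ l₃ S T U ρ φ ψ) 0 := by
  have bU := h.memU.essBdd
  have bψ := h'.memU.essBdd
  have b1 : EssBdd (fun x => 1 - x ^ 2) := essBdd_of_continuousOn (by fun_prop)
  have bk : EssBdd (fun x => 4 * ψ x) :=
    (essBdd_of_continuousOn continuousOn_const).mul bψ
  have D1 : HasDerivAt (fun t : ℝ => c₁ (fun x => U x + t * ψ x) ^ 2)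
      (4 * ∫ x, Real.exp (4 * U x) * (1 - x ^ 2) * ψ x ∂mu) 0 := by
    have e : ∀ t : ℝ, c₁ (fun x => U x + t * ψ x) ^ 2
        = ∫ x, Real.exp (4 * U x) * (1 - x ^ 2) * Real.exp (t * (4 * ψ x)) ∂mu := by
      intro t
      rw [c₁, Real.sq_sqrt, intervalIntegral_eq_mu]
      · congr 1; ext x
        rw [show 4 * (U x + t * ψ x) = 4 * U x + t * (4 * ψ x) by ring, Real.exp_add]
        ring
      · refine intervalIntegral.integral_nonneg (by norm_num) fun x hx => ?_
        have : 0 ≤ 1 - x ^ 2 := by nlinarith [hx.1, hx.2]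
        positivity
    rw [funext e]
    refine (hasDerivAt_integral_mul_exp ((bU.exp_const_mul 4).mul b1).integrable bk).congr_deriv ?_
    rw [← integral_const_mul]
    congr 1; ext x; ring
  have mT := h.memT.memW12.memL2
  have mφ := h'.memT.memW12.memL2
  have D2 : HasDerivAt (fun t : ℝ => c₂ (fun x => S x + t * ρ x) (fun x => T x + t * φ x))
      (∫ x, (ρ x * T x + S x * φ x) ∂mu) 0 := by
    have i0 := h.memS.integrable_mul mT
    have i1 : Integrable (fun x => ρ x * T x + S x * φ x) mu := (h'.memS.integrable_mul mT).add (h.memS.integrable_mul mφ)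
    have i2 := h'.memS.integrable_mul mφ
    have e : ∀ t : ℝ, c₂ (fun x => S x + t * ρ x) (fun x => T x + t * φ x)
        = (∫ x, S x * T x ∂mu) + t * (∫ x, (ρ x * T x + S x * φ x) ∂mu)
          + t ^ 2 * ∫ x, ρ x * φ x ∂mu := by
      intro t
      have i3 : Integrable (fun x => S x * T x + t * (ρ x * T x + S x * φ x)) mu :=
        i0.add (i1.const_mul t)
      rw [c₂, intervalIntegral_eq_mu, ← integral_const_mul, ← integral_const_mul,
        ← integral_add i0 (i1.const_mul _), ← integral_add i3 (i2.const_mul _)]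
      congr 1; ext x
      ring
    rw [funext e]
    have d1 := (hasDerivAt_id (0 : ℝ)).mul_const (∫ x, (ρ x * T x + S x * φ x) ∂mu)
    have d2 := ((hasDerivAt_id (0 : ℝ)).fun_pow 2).mul_const (∫ x, ρ x * φ x ∂mu)
    refine ((d1.const_add (∫ x, S x * T x ∂mu)).fun_add d2).congr_deriv ?_
    simp
  have D3 : HasDerivAt (fun t : ℝ => Real.sqrt 2 * l₃ * c₃ (fun x => S x + t * ρ x))
      (l₃ * ∫ x, ρ x ∂mu) 0 := by
    have e : ∀ t : ℝ, Real.sqrt 2 * l₃ * c₃ (fun x => S x + t * ρ x)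
        = l₃ * ((∫ x, S x ∂mu) + t * ∫ x, ρ x ∂mu) := by
      intro t
      rw [c₃, intervalIntegral_eq_mu, integral_add (MemLp.integrable one_le_two h.memS)
          ((MemLp.integrable one_le_two h'.memS).const_mul t), integral_const_mul]
      have : Real.sqrt 2 ≠ 0 := by positivity
      field_simp
    rw [funext e]
    have d1 := (hasDerivAt_id (0 : ℝ)).mul_const (∫ x, ρ x ∂mu)
    refine ((d1.const_add (∫ x, S x ∂mu)).const_mul l₃).congr_deriv ?_
    simp
  refine ((((hasDerivAt_energy h h').fun_add (D1.const_mul l₁)).fun_add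
    (D2.const_mul l₂)).fun_add D3).congr_deriv ?_
  rw [firstVariation]
  ring

omit h h' in
-- The variation is affine in the multipliers, so once one admissible triple is known, the others
-- are governed by the three linear functionals on the right.
theorem firstVariation_sub (l₁ l₂ l₃ k₁ k₂ k₃ : ℝ) :
    firstVariation l₁ l₂ l₃ S T U ρ φ ψ - firstVariation k₁ k₂ k₃ S T U ρ φ ψ
      = 4 * (l₁ - k₁) * (∫ x, Real.exp (4 * U x) * (1 - x ^ 2) * ψ x ∂mu)
        + (l₂ - k₂) * (∫ x, (ρ x * T x + S x * φ x) ∂mu) + (l₃ - k₃) * ∫ x, ρ x ∂mu := by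
  rw [firstVariation, firstVariation]; ring

end Variation

/-- Integration by parts against an element of `W₀^{1,2}`. -/
theorem MemW012.integral_mul_weakDeriv {G ψ : ℝ → ℝ} (hψ : MemW012 ψ) (hG : ContDiff ℝ 1 G) :
    ∫ x, G x * weakDeriv ψ x ∂mu = -∫ x, deriv G x * ψ x ∂mu := by
  have hp := hψ.isPrimitive
  have a1 := (IsACWith.of_contDiff hG).mul (isACWith_prim hp.memL2.intervalIntegrable)
  have e := a1.integral_eq
  have h1 : prim (weakDeriv ψ) 1 = 0 := hp.integral_eq_zero
  rw [prim_neg_one, h1, intervalIntegral_eq_mu] at e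
  have i1 : Integrable (fun x => G x * weakDeriv ψ x) mu := by
    simpa only [mul_comm] using Integrable.mul_essBdd (MemLp.integrable one_le_two hp.memL2)
      (essBdd_of_continuousOn hG.continuous.continuousOn)
  have i2 : Integrable (fun x => deriv G x * ψ x) mu :=
    Integrable.mul_essBdd (essBdd_of_continuousOn
      (hG.continuous_deriv le_rfl).continuousOn).integrable hψ.essBdd
  have e' : ∫ x, (deriv G x * ψ x + G x * weakDeriv ψ x) ∂mu = 0 := by
    rw [mul_zero, mul_zero, sub_self] at e
    rw [← e]
    refine integral_congr_ae ?_
    filter_upwards [hp.ae_eq] with x hx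
    rw [hx]; rfl
  rw [integral_add i2 i1] at e'
  linarith

theorem firstVariation_congr {S T U S' T' U' ρ φ ψ : ℝ → ℝ} (hT : MemW12 T) (hU : MemW12 U)
    (h1 : S =ᵐ[mu] S') (h2 : T =ᵐ[mu] T') (h3 : U =ᵐ[mu] U') (l₁ l₂ l₃ : ℝ) :
    firstVariation l₁ l₂ l₃ S T U ρ φ ψ = firstVariation l₁ l₂ l₃ S' T' U' ρ φ ψ := by
  have h4 := weakDeriv_congr hT h2
  have h5 := weakDeriv_congr hU h3
  rw [firstVariation, firstVariation]
  congr 2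
  · congr 1
    · congr 1
      · congr 1
        · refine integral_congr_ae ?_
          filter_upwards [h5] with x e
          rw [e]
        · refine integral_congr_ae ?_
          filter_upwards [h1, h3, h4] with x e1 e2 e3
          rw [e1, e2, e3]
      · refine integral_congr_ae ?_
        filter_upwards [h1, h3, h4] with x e1 e2 e3
        rw [e1, e2, e3]
    · congr 1
      refine integral_congr_ae ?_
      filter_upwards [h3] with x e
      rw [e]
  · congr 1
    refine integral_congr_ae ?_
    filter_upwards [h1, h2] with x e1 e2
    rw [e1, e2]

/-! ### The first variation at the family and uniqueness of the multipliers. -/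

section

variable {g : ℝ} (hg : g ∈ Icc (0 : ℝ) 1)

include hg

theorem contDiff_famU' : ContDiff ℝ 1 (famU' g) := by
  unfold famU'
  exact ContDiff.div (by fun_prop) (contDiff_famD.of_le (by simp)) fun x => (famD_pos hg x).ne'

theorem contDiff_famT' (σ : ℝ) : ContDiff ℝ 1 (famT' g σ) := by
  unfold famT'
  exact ContDiff.div (by fun_prop) ((contDiff_famD.of_le (by simp)).pow 2)
    fun x => pow_ne_zero _ (famD_pos hg x).ne'

/-- Integration by parts moves the derivative from `ψ` to `(1-x²)U' - x` and from `φ` to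
`T'e^{-2U}`. By `fam_eqU`, `fam_eqT` and `famS_eq` the integrands then cancel. -/
theorem firstVariation_family {σS σT : ℝ} (hS : σS ∈ ({1, -1} : Set ℝ))
    (hT : σT ∈ ({1, -1} : Set ℝ)) {ρ φ ψ : ℝ → ℝ} (h : MemX ρ φ ψ) :
    firstVariation (-(1 - g ^ 4) / 8) (-(σS * σT) * Real.sqrt (1 - g ^ 4)) (-σS * g ^ 3)
      (famS g σS) (famT g σT) (famU g) ρ φ ψ = 0 := by
  have hD := famD_pos hg
  have cS : EssBdd (famS g σS) :=
    essBdd_of_continuousOn (contDiff_famS hg σS).continuous.continuousOn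
  have cT : EssBdd (famT g σT) :=
    essBdd_of_continuousOn (contDiff_famT hg σT).continuous.continuousOn
  have iρ : Integrable ρ mu := MemLp.integrable one_le_two h.memS
  have iφ' : Integrable (weakDeriv φ) mu :=
    MemLp.integrable one_le_two h.memT.memW12.memL2_weakDeriv
  have bφ := h.memT.essBdd
  have bψ := h.memU.essBdd
  have dG : ContDiff ℝ 1 (fun x => (1 - x ^ 2) * famU' g x - x) :=
    ContDiff.sub (ContDiff.mul (by fun_prop) (contDiff_famU' hg)) contDiff_id
  have dH : ContDiff ℝ 1 (fun x => famT' g σT x * (famD g x / 2)) :=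
    (contDiff_famT' hg σT).mul ((contDiff_famD.of_le (by simp)).div_const 2)
  have eG : ∀ x, deriv (fun x => (1 - x ^ 2) * famU' g x - x) x
      = -((famS g σS x ^ 2 + famT' g σT x ^ 2) * (famD g x / 2))
        - (1 / 2) * (1 - g ^ 4) * (4 / famD g x ^ 2 * (1 - x ^ 2)) := by
    intro x
    have d1 : HasDerivAt (fun x : ℝ => 1 - x ^ 2) (-(2 * x)) x := by
      simpa using ((hasDerivAt_id x).fun_pow 2).const_sub 1
    have := ((d1.fun_mul (hasDerivAt_famU' hg x)).fun_sub (hasDerivAt_id x)).deriv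
    simp only [id] at this
    rw [this]
    linear_combination (-1) * fam_eqU hg hS hT x
  have eH : ∀ x, deriv (fun x => famT' g σT x * (famD g x / 2)) x
      = -(σS * σT) * Real.sqrt (1 - g ^ 4) * famS g σS x := by
    intro x
    have := ((hasDerivAt_famT' hg σT x).fun_mul ((hasDerivAt_famD (g := g) x).div_const 2)).deriv
    rw [this]
    have e := fam_eqT (σT := σT) hg hS x
    have hDx := (hD x).ne'
    have e2 : famU' g x = -((1 - g ^ 2) * x) / famD g x := rfl
    rw [e2] at e
    field_simp at e ⊢
    linear_combination (-1) * e
  have q1 : ∫ x, ((1 - x ^ 2) * (weakDeriv (famU g) x * weakDeriv ψ x) - x * weakDeriv ψ x) ∂mu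
      = (∫ x, (famS g σS x ^ 2 + famT' g σT x ^ 2) * (famD g x / 2) * ψ x ∂mu)
        + (1 / 2) * (1 - g ^ 4) * ∫ x, 4 / famD g x ^ 2 * (1 - x ^ 2) * ψ x ∂mu := by
    have e1 : ∫ x, ((1 - x ^ 2) * (weakDeriv (famU g) x * weakDeriv ψ x) - x * weakDeriv ψ x) ∂mu
        = ∫ x, ((1 - x ^ 2) * famU' g x - x) * weakDeriv ψ x ∂mu := by
      refine integral_congr_ae ?_
      filter_upwards [weakDeriv_famU hg] with x e
      rw [e]; ring
    have cP : EssBdd (fun x => (famS g σS x ^ 2 + famT' g σT x ^ 2) * (famD g x / 2)) :=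
      essBdd_of_continuousOn (((((contDiff_famS hg σS).continuous.pow 2).add
        ((contDiff_famT' hg σT).continuous.pow 2)).mul
        (contDiff_famD.continuous.div_const 2)).continuousOn)
    have cQ : EssBdd (fun x => 4 / famD g x ^ 2 * (1 - x ^ 2)) :=
      essBdd_of_continuousOn (Continuous.continuousOn (Continuous.mul
        (Continuous.div₀ continuous_const (contDiff_famD.continuous.pow 2)
          fun x => pow_ne_zero _ (hD x).ne') (by fun_prop)))
    rw [e1, h.memU.integral_mul_weakDeriv dG, ← integral_const_mul, ← integral_neg,
      ← integral_add (Integrable.mul_essBdd cP.integrable bψ)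
        ((Integrable.mul_essBdd cQ.integrable bψ).const_mul _)]
    congr 1; ext x
    rw [eG]; ring
  have q2 : ∫ x, (famS g σS x ^ 2 + weakDeriv (famT g σT) x ^ 2) * Real.exp (-2 * famU g x) * ψ x
      ∂mu = ∫ x, (famS g σS x ^ 2 + famT' g σT x ^ 2) * (famD g x / 2) * ψ x ∂mu := by
    refine integral_congr_ae ?_
    filter_upwards [weakDeriv_famT hg σT] with x e
    rw [e, exp_neg_two_famU hg]
  have q4 : ∫ x, Real.exp (4 * famU g x) * (1 - x ^ 2) * ψ x ∂mu
      = ∫ x, 4 / famD g x ^ 2 * (1 - x ^ 2) * ψ x ∂mu := by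
    congr 1; ext x; rw [exp_four_famU hg]
  have iST : Integrable (fun x => ρ x * famT g σT x) mu := Integrable.mul_essBdd iρ cT
  have iSφ : Integrable (fun x => famS g σS x * φ x) mu := Integrable.mul_essBdd cS.integrable bφ
  have q3 : ∫ x, (famS g σS x * ρ x + weakDeriv (famT g σT) x * weakDeriv φ x)
      * Real.exp (-2 * famU g x) ∂mu
      = σS * σT * Real.sqrt (1 - g ^ 4) * ((∫ x, ρ x * famT g σT x ∂mu)
        + ∫ x, famS g σS x * φ x ∂mu) + σS * g ^ 3 * ∫ x, ρ x ∂mu := by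
    have e1 : ∫ x, (famS g σS x * ρ x + weakDeriv (famT g σT) x * weakDeriv φ x)
        * Real.exp (-2 * famU g x) ∂mu
        = ∫ x, ((σS * σT * Real.sqrt (1 - g ^ 4) * (ρ x * famT g σT x) + σS * g ^ 3 * ρ x)
          + famT' g σT x * (famD g x / 2) * weakDeriv φ x) ∂mu := by
      refine integral_congr_ae ?_
      filter_upwards [weakDeriv_famT hg σT] with x e
      rw [e, exp_neg_two_famU hg, famS_eq hg hT]
      have := (hD x).ne'
      field_simp
    have i3 : Integrable (fun x => famT' g σT x * (famD g x / 2) * weakDeriv φ x) mu := by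
      simpa only [mul_comm] using
        Integrable.mul_essBdd iφ' (essBdd_of_continuousOn dH.continuous.continuousOn)
    have i2 : Integrable (fun x => σS * σT * Real.sqrt (1 - g ^ 4) * (ρ x * famT g σT x)
        + σS * g ^ 3 * ρ x) mu := (iST.const_mul _).add (iρ.const_mul _)
    rw [e1, integral_add i2 i3, integral_add (iST.const_mul _) (iρ.const_mul _),
      integral_const_mul, integral_const_mul, h.memT.integral_mul_weakDeriv dH]
    have e2 : ∫ x, deriv (fun x => famT' g σT x * (famD g x / 2)) x * φ x ∂mu
        = -(σS * σT) * Real.sqrt (1 - g ^ 4) * ∫ x, famS g σS x * φ x ∂mu := by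
      rw [← integral_const_mul]
      congr 1; ext x
      rw [eH]; ring
    rw [e2]; ring
  rw [firstVariation, q1, q2, q3, q4, integral_add iST iSφ]
  ring

theorem isLagrangeMultiplier_iff {σS σT : ℝ} (hS : σS ∈ ({1, -1} : Set ℝ))
    (hT : σT ∈ ({1, -1} : Set ℝ)) {S T U : ℝ → ℝ} (h : InFamilyAE (-g ^ 2) σS σT S T U)
    (l₁ l₂ l₃ : ℝ) :
    IsLagrangeMultiplier l₁ l₂ l₃ S T U ↔ l₁ = -(1 - g ^ 4) / 8 ∧
      (g = 0 ∨ l₂ = -(σS * σT) * Real.sqrt (1 - g ^ 4)) ∧ l₃ = -σS * g ^ 3 := by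
  have hX := memX_of_inFamilyAE hg hT h
  obtain ⟨h1, h2, h3⟩ := (inFamilyAE_iff hg hT S T U).1 h
  have key : ∀ ρ φ ψ : ℝ → ℝ, MemX ρ φ ψ → HasDerivAt (fun t : ℝ => lagrangian l₁ l₂ l₃
      (fun x => S x + t * ρ x) (fun x => T x + t * φ x) (fun x => U x + t * ψ x))
      (4 * (l₁ - -(1 - g ^ 4) / 8) * (∫ x, Real.exp (4 * famU g x) * (1 - x ^ 2) * ψ x ∂mu)
        + (l₂ - -(σS * σT) * Real.sqrt (1 - g ^ 4))
          * (∫ x, (ρ x * famT g σT x + famS g σS x * φ x) ∂mu)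
        + (l₃ - -σS * g ^ 3) * ∫ x, ρ x ∂mu) 0 := by
    intro ρ φ ψ hd
    refine (hasDerivAt_lagrangian hX hd l₁ l₂ l₃).congr_deriv ?_
    rw [firstVariation_congr hX.memT.memW12 hX.memU.memW12 h1 h2 h3, ← firstVariation_sub,
      firstVariation_family hg hS hT hd, sub_zero]
  have hzero : MemW012 (fun _ => 0) := memW012_of_contDiff contDiff_const rfl rfl
  have hbump : MemW012 (fun x => 1 - x ^ 2) :=
    memW012_of_contDiff (by fun_prop) (by norm_num) (by norm_num)
  have hL0 : MemL2 (fun _ => (0 : ℝ)) := memL2_of_continuousOn continuousOn_const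
  have hL1 : MemL2 (fun _ => (1 : ℝ)) := memL2_of_continuousOn continuousOn_const
  have pos_integral : ∀ {k : ℝ → ℝ}, Continuous k → (∀ x ∈ Ioo (-1 : ℝ) 1, 0 < k x) →
      0 < ∫ x, k x ∂mu := by
    intro k hk hpos
    rw [← intervalIntegral_eq_mu]
    exact intervalIntegral.intervalIntegral_pos_of_pos_on (hk.intervalIntegrable _ _) hpos
      (by norm_num)
  constructor
  · intro hl
    have e : ∀ ρ φ ψ : ℝ → ℝ, MemX ρ φ ψ → _ := fun ρ φ ψ hd =>
      (key ρ φ ψ hd).unique (hl ρ φ ψ hd)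
    have hbump_pos : ∀ x ∈ Ioo (-1 : ℝ) 1, 0 < 1 - x ^ 2 := fun x hx => by nlinarith [hx.1, hx.2]
    -- Varying `U` alone by `1-x²` isolates `λ₁`, varying `T` alone isolates `λ₂`, and varying `S`
    -- by a constant gives `λ₃`. For `λ₂` the coefficient is an integral of `S(1-x²)`, which is
    -- nonzero since `S` has a strict sign when `g ≠ 0`.
    have e1 := e _ _ _ ⟨hL0, hzero, hbump⟩
    have e2 := e _ _ _ ⟨hL0, hbump, hzero⟩
    have e3 := e _ _ _ ⟨hL1, hzero, hzero⟩
    simp only [mul_zero, zero_mul, add_zero, integral_zero, zero_add, one_mul] at e1 e2 e3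
    have hl1 : l₁ = -(1 - g ^ 4) / 8 := by
      have hp : 0 < ∫ x, Real.exp (4 * famU g x) * (1 - x ^ 2) * (1 - x ^ 2) ∂mu := by
        refine pos_integral ?_ fun x hx => ?_
        · have := (contDiff_famU hg).continuous
          fun_prop
        · have := hbump_pos x hx
          positivity
      rcases mul_eq_zero.1 e1 with h | h
      · linarith
      · exact absurd h hp.ne'
    have hl2 : g = 0 ∨ l₂ = -(σS * σT) * Real.sqrt (1 - g ^ 4) := by
      rcases hg.1.eq_or_lt with h0 | h0
      · exact Or.inl h0.symm
      · right
        have hp : 0 < ∫ x, σS * famS g σS x * (1 - x ^ 2) ∂mu := by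
          refine pos_integral ?_ fun x hx => ?_
          · have := (contDiff_famS hg σS).continuous
            fun_prop
          · have h1 := hbump_pos x hx
            have h2 := famD_pos hg x
            have h3 : 0 < 1 + g ^ 2 - (1 - g ^ 2) * x ^ 2 := by nlinarith [sq_nonneg (g * x)]
            have : σS * famS g σS x
                = σS ^ 2 * (2 * g * (1 + g ^ 2 - (1 - g ^ 2) * x ^ 2) / famD g x ^ 2) := by
              rw [famS]; ring
            rw [this, sq_of_sign hS]
            positivity
        simp only [mul_assoc] at hp
        rw [integral_const_mul] at hp
        rcases mul_eq_zero.1 e2 with h | h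
        · linarith
        · rw [h, mul_zero] at hp
          exact absurd hp (lt_irrefl _)
    refine ⟨hl1, hl2, ?_⟩
    have e4 : (l₂ - -(σS * σT) * Real.sqrt (1 - g ^ 4)) * ∫ x, famT g σT x ∂mu = 0 := by
      rcases hl2 with h | h
      · have : famT g σT = fun _ => 0 := by
          funext x; rw [famT, h]; simp
        rw [this]; simp
      · rw [h]; ring
    rw [e4] at e3
    have hp := pos_integral (continuous_const (y := (1 : ℝ))) fun x _ => one_pos
    rw [zero_add] at e3
    rcases mul_eq_zero.1 e3 with h | h
    · linarith
    · exact absurd h hp.ne'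
  · rintro ⟨hl1, hl2, hl3⟩ ρ φ ψ hd
    refine (key ρ φ ψ hd).congr_deriv ?_
    rw [hl1, hl3]
    rcases hl2 with h | h
    · have e1 : famT g σT = fun _ => 0 := by funext x; rw [famT, h]; simp
      have e2 : famS g σS = fun _ => 0 := by funext x; rw [famS, h]; simp
      rw [e1, e2]; simp
    · rw [h]; ring

end

/-- The Lagrange multipliers at the members of the family. -/
theorem lagrange_multipliers {γ : ℝ} (hγ : γ ∈ Icc (-1 : ℝ) 0) {σS : ℝ}
    (hS : σS ∈ ({1, -1} : Set ℝ)) {σT : ℝ} (hT : σT ∈ ({1, -1} : Set ℝ)) {S T U : ℝ → ℝ}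
    (h : InFamilyAE γ σS σT S T U) (l₁ l₂ l₃ : ℝ) :
    IsLagrangeMultiplier l₁ l₂ l₃ S T U ↔ l₁ = -(1 / 8) * (1 - γ ^ 2) ∧
      (γ = 0 ∨ l₂ = -(σS * σT) * Real.sqrt (1 - γ ^ 2)) ∧ l₃ = -σS * (-γ) ^ (3 / 2 : ℝ) := by
  have h0 : 0 ≤ -γ := by linarith [hγ.2]
  have hsq : Real.sqrt (-γ) ^ 2 = -γ := Real.sq_sqrt h0
  set g := Real.sqrt (-γ)
  have hg : g ∈ Icc (0 : ℝ) 1 := ⟨Real.sqrt_nonneg _, Real.sqrt_le_one.2 (by linarith [hγ.1])⟩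
  have hγg : γ = -g ^ 2 := by rw [hsq, neg_neg]
  have e4 : (-γ) ^ (3 / 2 : ℝ) = g ^ 3 := by
    rw [← hsq, ← Real.rpow_natCast g 2, ← Real.rpow_mul hg.1, ← Real.rpow_natCast g 3]
    norm_num
  rw [hγg] at h
  rw [isLagrangeMultiplier_iff hg hS hT h, e4, hγg]
  have e5 : (-g ^ 2) ^ 2 = g ^ 4 := by ring
  have e6 : -g ^ 2 = 0 ↔ g = 0 := by simp
  rw [e5, e6, show -(1 / 8) * (1 - g ^ 4) = -(1 - g ^ 4) / 8 by ring]

/-! ### Smooth solutions of the Euler-Lagrange equations -/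

theorem eq_left_of_hasDerivAt_zero {f : ℝ → ℝ} {a b : ℝ} (hab : a < b)
    (hf : ContinuousOn f (Icc a b)) (h : ∀ x ∈ Ioo a b, HasDerivAt f 0 x) :
    ∀ x ∈ Icc a b, f x = f a := by
  obtain ⟨c, hc⟩ := exists_const_of_hasDerivAt_zero h
  have := eqOn_Icc_of_eqOn_Ioo hab hf continuousOn_const hc
  intro x hx
  rw [this x hx, this a (left_mem_Icc.2 hab.le)]

theorem hasDerivAt_prim {k : ℝ → ℝ} (hk : ContinuousOn k (Icc (-1) 1)) {x : ℝ}
    (hx : x ∈ Ioo (-1 : ℝ) 1) : HasDerivAt (prim k) (k x) x :=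
  hasDerivAt_prim_of_ae_eq (memL2_of_continuousOn hk).intervalIntegrable
    (hk.mono Ioo_subset_Icc_self) (Eventually.of_forall fun _ _ => rfl) hx

/-- With `λ₂ = -2w`, `λ₃ = -2k₁` and `λ₁ = -w²/2` the equations have first integrals whose constants
are fixed by `T = U = ψ = t = 0` at `x = -1`. Together they amount to `FirstOrderAt`. -/
theorem family_of_eulerLagrange {S T U τ υ υ' : ℝ → ℝ} {w k₁ : ℝ}
    (cS : ContinuousOn S (Icc (-1) 1)) (cT : ContinuousOn T (Icc (-1) 1))
    (cU : ContinuousOn U (Icc (-1) 1)) (cτ : ContinuousOn τ (Icc (-1) 1))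
    (cυ : ContinuousOn υ (Icc (-1) 1)) (T0 : T (-1) = 0) (T1 : T 1 = 0) (U0 : U (-1) = 0)
    (U1 : U 1 = 0) (dT : ∀ x ∈ Ioo (-1 : ℝ) 1, HasDerivAt T (τ x) x)
    (dU : ∀ x ∈ Ioo (-1 : ℝ) 1, HasDerivAt U (υ x) x)
    (dτ : ∀ x ∈ Ioo (-1 : ℝ) 1,
      HasDerivAt τ (2 * υ x * τ x - 2 * w * S x * Real.exp (2 * U x)) x)
    (dυ : ∀ x ∈ Ioo (-1 : ℝ) 1, HasDerivAt υ (υ' x) x)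
    (eqU : ∀ x ∈ Ioo (-1 : ℝ) 1, υ' x * (1 - x ^ 2) = 2 * x * υ x + 1
      - (S x ^ 2 + τ x ^ 2) / Real.exp (2 * U x)
      - 2 * w ^ 2 * (1 - x ^ 2) * Real.exp (2 * U x) ^ 2)
    (eqS : ∀ x ∈ Ioo (-1 : ℝ) 1, S x = 2 * (k₁ + w * T x) * Real.exp (2 * U x)) :
    ∃ g ∈ Icc (0 : ℝ) 1, ∃ σS ∈ ({1, -1} : Set ℝ), ∃ σT ∈ ({1, -1} : Set ℝ),
      ∀ x ∈ Icc (-1 : ℝ) 1, S x = famS g σS x ∧ T x = famT g σT x ∧ U x = famU g x := by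
  have h11 : (-1 : ℝ) < 1 := by norm_num
  obtain ⟨X, hX⟩ : ∃ X : ℝ → ℝ, ∀ x, Real.exp (2 * U x) = X x := ⟨_, fun _ => rfl⟩
  have X0 : ∀ x, 0 < X x := fun x => hX x ▸ Real.exp_pos _
  have cX : ContinuousOn X (Icc (-1) 1) := by
    rw [← funext hX]; fun_prop
  have dX : ∀ x ∈ Ioo (-1 : ℝ) 1, HasDerivAt X (X x * (2 * υ x)) x := by
    intro x hx
    have := ((dU x hx).const_mul 2).exp
    rwa [funext hX, hX x] at this
  simp only [hX] at dτ eqU eqS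
  have cψ : ContinuousOn (prim S) (Icc (-1) 1) := continuousOn_prim (memL2_of_continuousOn cS)
  have dψ : ∀ x ∈ Ioo (-1 : ℝ) 1, HasDerivAt (prim S) (S x) x := fun x hx => hasDerivAt_prim cS hx
  have ψ0 : prim S (-1) = 0 := prim_neg_one S
  set ψ := prim S
  -- the conserved quantity of the variation of `T`
  obtain ⟨k₂, hk₂⟩ : ∃ k₂, ∀ x ∈ Ioo (-1 : ℝ) 1, -(τ x / X x + 2 * w * ψ x) / 2 = k₂ := by
    refine exists_const_of_hasDerivAt_zero fun x hx => ?_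
    refine (((((dτ x hx).fun_div (dX x hx) (X0 x).ne').fun_add
      ((dψ x hx).const_mul (2 * w))).fun_neg).div_const 2).congr_deriv ?_
    have := (X0 x).ne'
    field_simp
    ring
  have hτ : ∀ x ∈ Ioo (-1 : ℝ) 1, τ x = -2 * X x * (k₂ + w * ψ x) := by
    intro x hx
    have h1 := hk₂ x hx
    have := (X0 x).ne'
    field_simp at h1
    linear_combination (-1) * h1
  have d1 : ∀ x : ℝ, HasDerivAt (fun x : ℝ => 1 - x ^ 2) (-(2 * x)) x := fun x => by
    simpa using ((hasDerivAt_id x).fun_pow 2).const_sub 1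
  -- the twist potential
  have ct' : ContinuousOn (fun x => 2 * w * (X x ^ 2 * (1 - x ^ 2)) - 2 * (ψ x * τ x - T x * S x))
      (Icc (-1) 1) := by fun_prop
  obtain ⟨t, ht⟩ : ∃ t : ℝ → ℝ, t = prim (fun x => 2 * w * (X x ^ 2 * (1 - x ^ 2))
      - 2 * (ψ x * τ x - T x * S x)) := ⟨_, rfl⟩
  have t0 : t (-1) = 0 := by rw [ht, prim_neg_one]
  have ct : ContinuousOn t (Icc (-1) 1) := ht ▸ continuousOn_prim (memL2_of_continuousOn ct')
  have dt0 : ∀ x ∈ Ioo (-1 : ℝ) 1, HasDerivAt t (2 * w * (X x ^ 2 * (1 - x ^ 2))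
      - 2 * (ψ x * τ x - T x * S x)) x := fun x hx => ht ▸ hasDerivAt_prim ct' hx
  -- the conserved quantities
  have R : ∀ x ∈ Icc (-1 : ℝ) 1, w * (ψ x ^ 2 + T x ^ 2) + 2 * (ψ x * k₂ + T x * k₁) = 0 := by
    intro x hx
    refine (eq_left_of_hasDerivAt_zero (f := fun x => w * (ψ x ^ 2 + T x ^ 2)
      + 2 * (ψ x * k₂ + T x * k₁)) h11 (by fun_prop) ?_ x hx).trans (by simp [T0, ψ0])
    intro x hx
    refine (((((dψ x hx).fun_pow 2).fun_add ((dT x hx).fun_pow 2)).const_mul w).fun_add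
      ((((dψ x hx).mul_const k₂).fun_add ((dT x hx).mul_const k₁)).const_mul 2)).congr_deriv ?_
    rw [eqS x hx, hτ x hx]
    push_cast
    ring
  -- The value `1` is that of `-x` at `x = -1`. The relation `λ₁ = -λ₂²/8` enters here: the term
  -- with `w²` in `eqU` cancels the one in `wt'`.
  have D : ∀ x ∈ Icc (-1 : ℝ) 1,
      υ x * (1 - x ^ 2) - x + 2 * (ψ x * k₁ - T x * k₂) + t x * w = 1 := by
    intro x hx
    refine (eq_left_of_hasDerivAt_zero (f := fun x => υ x * (1 - x ^ 2) - x
      + 2 * (ψ x * k₁ - T x * k₂) + t x * w) h11 (by fun_prop) ?_ x hx).trans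
      (by simp [T0, ψ0, t0])
    intro x hx
    refine ((((((dυ x hx).fun_mul (d1 x)).fun_sub (hasDerivAt_id x))).fun_add
      ((((dψ x hx).mul_const k₁).fun_sub ((dT x hx).mul_const k₂)).const_mul 2)).fun_add
      ((dt0 x hx).mul_const w)).congr_deriv ?_
    rw [eqU x hx, eqS x hx, hτ x hx]
    have := (X0 x).ne'
    field_simp
    ring
  have dt : ∀ x ∈ Ioo (-1 : ℝ) 1, HasDerivAt t
      (2 * X x * w * (X x * (1 - x ^ 2) + ψ x ^ 2 + T x ^ 2)) x := by
    intro x hx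
    refine (dt0 x hx).congr_deriv ?_
    rw [eqS x hx, hτ x hx]
    linear_combination (2 * X x) * R x (Ioo_subset_Icc_self hx)
  obtain ⟨A, hA⟩ : ∃ A : ℝ → ℝ, ∀ x, X x * (1 - x ^ 2) + ψ x ^ 2 + T x ^ 2 = A x :=
    ⟨_, fun _ => rfl⟩
  have A0 : A (-1) = 0 := by rw [← hA, T0, ψ0]; norm_num
  have cA : ContinuousOn A (Icc (-1) 1) := by rw [← funext hA]; fun_prop
  have dA : ∀ x ∈ Ioo (-1 : ℝ) 1, HasDerivAt A (2 * X x * (1 - t x * w)) x := by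
    intro x hx
    rw [← funext hA]
    refine ((((dX x hx).fun_mul (d1 x)).fun_add ((dψ x hx).fun_pow 2)).fun_add
      ((dT x hx).fun_pow 2)).congr_deriv ?_
    rw [eqS x hx, hτ x hx]
    push_cast
    linear_combination (2 * X x) * D x (Ioo_subset_Icc_self hx)
  simp only [hA] at dt
  have W : ∀ x ∈ Icc (-1 : ℝ) 1, w * (A x ^ 2 + t x ^ 2) - 2 * t x = 0 := by
    intro x hx
    refine (eq_left_of_hasDerivAt_zero (f := fun x => w * (A x ^ 2 + t x ^ 2) - 2 * t x) h11
      (by fun_prop) ?_ x hx).trans (by simp [A0, t0])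
    intro x hx
    refine (((((dA x hx).fun_pow 2).fun_add ((dt x hx).fun_pow 2)).const_mul w).fun_sub
      ((dt x hx).const_mul 2)).congr_deriv ?_
    push_cast
    ring
  -- `Y` and `Z` are the two parts of `(k₁ + wT - i(k₂ + wψ))(A + it) = ψ + iT`. Since `ψ' + iT'` is
  -- `2X` times the first factor, they turn into `ζ' = 2Xζ/E`.
  have Y : ∀ x ∈ Icc (-1 : ℝ) 1, (k₁ + w * T x) * A x + (k₂ + w * ψ x) * t x - ψ x = 0 := by
    intro x hx
    refine (eq_left_of_hasDerivAt_zero (f := fun x => (k₁ + w * T x) * A x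
      + (k₂ + w * ψ x) * t x - ψ x) h11 (by fun_prop) ?_ x hx).trans (by simp [A0, t0, ψ0])
    intro x hx
    refine ((((((dT x hx).const_mul w).const_add k₁).fun_mul (dA x hx)).fun_add
      ((((dψ x hx).const_mul w).const_add k₂).fun_mul (dt x hx))).fun_sub (dψ x hx)).congr_deriv ?_
    rw [eqS x hx, hτ x hx]
    ring
  have Z : ∀ x ∈ Icc (-1 : ℝ) 1, (k₂ + w * ψ x) * A x - (k₁ + w * T x) * t x + T x = 0 := by
    intro x hx
    refine (eq_left_of_hasDerivAt_zero (f := fun x => (k₂ + w * ψ x) * A x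
      - (k₁ + w * T x) * t x + T x) h11 (by fun_prop) ?_ x hx).trans (by simp [A0, t0, T0])
    intro x hx
    refine ((((((dψ x hx).const_mul w).const_add k₂).fun_mul (dA x hx)).fun_sub
      ((((dT x hx).const_mul w).const_add k₁).fun_mul (dt x hx))).fun_add (dT x hx)).congr_deriv ?_
    rw [eqS x hx, hτ x hx]
    ring
  have H : ∀ x ∈ Ioo (-1 : ℝ) 1, FirstOrderAt w S T U ψ t x (A x) (A x ^ 2 + t x ^ 2) := by
    intro x hx
    have hx' := Ioo_subset_Icc_self hx
    have h1 : 0 < 1 - x ^ 2 := by nlinarith [hx.1, hx.2]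
    have hApos : 0 < A x := by
      rw [← hA]
      have := X0 x
      positivity
    have hN : A x ^ 2 + t x ^ 2 ≠ 0 := by positivity
    have hY := Y x hx'
    have hZ := Z x hx'
    have eS : S x = 2 * X x * (ψ x * A x + t x * T x) / (A x ^ 2 + t x ^ 2) := by
      rw [eq_div_iff hN, eqS x hx]
      linear_combination (2 * X x * A x) * hY - (2 * X x * t x) * hZ
    have eτ : τ x = 2 * X x * (T x * A x - t x * ψ x) / (A x ^ 2 + t x ^ 2) := by
      rw [eq_div_iff hN, hτ x hx]
      linear_combination (-(2 * X x * A x)) * hZ - (2 * X x * t x) * hY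
    refine ⟨by rw [hX, hA], rfl, ?_, by rw [hX]; exact eS, ?_, ?_, ?_, ?_⟩
    · rw [eq_div_iff hN]; linear_combination W x hx'
    · refine (dU x hx).congr_deriv ?_
      -- The first order equation for `U` is `D` multiplied by `N`, with `k₁`, `k₂` and `w`
      -- eliminated by `W`, `Y` and `Z`.
      have key : (υ x * (1 - x ^ 2) - x + 1) * (A x ^ 2 + t x ^ 2)
          = 2 * (X x * (1 - x ^ 2)) * A x := by
        linear_combination (A x ^ 2 + t x ^ 2) * D x hx' - t x * W x hx'
          - 2 * ψ x * (A x * hY - t x * hZ) + 2 * T x * (A x * hZ + t x * hY) - 2 * A x * hA x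
      rw [eq_div_iff h1.ne', hX, ← key]
      field_simp
      ring
    · refine (dψ x hx).congr_deriv ?_
      rw [hX]; exact eS
    · refine (dT x hx).congr_deriv ?_
      rw [hX]; exact eτ
    · refine (dt0 x hx).congr_deriv ?_
      rw [hX, ← eS, ← eτ]
  obtain ⟨g, hg, σS, hσS, σT, hσT, hfam⟩ := firstOrder_solution H cU cT U0 U1 T1
  refine ⟨g, hg, σS, hσS, σT, hσT, fun x hx => ⟨?_, ?_, ?_⟩⟩
  · exact eqOn_Icc_of_eqOn_Ioo h11 cS (contDiff_famS hg σS).continuous.continuousOn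
      (fun x hx => (hfam x hx).1) x hx
  · exact eqOn_Icc_of_eqOn_Ioo h11 cT (contDiff_famT hg σT).continuous.continuousOn
      (fun x hx => (hfam x hx).2.1) x hx
  · exact eqOn_Icc_of_eqOn_Ioo h11 cU (contDiff_famU hg).continuous.continuousOn
      (fun x hx => (hfam x hx).2.2) x hx

theorem exp_neg_two_eq (u : ℝ) : Real.exp (-2 * u) = (Real.exp (2 * u))⁻¹ := by
  rw [← Real.exp_neg]; ring_nf

/-- The derivative within the closed interval is continuous up to the end points, where `deriv`
would depend on values outside. -/
theorem exists_deriv_of_contDiffOn_Icc {f : ℝ → ℝ} (hf : ContDiffOn ℝ ∞ f (Icc (-1) 1)) :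
    ∃ f' : ℝ → ℝ, ContinuousOn f' (Icc (-1) 1) ∧ ∀ x ∈ Ioo (-1 : ℝ) 1, HasDerivAt f (f' x) x ∧
      HasDerivAt f' (deriv (deriv f) x) x := by
  have hu : UniqueDiffOn ℝ (Icc (-1 : ℝ) 1) := uniqueDiffOn_Icc (by norm_num)
  have hfo : ContDiffOn ℝ ∞ f (Ioo (-1) 1) := hf.mono Ioo_subset_Icc_self
  refine ⟨derivWithin f (Icc (-1) 1), hf.continuousOn_derivWithin hu (by simp), fun x hx => ?_⟩
  have hmem : Icc (-1 : ℝ) 1 ∈ 𝓝 x := Icc_mem_nhds hx.1 hx.2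
  have hd : DifferentiableAt ℝ f x :=
    (hf.contDiffAt hmem).differentiableAt (by simp)
  have hd2 : DifferentiableAt ℝ (deriv f) x :=
    ((hfo.deriv_of_isOpen (m := ∞) isOpen_Ioo le_rfl).contDiffAt
      (isOpen_Ioo.mem_nhds hx)).differentiableAt (by simp)
  refine ⟨by rw [derivWithin_of_mem_nhds hmem]; exact hd.hasDerivAt,
    hd2.hasDerivAt.congr_of_eventuallyEq ?_⟩
  filter_upwards [isOpen_Ioo.mem_nhds hx] with y hy
  exact derivWithin_of_mem_nhds (Icc_mem_nhds hy.1 hy.2)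

theorem IsSmoothELSolution.family {S T U : ℝ → ℝ} {l₁ l₂ l₃ : ℝ} (hl : l₁ = -(1 / 8) * l₂ ^ 2)
    (h : IsSmoothELSolution l₁ l₂ l₃ S T U) :
    ∃ g ∈ Icc (0 : ℝ) 1, ∃ σS ∈ ({1, -1} : Set ℝ), ∃ σT ∈ ({1, -1} : Set ℝ),
      ∀ x ∈ Icc (-1 : ℝ) 1, S x = famS g σS x ∧ T x = famT g σT x ∧ U x = famU g x := by
  obtain ⟨τ, cτ, hτ⟩ := exists_deriv_of_contDiffOn_Icc h.smoothT
  obtain ⟨υ, cυ, hυ⟩ := exists_deriv_of_contDiffOn_Icc h.smoothU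
  refine family_of_eulerLagrange (τ := τ) (υ := υ) (υ' := deriv (deriv U)) (w := -l₂ / 2)
    (k₁ := -l₃ / 2) h.smoothS.continuousOn h.smoothT.continuousOn h.smoothU.continuousOn cτ cυ
    h.T_neg h.T_pos h.U_neg h.U_pos (fun x hx => (hτ x hx).1) (fun x hx => (hυ x hx).1) ?_
    (fun x hx => (hυ x hx).2) ?_ ?_
  · intro x hx
    refine (hτ x hx).2.congr_deriv ?_
    have := h.eqT x hx
    rw [(hτ x hx).1.deriv, (hυ x hx).1.deriv] at this
    linear_combination this
  · intro x hx
    have := h.eqU x hx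
    rw [(hτ x hx).1.deriv, (hυ x hx).1.deriv, exp_four_eq, exp_neg_two_eq, hl] at this
    rw [div_eq_mul_inv]
    linear_combination this
  · intro x hx
    linear_combination -h.eqS x hx

theorem isSmoothELSolution_family {g : ℝ} (hg : g ∈ Icc (0 : ℝ) 1) {σS σT : ℝ}
    (hS : σS ∈ ({1, -1} : Set ℝ)) (hT : σT ∈ ({1, -1} : Set ℝ)) {S T U : ℝ → ℝ}
    (h : ∀ x ∈ Icc (-1 : ℝ) 1, S x = famS g σS x ∧ T x = famT g σT x ∧ U x = famU g x) :
    IsSmoothELSolution (-(1 / 8) * (1 - g ^ 4)) (-(σS * σT) * Real.sqrt (1 - g ^ 4))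
      (-σS * g ^ 3) S T U := by
  have l1 : (-1 : ℝ) ∈ Icc (-1 : ℝ) 1 := by norm_num
  have l2 : (1 : ℝ) ∈ Icc (-1 : ℝ) 1 := by norm_num
  have nh : ∀ {x : ℝ}, x ∈ Ioo (-1 : ℝ) 1 → ∀ᶠ y in 𝓝 x, y ∈ Ioo (-1 : ℝ) 1 :=
    fun hx => isOpen_Ioo.mem_nhds hx
  have dU : ∀ x ∈ Ioo (-1 : ℝ) 1, HasDerivAt U (famU' g x) x := fun x hx =>
    (hasDerivAt_famU hg x).congr_of_eventuallyEq
      ((nh hx).mono fun y hy => (h y (Ioo_subset_Icc_self hy)).2.2)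
  have dT : ∀ x ∈ Ioo (-1 : ℝ) 1, HasDerivAt T (famT' g σT x) x := fun x hx =>
    (hasDerivAt_famT hg σT x).congr_of_eventuallyEq
      ((nh hx).mono fun y hy => (h y (Ioo_subset_Icc_self hy)).2.1)
  have ddU := fun x (hx : x ∈ Ioo (-1 : ℝ) 1) => (hasDerivAt_famU' hg x).congr_of_eventuallyEq
      ((nh hx).mono fun y hy => (dU y hy).deriv)
  have ddT := fun x (hx : x ∈ Ioo (-1 : ℝ) 1) => (hasDerivAt_famT' hg σT x).congr_of_eventuallyEq
      ((nh hx).mono fun y hy => (dT y hy).deriv)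
  refine ⟨(contDiff_famS hg σS).contDiffOn.congr fun x hx => (h x hx).1,
    (contDiff_famT hg σT).contDiffOn.congr fun x hx => (h x hx).2.1,
    (contDiff_famU hg).contDiffOn.congr fun x hx => (h x hx).2.2,
    by rw [(h _ l1).2.1, famT_neg_one], by rw [(h _ l2).2.1, famT_one],
    by rw [(h _ l1).2.2, famU_neg_one], by rw [(h _ l2).2.2, famU_one], ?_, ?_, ?_⟩
  · intro x hx
    obtain ⟨e1, e2, e3⟩ := h x (Ioo_subset_Icc_self hx)
    rw [(ddU x hx).deriv, (dU x hx).deriv, (dT x hx).deriv, e1, e3, exp_neg_two_famU hg,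
      exp_four_famU hg]
    linear_combination (-1) * fam_eqU hg hS hT x
  · intro x hx
    obtain ⟨e1, e2, e3⟩ := h x (Ioo_subset_Icc_self hx)
    rw [(ddT x hx).deriv, (dU x hx).deriv, (dT x hx).deriv, e1, e3, exp_two_famU hg]
    linear_combination (-1) * fam_eqT (σT := σT) hg hS x
  · intro x hx
    obtain ⟨e1, e2, e3⟩ := h x (Ioo_subset_Icc_self hx)
    rw [e1, e2, e3, exp_two_famU hg, famS_eq hg hT]
    ring

theorem exists_inFamilyOn_iff (S T U : ℝ → ℝ) :
    (∃ γ ∈ Icc (-1 : ℝ) 0, ∃ σS ∈ ({1, -1} : Set ℝ), ∃ σT ∈ ({1, -1} : Set ℝ),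
      InFamilyOn γ σS σT S T U) ↔
    ∃ g ∈ Icc (0 : ℝ) 1, ∃ σS ∈ ({1, -1} : Set ℝ), ∃ σT ∈ ({1, -1} : Set ℝ),
      ∀ x ∈ Icc (-1 : ℝ) 1, S x = famS g σS x ∧ T x = famT g σT x ∧ U x = famU g x := by
  rw [exists_family_iff (P := fun γ σS σT => InFamilyOn γ σS σT S T U)]
  constructor
  · rintro ⟨g, hg, σS, hS, σT, hT, h⟩
    exact ⟨g, hg, σS, hS, σT, hT, (inFamilyOn_iff hg hT S T U).1 h⟩
  · rintro ⟨g, hg, σS, hS, σT, hT, h⟩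
    exact ⟨g, hg, σS, hS, σT, hT, (inFamilyOn_iff hg hT S T U).2 h⟩

/-- The smooth solutions of the Euler-Lagrange equations are the members of the family. -/
theorem exists_isSmoothELSolution_iff (S T U : ℝ → ℝ) :
    (∃ l₁ l₂ l₃ : ℝ, l₁ = -(1 / 8) * l₂ ^ 2 ∧ IsSmoothELSolution l₁ l₂ l₃ S T U) ↔
      ∃ γ ∈ Icc (-1 : ℝ) 0, ∃ σS ∈ ({1, -1} : Set ℝ), ∃ σT ∈ ({1, -1} : Set ℝ),
        InFamilyOn γ σS σT S T U := by
  rw [exists_inFamilyOn_iff]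
  constructor
  · rintro ⟨l₁, l₂, l₃, hl, h⟩
    exact h.family hl
  · rintro ⟨g, hg, σS, hS, σT, hT, h⟩
    refine ⟨_, _, _, ?_, isSmoothELSolution_family hg hS hT h⟩
    rw [mul_pow, sq_sqrt_one_sub_pow_four hg, neg_sq, mul_pow, sq_of_sign hS, sq_of_sign hT]
    ring

/-! ### Calculus in the vicinity of the horizon -/

/-- The vicinity of the horizon, up to the horizon and the rotation axis. -/
def strip (R₀ : ℝ) : Set (ℝ × ℝ) := Ico 0 R₀ ×ˢ Icc (-1) 1

/-- The function `f` of `(R, x)` is smooth on `strip R₀`. -/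
def StripSmooth (R₀ : ℝ) (f : ℝ → ℝ → ℝ) : Prop :=
  ContDiffOn ℝ ∞ (fun p : ℝ × ℝ => f p.1 p.2) (strip R₀)

/-- The derivative on `strip R₀` in the direction `v`. -/
noncomputable def stripDeriv (R₀ : ℝ) (v : ℝ × ℝ) (f : ℝ → ℝ → ℝ) : ℝ → ℝ → ℝ := fun R x =>
  fderivWithin ℝ (fun p : ℝ × ℝ => f p.1 p.2) (strip R₀) (R, x) v

/-- `∂/∂R` on `strip R₀`. -/
noncomputable abbrev pR (R₀ : ℝ) : (ℝ → ℝ → ℝ) → ℝ → ℝ → ℝ := stripDeriv R₀ (1, 0)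

/-- `∂/∂x` on `strip R₀`. -/
noncomputable abbrev pX (R₀ : ℝ) : (ℝ → ℝ → ℝ) → ℝ → ℝ → ℝ := stripDeriv R₀ (0, 1)

theorem uniqueDiffOn_strip (R₀ : ℝ) : UniqueDiffOn ℝ (strip R₀) :=
  (uniqueDiffOn_Ico 0 R₀).prod (uniqueDiffOn_Icc (by norm_num))

/-- Symmetry of second derivatives within a set, also at boundary points, requires this density of
the interior. -/
theorem strip_subset_closure_interior (R₀ : ℝ) :
    strip R₀ ⊆ closure (interior (strip R₀)) := by
  rintro ⟨R, x⟩ ⟨h1, h2⟩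
  rw [strip, interior_prod_eq, closure_prod_eq, interior_Ico, interior_Icc,
    closure_Ioo (h1.1.trans_lt h1.2).ne,
    closure_Ioo (show (-1 : ℝ) ≠ 1 by norm_num)]
  exact ⟨Ico_subset_Icc_self h1, h2⟩

section

variable {R₀ : ℝ} {f : ℝ → ℝ → ℝ}

namespace StripSmooth

theorem stripDeriv (hf : StripSmooth R₀ f) (v : ℝ × ℝ) : StripSmooth R₀ (stripDeriv R₀ v f) :=
  (hf.fderivWithin (uniqueDiffOn_strip R₀) (m := ∞) le_rfl).clm_apply contDiffOn_const

theorem hasFDerivWithinAt (hf : StripSmooth R₀ f) {p : ℝ × ℝ} (hp : p ∈ strip R₀) :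
    HasFDerivWithinAt (fun p : ℝ × ℝ => f p.1 p.2)
      (fderivWithin ℝ (fun p : ℝ × ℝ => f p.1 p.2) (strip R₀) p) (strip R₀) p :=
  ((hf.differentiableOn (by simp)) p hp).hasFDerivWithinAt

theorem hasDerivWithinAt_pR (hf : StripSmooth R₀ f) {R x : ℝ} (hR : R ∈ Ico 0 R₀)
    (hx : x ∈ Icc (-1 : ℝ) 1) :
    HasDerivWithinAt (fun r => f r x) (pR R₀ f R x) (Ico 0 R₀) R :=
  (hf.hasFDerivWithinAt (p := (R, x)) ⟨hR, hx⟩).comp_hasDerivWithinAt (f := fun r => (r, x)) R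
    ((hasDerivWithinAt_id R _).prodMk (hasDerivWithinAt_const R _ x)) fun _ hr => ⟨hr, hx⟩

theorem hasDerivWithinAt_pX (hf : StripSmooth R₀ f) {R x : ℝ} (hR : R ∈ Ico 0 R₀)
    (hx : x ∈ Icc (-1 : ℝ) 1) :
    HasDerivWithinAt (fun y => f R y) (pX R₀ f R x) (Icc (-1) 1) x :=
  (hf.hasFDerivWithinAt (p := (R, x)) ⟨hR, hx⟩).comp_hasDerivWithinAt (f := fun y => (R, y)) x
    ((hasDerivWithinAt_const x _ R).prodMk (hasDerivWithinAt_id x _)) fun _ hy => ⟨hR, hy⟩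

theorem hasDerivAt_pR (hf : StripSmooth R₀ f) {R x : ℝ} (hR : R ∈ Ioo 0 R₀)
    (hx : x ∈ Icc (-1 : ℝ) 1) : HasDerivAt (fun r => f r x) (pR R₀ f R x) R :=
  (hf.hasDerivWithinAt_pR (Ioo_subset_Ico_self hR) hx).hasDerivAt (Ico_mem_nhds hR.1 hR.2)

theorem hasDerivAt_pX (hf : StripSmooth R₀ f) {R x : ℝ} (hR : R ∈ Ico 0 R₀)
    (hx : x ∈ Ioo (-1 : ℝ) 1) : HasDerivAt (fun y => f R y) (pX R₀ f R x) x :=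
  (hf.hasDerivWithinAt_pX hR (Ioo_subset_Icc_self hx)).hasDerivAt (Icc_mem_nhds hx.1 hx.2)

/-- The partial derivatives commute, also on the boundary. -/
theorem pR_pX (hf : StripSmooth R₀ f) {R x : ℝ} (hR : R ∈ Ico 0 R₀) (hx : x ∈ Icc (-1 : ℝ) 1) :
    pR R₀ (pX R₀ f) R x = pX R₀ (pR R₀ f) R x := by
  have hp : (R, x) ∈ strip R₀ := ⟨hR, hx⟩
  have hs := ContDiffWithinAt.isSymmSndFDerivWithinAt (hf (R, x) hp)
    (by rw [minSmoothness_of_isRCLikeNormedField]; exact WithTop.coe_le_coe.2 le_top)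
    (uniqueDiffOn_strip R₀) (strip_subset_closure_interior R₀ hp) hp
  have key : ∀ v w : ℝ × ℝ, DegenerateHorizon.stripDeriv R₀ v
      (DegenerateHorizon.stripDeriv R₀ w f) R x
      = fderivWithin ℝ (fderivWithin ℝ (fun p : ℝ × ℝ => f p.1 p.2) (strip R₀)) (strip R₀)
        (R, x) v w := by
    intro v w
    have hd : DifferentiableWithinAt ℝ (fderivWithin ℝ (fun p : ℝ × ℝ => f p.1 p.2) (strip R₀))
        (strip R₀) (R, x) :=
      ((hf.fderivWithin (uniqueDiffOn_strip R₀) (m := ∞) le_rfl).differentiableOn (by simp))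
        (R, x) hp
    have := (hd.hasFDerivWithinAt.clm_apply (hasFDerivWithinAt_const w (R, x) _)).fderivWithin
      (uniqueDiffOn_strip R₀ _ hp)
    have h2 := congrArg (fun L : ℝ × ℝ →L[ℝ] ℝ => L v) this
    refine Eq.trans h2 ?_
    simp
  exact (key _ _).trans ((hs _ _).trans (key _ _).symm)

theorem tendsto_horizon (hf : StripSmooth R₀ f) (h0 : 0 < R₀) {x : ℝ} (hx : x ∈ Icc (-1 : ℝ) 1) :
    Tendsto (fun R => f R x) (𝓝[>] 0) (𝓝 (f 0 x)) := by
  have h := (hf.hasDerivWithinAt_pR (R := 0) ⟨le_rfl, h0⟩ hx).continuousWithinAt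
  refine h.mono_left ?_
  rw [← nhdsWithin_Ioo_eq_nhdsGT h0]
  exact nhdsWithin_mono _ Ioo_subset_Ico_self

/-- The quotient is the difference quotient at `R = 0`. This gives a meaning on the horizon to the
terms of the field equations that are divided by `R`. -/
theorem tendsto_div_horizon (hf : StripSmooth R₀ f) (h0 : 0 < R₀) {x : ℝ}
    (hx : x ∈ Icc (-1 : ℝ) 1) (hz : f 0 x = 0) :
    Tendsto (fun R => f R x / R) (𝓝[>] 0) (𝓝 (pR R₀ f 0 x)) := by
  have h := hasDerivWithinAt_iff_tendsto_slope.1 (hf.hasDerivWithinAt_pR (R := 0) ⟨le_rfl, h0⟩ hx)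
  have e : Ico 0 R₀ \ {0} = Ioo 0 R₀ := by
    ext r; simp only [Set.mem_sdiff, mem_Ico, mem_singleton_iff, mem_Ioo]
    exact ⟨fun h => ⟨lt_of_le_of_ne h.1.1 (Ne.symm h.2), h.1.2⟩,
      fun h => ⟨⟨h.1.le, h.2⟩, h.1.ne'⟩⟩
  rw [e, nhdsWithin_Ioo_eq_nhdsGT h0] at h
  refine h.congr fun r => ?_
  rw [slope_def_field, hz, sub_zero, sub_zero]

theorem pX_horizon_eq_zero (hf : StripSmooth R₀ f) (h0 : 0 < R₀) {c : ℝ}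
    (hc : ∀ x ∈ Icc (-1 : ℝ) 1, f 0 x = c) {x : ℝ} (hx : x ∈ Icc (-1 : ℝ) 1) :
    pX R₀ f 0 x = 0 := by
  have h1 := hf.hasDerivWithinAt_pX (R := 0) ⟨le_rfl, h0⟩ hx
  have h2 : HasDerivWithinAt (fun y => f 0 y) 0 (Icc (-1) 1) x :=
    (hasDerivWithinAt_const x _ c).congr hc (hc x hx)
  exact (uniqueDiffOn_Icc (by norm_num) x hx).eq_deriv _ h1 h2

theorem contDiffOn_horizon (hf : StripSmooth R₀ f) (h0 : 0 < R₀) :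
    ContDiffOn ℝ ∞ (f 0) (Icc (-1) 1) :=
  ContDiffOn.comp (t := strip R₀) hf (f := fun x : ℝ => ((0 : ℝ), x)) (by fun_prop)
    fun _ hx => ⟨⟨le_rfl, h0⟩, hx⟩

theorem horizonDeriv_eq (hf : StripSmooth R₀ f) (h0 : 0 < R₀) {x : ℝ}
    (hx : x ∈ Icc (-1 : ℝ) 1) : HorizonFields.horizonDeriv f x = pR R₀ f 0 x := by
  have h := hf.hasDerivWithinAt_pR (R := 0) ⟨le_rfl, h0⟩ hx
  have h2 : HasDerivWithinAt (fun r => f r x) (pR R₀ f 0 x) (Ici 0) 0 :=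
    h.mono_of_mem_nhdsWithin (Ico_mem_nhdsGE h0)
  exact h2.derivWithin (uniqueDiffOn_Ici 0 0 self_mem_Ici)

/-- Restricted to `R > 0`: at `R = 0` the two-sided derivative would see the arbitrary values at
negative `R`. -/
theorem dR_polar (hf : StripSmooth R₀ f) {R θ : ℝ} (hR : R ∈ Ioo 0 R₀) :
    dR (polar f) R θ = pR R₀ f R (Real.cos θ) :=
  (hf.hasDerivAt_pR hR (Real.cos_mem_Icc θ)).deriv

theorem dR_dR_polar (hf : StripSmooth R₀ f) {R θ : ℝ} (hR : R ∈ Ioo 0 R₀) :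
    dR (dR (polar f)) R θ = pR R₀ (pR R₀ f) R (Real.cos θ) := by
  rw [← (hf.stripDeriv _).dR_polar hR]
  refine Filter.EventuallyEq.deriv_eq ?_
  filter_upwards [isOpen_Ioo.mem_nhds hR] with r hr
  exact hf.dR_polar hr

theorem cos_mem_Ioo {θ : ℝ} (hθ : θ ∈ Ioo 0 Real.pi) : Real.cos θ ∈ Ioo (-1 : ℝ) 1 := by
  have h := Real.sin_pos_of_pos_of_lt_pi hθ.1 hθ.2
  have := Real.sin_sq_add_cos_sq θ
  constructor <;> nlinarith [sq_nonneg (Real.cos θ)]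

theorem hasDerivAt_polar (hf : StripSmooth R₀ f) {R θ : ℝ} (hR : R ∈ Ico 0 R₀)
    (hθ : θ ∈ Ioo 0 Real.pi) :
    HasDerivAt (fun t => polar f R t) (-Real.sin θ * pX R₀ f R (Real.cos θ)) θ :=
  ((hf.hasDerivAt_pX hR (cos_mem_Ioo hθ)).comp θ (Real.hasDerivAt_cos θ)).congr_deriv
    (mul_comm _ _)

theorem dTheta_polar (hf : StripSmooth R₀ f) {R θ : ℝ} (hR : R ∈ Ico 0 R₀)
    (hθ : θ ∈ Ioo 0 Real.pi) :
    dTheta (polar f) R θ = -Real.sin θ * pX R₀ f R (Real.cos θ) :=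
  (hf.hasDerivAt_polar hR hθ).deriv

theorem dTheta_dTheta_polar (hf : StripSmooth R₀ f) {R θ : ℝ} (hR : R ∈ Ico 0 R₀)
    (hθ : θ ∈ Ioo 0 Real.pi) :
    dTheta (dTheta (polar f)) R θ = Real.sin θ ^ 2 * pX R₀ (pX R₀ f) R (Real.cos θ)
      - Real.cos θ * pX R₀ f R (Real.cos θ) := by
  have h := (Real.hasDerivAt_sin θ).fun_neg.fun_mul ((hf.stripDeriv (0, 1)).hasDerivAt_polar hR hθ)
  have e : (fun t => dTheta (polar f) R t) =ᶠ[𝓝 θ]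
      fun t => -Real.sin t * polar (pX R₀ f) R t := by
    filter_upwards [isOpen_Ioo.mem_nhds hθ] with t ht
    exact hf.dTheta_polar hR ht
  refine e.deriv_eq.trans (h.deriv.trans ?_)
  simp only [polar]
  ring

end StripSmooth

end

/-- The direction `∂/∂x` is tangent to the horizon, so only horizon values matter, although `pX` is
defined by a derivative in two variables. -/
theorem StripSmooth.pX_horizon_congr {R₀ : ℝ} {f k : ℝ → ℝ → ℝ} (hf : StripSmooth R₀ f)
    (hk : StripSmooth R₀ k) (h0 : 0 < R₀) (h : ∀ x ∈ Icc (-1 : ℝ) 1, f 0 x = k 0 x) {x : ℝ}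
    (hx : x ∈ Icc (-1 : ℝ) 1) : pX R₀ f 0 x = pX R₀ k 0 x := by
  have h1 := hf.hasDerivWithinAt_pX (R := 0) ⟨le_rfl, h0⟩ hx
  have h2 := (hk.hasDerivWithinAt_pX (R := 0) ⟨le_rfl, h0⟩ hx).congr h (h x hx)
  exact (uniqueDiffOn_Icc (by norm_num) x hx).eq_deriv _ h1 h2

theorem exists_cos_eq {x : ℝ} (hx : x ∈ Ioo (-1 : ℝ) 1) :
    ∃ θ ∈ Ioo 0 Real.pi, Real.cos θ = x ∧ 0 < Real.sin θ ∧ Real.sin θ ^ 2 = 1 - x ^ 2 := by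
  have hc := Real.cos_arccos hx.1.le hx.2.le
  have hm : Real.arccos x ∈ Ioo 0 Real.pi :=
    ⟨Real.arccos_pos.2 hx.2, lt_of_le_of_ne (Real.arccos_le_pi x) fun e => by
      rw [e, Real.cos_pi] at hc
      linarith [hx.1]⟩
  refine ⟨_, hm, hc, Real.sin_pos_of_pos_of_lt_pi hm.1 hm.2, ?_⟩
  rw [Real.sin_sq, hc]

/-! ### The field equations in the coordinates `(R, x)`. -/

namespace HorizonFields

/-- `ũ` as a function of `(R, x)`. -/
noncomputable def logU (F : HorizonFields) : ℝ → ℝ → ℝ :=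
  fun R x => (1 / 2) * Real.log (F.uHat R x / F.uN)

theorem uTilde_eq (F : HorizonFields) : F.uTilde = polar F.logU := rfl

namespace IsDegenerateBlackHole

variable {F : HorizonFields} (h : F.IsDegenerateBlackHole)

include h

theorem uN_pos : 0 < F.uN := h.uHat_pos 0 ⟨le_rfl, h.R₀_pos⟩ 1 (by norm_num)

theorem stripSmooth_omega : StripSmooth F.R₀ F.omega := h.smooth_omega

theorem stripSmooth_Phi : StripSmooth F.R₀ F.Phi := h.smooth_Phi

theorem stripSmooth_A : StripSmooth F.R₀ F.A := h.smooth_A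

theorem stripSmooth_uHat : StripSmooth F.R₀ F.uHat := h.smooth_uHat

theorem stripSmooth_logU : StripSmooth F.R₀ F.logU := by
  have h1 : ContDiffOn ℝ ∞ (fun p : ℝ × ℝ => F.uHat p.1 p.2) (strip F.R₀) := h.stripSmooth_uHat
  exact contDiffOn_const.mul ((h1.div_const _).log fun p hp =>
    (div_pos (h.uHat_pos _ hp.1 _ hp.2) h.uN_pos).ne')

section FieldEquations

variable {R x : ℝ} (hR : R ∈ Ioo 0 F.R₀) (hx : x ∈ Ioo (-1 : ℝ) 1)

include hR hx

/-- In this and the next three equations negative powers of `R` are absorbed in quotients such as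
`ω_{,x}/R` and `Φ_{,x}/R`, which have limits on the horizon because `ω` and `Φ` are constant there.
The equations for `ω` and `Φ` are divided by `R` as a whole. -/
theorem field_eq_u :
    R ^ 2 * pR F.R₀ (pR F.R₀ F.logU) R x + 2 * R * pR F.R₀ F.logU R x
      + (1 - x ^ 2) * pX F.R₀ (pX F.R₀ F.logU) R x - 2 * x * pX F.R₀ F.logU R x
    = 1 - F.uHat R x ^ 2 / 8 * (1 - x ^ 2)
        * (pR F.R₀ F.omega R x ^ 2 + (1 - x ^ 2) * (pX F.R₀ F.omega R x / R) ^ 2)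
      - 1 / (F.uHat R x * (1 - x ^ 2))
        * (R ^ 2 * pR F.R₀ F.A R x ^ 2 + (1 - x ^ 2) * pX F.R₀ F.A R x ^ 2)
      - F.uHat R x / 4 * ((pR F.R₀ F.Phi R x - F.A R x * pR F.R₀ F.omega R x) ^ 2
        + (1 - x ^ 2) * (pX F.R₀ F.Phi R x / R - F.A R x * (pX F.R₀ F.omega R x / R)) ^ 2) := by
  obtain ⟨θ, hθ, hc, hs, hs2⟩ := exists_cos_eq hx
  have hR' := Ioo_subset_Ico_self hR
  have e := (h.field_eqs R hR θ hθ).eq1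
  rw [uTilde_eq, h.stripSmooth_logU.dR_dR_polar hR, h.stripSmooth_logU.dR_polar hR,
    h.stripSmooth_logU.dTheta_dTheta_polar hR' hθ, h.stripSmooth_logU.dTheta_polar hR' hθ,
    h.stripSmooth_omega.dR_polar hR, h.stripSmooth_omega.dTheta_polar hR' hθ,
    h.stripSmooth_A.dR_polar hR, h.stripSmooth_A.dTheta_polar hR' hθ, eR, eTheta,
    h.stripSmooth_omega.dR_polar hR, h.stripSmooth_omega.dTheta_polar hR' hθ,
    h.stripSmooth_Phi.dR_polar hR, h.stripSmooth_Phi.dTheta_polar hR' hθ,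
    Real.cot_eq_cos_div_sin, hs2] at e
  simp only [polar, hc] at e
  have hcot : x / Real.sin θ * (-Real.sin θ * pX F.R₀ F.logU R x)
      = -(x * pX F.R₀ F.logU R x) := by field_simp
  rw [hcot] at e
  have hR0 := hR.1.ne'
  have e1 : (-Real.sin θ * pX F.R₀ F.omega R x) ^ 2 / R ^ 2
      = (1 - x ^ 2) * (pX F.R₀ F.omega R x / R) ^ 2 := by rw [← hs2]; ring
  have e2 : (-Real.sin θ * pX F.R₀ F.Phi R x - F.A R x * (-Real.sin θ * pX F.R₀ F.omega R x)) ^ 2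
      / R ^ 2 = (1 - x ^ 2)
        * (pX F.R₀ F.Phi R x / R - F.A R x * (pX F.R₀ F.omega R x / R)) ^ 2 := by
    rw [← hs2]; ring
  have e3 : (-Real.sin θ * pX F.R₀ F.A R x) ^ 2 = (1 - x ^ 2) * pX F.R₀ F.A R x ^ 2 := by
    rw [← hs2]; ring
  rw [e1, e2, e3] at e
  linear_combination e

theorem field_eq_omega :
    R * (pR F.R₀ (pR F.R₀ F.omega) R x + 4 * pR F.R₀ F.omega R x * pR F.R₀ F.logU R x)
      + (1 - x ^ 2) * (pX F.R₀ (pX F.R₀ F.omega) R x / R) - 4 * x * (pX F.R₀ F.omega R x / R)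
      + 4 * (1 - x ^ 2) * (pX F.R₀ F.omega R x / R) * pX F.R₀ F.logU R x
    = 4 / (F.uHat R x * (1 - x ^ 2))
      * (R * pR F.R₀ F.A R x * (pR F.R₀ F.Phi R x - F.A R x * pR F.R₀ F.omega R x)
        + (1 - x ^ 2) * pX F.R₀ F.A R x
          * (pX F.R₀ F.Phi R x / R - F.A R x * (pX F.R₀ F.omega R x / R))) := by
  obtain ⟨θ, hθ, hc, hs, hs2⟩ := exists_cos_eq hx
  have hR' := Ioo_subset_Ico_self hR
  have e := (h.field_eqs R hR θ hθ).eq3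
  rw [uTilde_eq, h.stripSmooth_logU.dR_polar hR, h.stripSmooth_logU.dTheta_polar hR' hθ,
    h.stripSmooth_omega.dR_dR_polar hR, h.stripSmooth_omega.dTheta_dTheta_polar hR' hθ,
    h.stripSmooth_omega.dR_polar hR, h.stripSmooth_omega.dTheta_polar hR' hθ,
    h.stripSmooth_A.dR_polar hR, h.stripSmooth_A.dTheta_polar hR' hθ, eR, eTheta,
    h.stripSmooth_omega.dR_polar hR, h.stripSmooth_omega.dTheta_polar hR' hθ,
    h.stripSmooth_Phi.dR_polar hR, h.stripSmooth_Phi.dTheta_polar hR' hθ,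
    Real.cot_eq_cos_div_sin, hs2] at e
  simp only [polar, hc] at e
  have hR0 := hR.1.ne'
  have e1 : -Real.sin θ * pX F.R₀ F.omega R x
      * (3 * (x / Real.sin θ) + 4 * (-Real.sin θ * pX F.R₀ F.logU R x))
      = -3 * x * pX F.R₀ F.omega R x
        + 4 * (1 - x ^ 2) * pX F.R₀ F.omega R x * pX F.R₀ F.logU R x := by
    rw [← hs2]; field_simp; ring
  have e2 : -Real.sin θ * pX F.R₀ F.A R x * (-Real.sin θ * pX F.R₀ F.Phi R x
      - F.A R x * (-Real.sin θ * pX F.R₀ F.omega R x))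
      = (1 - x ^ 2) * pX F.R₀ F.A R x * (pX F.R₀ F.Phi R x - F.A R x * pX F.R₀ F.omega R x) := by
    rw [← hs2]; ring
  rw [e1, e2] at e
  have hsne : 1 - x ^ 2 ≠ 0 := by rw [← hs2]; positivity
  have hu := (h.uHat_pos R hR' x (Ioo_subset_Icc_self hx)).ne'
  field_simp at e ⊢
  linear_combination e

theorem field_eq_Phi :
    R * (pR F.R₀ (pR F.R₀ F.Phi) R x - F.A R x * pR F.R₀ (pR F.R₀ F.omega) R x
        + 2 * pR F.R₀ F.logU R x * (pR F.R₀ F.Phi R x - F.A R x * pR F.R₀ F.omega R x)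
        - pR F.R₀ F.A R x * pR F.R₀ F.omega R x)
      + (1 - x ^ 2) * (pX F.R₀ (pX F.R₀ F.Phi) R x / R
        - F.A R x * (pX F.R₀ (pX F.R₀ F.omega) R x / R))
      + (2 * (1 - x ^ 2) * pX F.R₀ F.logU R x - 2 * x)
        * (pX F.R₀ F.Phi R x / R - F.A R x * (pX F.R₀ F.omega R x / R))
      - (1 - x ^ 2) * pX F.R₀ F.A R x * (pX F.R₀ F.omega R x / R) = 0 := by
  obtain ⟨θ, hθ, hc, hs, hs2⟩ := exists_cos_eq hx
  have hR' := Ioo_subset_Ico_self hR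
  have e := (h.field_eqs R hR θ hθ).eq4
  rw [uTilde_eq, h.stripSmooth_logU.dR_polar hR, h.stripSmooth_logU.dTheta_polar hR' hθ,
    h.stripSmooth_omega.dR_dR_polar hR, h.stripSmooth_omega.dTheta_dTheta_polar hR' hθ,
    h.stripSmooth_Phi.dR_dR_polar hR, h.stripSmooth_Phi.dTheta_dTheta_polar hR' hθ,
    h.stripSmooth_omega.dR_polar hR, h.stripSmooth_omega.dTheta_polar hR' hθ,
    h.stripSmooth_A.dR_polar hR, h.stripSmooth_A.dTheta_polar hR' hθ, eR, eTheta,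
    h.stripSmooth_omega.dR_polar hR, h.stripSmooth_omega.dTheta_polar hR' hθ,
    h.stripSmooth_Phi.dR_polar hR, h.stripSmooth_Phi.dTheta_polar hR' hθ,
    Real.cot_eq_cos_div_sin, hs2] at e
  simp only [polar, hc] at e
  have hR0 := hR.1.ne'
  have e1 : (2 * (-Real.sin θ * pX F.R₀ F.logU R x) + x / Real.sin θ)
      * (-Real.sin θ * pX F.R₀ F.Phi R x - F.A R x * (-Real.sin θ * pX F.R₀ F.omega R x))
      = (2 * (1 - x ^ 2) * pX F.R₀ F.logU R x - x)
        * (pX F.R₀ F.Phi R x - F.A R x * pX F.R₀ F.omega R x) := by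
    rw [← hs2]; field_simp; ring
  have e2 : -Real.sin θ * pX F.R₀ F.A R x * (-Real.sin θ * pX F.R₀ F.omega R x)
      = (1 - x ^ 2) * pX F.R₀ F.A R x * pX F.R₀ F.omega R x := by
    rw [← hs2]; ring
  rw [e1, e2] at e
  field_simp
  linear_combination e

theorem field_eq_A :
    R ^ 2 * (pR F.R₀ (pR F.R₀ F.A) R x - 2 * pR F.R₀ F.logU R x * pR F.R₀ F.A R x)
      + 2 * R * pR F.R₀ F.A R x + (1 - x ^ 2) * (pX F.R₀ (pX F.R₀ F.A) R x
        - 2 * pX F.R₀ F.logU R x * pX F.R₀ F.A R x)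
    = F.uHat R x ^ 2 / 4 * (1 - x ^ 2)
      * ((pR F.R₀ F.Phi R x - F.A R x * pR F.R₀ F.omega R x) * pR F.R₀ F.omega R x
        + (1 - x ^ 2) * (pX F.R₀ F.Phi R x / R - F.A R x * (pX F.R₀ F.omega R x / R))
          * (pX F.R₀ F.omega R x / R)) := by
  obtain ⟨θ, hθ, hc, hs, hs2⟩ := exists_cos_eq hx
  have hR' := Ioo_subset_Ico_self hR
  have e := (h.field_eqs R hR θ hθ).eq5
  rw [uTilde_eq, h.stripSmooth_logU.dR_polar hR, h.stripSmooth_logU.dTheta_polar hR' hθ,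
    h.stripSmooth_A.dR_dR_polar hR, h.stripSmooth_A.dTheta_dTheta_polar hR' hθ,
    h.stripSmooth_A.dR_polar hR, h.stripSmooth_A.dTheta_polar hR' hθ, eR, eTheta,
    h.stripSmooth_omega.dR_polar hR, h.stripSmooth_omega.dTheta_polar hR' hθ,
    h.stripSmooth_Phi.dR_polar hR, h.stripSmooth_Phi.dTheta_polar hR' hθ,
    Real.cot_eq_cos_div_sin, hs2] at e
  simp only [polar, hc] at e
  have hR0 := hR.1.ne'
  have e1 : (2 * (-Real.sin θ * pX F.R₀ F.logU R x) + x / Real.sin θ)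
      * (-Real.sin θ * pX F.R₀ F.A R x)
      = (2 * (1 - x ^ 2) * pX F.R₀ F.logU R x - x) * pX F.R₀ F.A R x := by
    rw [← hs2]; field_simp; ring
  have e2 : (-Real.sin θ * pX F.R₀ F.Phi R x - F.A R x * (-Real.sin θ * pX F.R₀ F.omega R x))
      / R ^ 2 * (-Real.sin θ * pX F.R₀ F.omega R x)
      = (1 - x ^ 2) * (pX F.R₀ F.Phi R x / R - F.A R x * (pX F.R₀ F.omega R x / R))
          * (pX F.R₀ F.omega R x / R) := by
    rw [← hs2]; field_simp; ring
  rw [e1, e2] at e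
  linear_combination e

end FieldEquations

end IsDegenerateBlackHole

end HorizonFields

/-! ### The limits of the field equations on the horizon. -/

namespace HorizonFields

namespace IsDegenerateBlackHole

variable {F : HorizonFields} (h : F.IsDegenerateBlackHole)

include h

/-- If `f` is constant on the horizon, the limits
of `f_{,x}/R` and `f_{,xx}/R` there are the `x`-derivatives of `f_{,R}`. -/
theorem tendsto_pX_div {f : ℝ → ℝ → ℝ} (hf : StripSmooth F.R₀ f)
    (hc : ∃ c, ∀ x ∈ Icc (-1 : ℝ) 1, f 0 x = c) {x : ℝ} (hx : x ∈ Icc (-1 : ℝ) 1) :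
    Tendsto (fun R => pX F.R₀ f R x / R) (𝓝[>] 0) (𝓝 (pX F.R₀ (pR F.R₀ f) 0 x)) ∧
      Tendsto (fun R => pX F.R₀ (pX F.R₀ f) R x / R) (𝓝[>] 0)
        (𝓝 (pX F.R₀ (pX F.R₀ (pR F.R₀ f)) 0 x)) := by
  obtain ⟨c, hc⟩ := hc
  have h0 := h.R₀_pos
  have m0 : (0 : ℝ) ∈ Ico 0 F.R₀ := ⟨le_rfl, h0⟩
  have hfx := hf.stripDeriv (0, 1)
  have z1 : ∀ y ∈ Icc (-1 : ℝ) 1, pX F.R₀ f 0 y = 0 := fun y hy => hf.pX_horizon_eq_zero h0 hc hy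
  have z2 := hfx.pX_horizon_eq_zero h0 z1 hx
  refine ⟨hf.pR_pX m0 hx ▸ hfx.tendsto_div_horizon h0 hx (z1 x hx), ?_⟩
  have e : pR F.R₀ (pX F.R₀ (pX F.R₀ f)) 0 x = pX F.R₀ (pX F.R₀ (pR F.R₀ f)) 0 x := by
    rw [hfx.pR_pX m0 hx]
    exact (hfx.stripDeriv (1, 0)).pX_horizon_congr ((hf.stripDeriv (1, 0)).stripDeriv (0, 1)) h0
      (fun y hy => hf.pR_pX m0 hy) hx
  exact e ▸ (hfx.stripDeriv (0, 1)).tendsto_div_horizon h0 hx z2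

theorem eventually_mem : ∀ᶠ R in 𝓝[>] (0 : ℝ), R ∈ Ioo 0 F.R₀ := Ioo_mem_nhdsGT h.R₀_pos

section Limits

variable {x : ℝ} (hx : x ∈ Ioo (-1 : ℝ) 1)

include hx

/-- In the limit `R → 0` all terms with a factor `R` drop out, and the quotients by `R` become
`x`-derivatives of `ω_{,R}` and `Φ_{,R}`. The same holds for the next three equations. -/
theorem horizon_eq_omega :
    (1 - x ^ 2) * pX F.R₀ (pX F.R₀ (pR F.R₀ F.omega)) 0 x
      - 4 * x * pX F.R₀ (pR F.R₀ F.omega) 0 x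
      + 4 * (1 - x ^ 2) * pX F.R₀ (pR F.R₀ F.omega) 0 x * pX F.R₀ F.logU 0 x
    = 4 / F.uHat 0 x * pX F.R₀ F.A 0 x
      * (pX F.R₀ (pR F.R₀ F.Phi) 0 x - F.A 0 x * pX F.R₀ (pR F.R₀ F.omega) 0 x) := by
  have h0 := h.R₀_pos
  have hx' := Ioo_subset_Icc_self hx
  have L : ∀ {f : ℝ → ℝ → ℝ}, StripSmooth F.R₀ f → _ := fun hf => hf.tendsto_horizon h0 hx'
  have tR : Tendsto (fun R : ℝ => R) (𝓝[>] 0) (𝓝 0) := tendsto_id.mono_left nhdsWithin_le_nhds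
  obtain ⟨w1, w2⟩ := h.tendsto_pX_div h.stripSmooth_omega h.omega_const hx'
  obtain ⟨p1, -⟩ := h.tendsto_pX_div h.stripSmooth_Phi h.Phi_const hx'
  have sω := h.stripSmooth_omega
  have sΦ := h.stripSmooth_Phi
  have sA := h.stripSmooth_A
  have sv := h.stripSmooth_logU
  have su := h.stripSmooth_uHat
  have hu := (h.uHat_pos 0 ⟨le_rfl, h0⟩ x hx').ne'
  have h1 : 1 - x ^ 2 ≠ 0 := by nlinarith [hx.1, hx.2]
  have lhs := (((tR.mul ((L ((sω.stripDeriv (1, 0)).stripDeriv (1, 0))).add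
    (((L (sω.stripDeriv (1, 0))).const_mul 4).mul (L (sv.stripDeriv (1, 0)))))).add
    (w2.const_mul (1 - x ^ 2))).sub (w1.const_mul (4 * x))).add
    ((w1.const_mul (4 * (1 - x ^ 2))).mul (L (sv.stripDeriv (0, 1))))
  have rhs := ((tendsto_const_nhds (x := (4 : ℝ))).div ((L su).mul_const (1 - x ^ 2))
    (mul_ne_zero hu h1)).mul
    (((tR.mul (L (sA.stripDeriv (1, 0)))).mul ((L (sΦ.stripDeriv (1, 0))).sub
      ((L sA).mul (L (sω.stripDeriv (1, 0)))))).add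
    (((L (sA.stripDeriv (0, 1))).const_mul (1 - x ^ 2)).mul (p1.sub ((L sA).mul w1))))
  have key := tendsto_nhds_unique (lhs.congr' ?_) rhs
  · have e : 4 / (F.uHat 0 x * (1 - x ^ 2)) * (1 - x ^ 2) = 4 / F.uHat 0 x := by field_simp
    rw [← e]
    linear_combination key
  · filter_upwards [h.eventually_mem] with R hR
    exact h.field_eq_omega hR hx

theorem horizon_eq_Phi :
    (1 - x ^ 2) * (pX F.R₀ (pX F.R₀ (pR F.R₀ F.Phi)) 0 x
        - F.A 0 x * pX F.R₀ (pX F.R₀ (pR F.R₀ F.omega)) 0 x)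
      + (2 * (1 - x ^ 2) * pX F.R₀ F.logU 0 x - 2 * x)
        * (pX F.R₀ (pR F.R₀ F.Phi) 0 x - F.A 0 x * pX F.R₀ (pR F.R₀ F.omega) 0 x)
      - (1 - x ^ 2) * pX F.R₀ F.A 0 x * pX F.R₀ (pR F.R₀ F.omega) 0 x = 0 := by
  have h0 := h.R₀_pos
  have hx' := Ioo_subset_Icc_self hx
  have L : ∀ {f : ℝ → ℝ → ℝ}, StripSmooth F.R₀ f → _ := fun hf => hf.tendsto_horizon h0 hx'
  have tR : Tendsto (fun R : ℝ => R) (𝓝[>] 0) (𝓝 0) := tendsto_id.mono_left nhdsWithin_le_nhds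
  obtain ⟨w1, w2⟩ := h.tendsto_pX_div h.stripSmooth_omega h.omega_const hx'
  obtain ⟨p1, p2⟩ := h.tendsto_pX_div h.stripSmooth_Phi h.Phi_const hx'
  have sω := h.stripSmooth_omega
  have sΦ := h.stripSmooth_Phi
  have sA := h.stripSmooth_A
  have sv := h.stripSmooth_logU
  have lhs := (((tR.mul ((((L ((sΦ.stripDeriv (1, 0)).stripDeriv (1, 0))).sub
    ((L sA).mul (L ((sω.stripDeriv (1, 0)).stripDeriv (1, 0))))).add
    (((L (sv.stripDeriv (1, 0))).const_mul 2).mul ((L (sΦ.stripDeriv (1, 0))).sub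
      ((L sA).mul (L (sω.stripDeriv (1, 0))))))).sub
    ((L (sA.stripDeriv (1, 0))).mul (L (sω.stripDeriv (1, 0)))))).add
    ((p2.sub ((L sA).mul w2)).const_mul (1 - x ^ 2))).add
    ((((L (sv.stripDeriv (0, 1))).const_mul (2 * (1 - x ^ 2))).sub_const (2 * x)).mul
      (p1.sub ((L sA).mul w1)))).sub
    (((L (sA.stripDeriv (0, 1))).const_mul (1 - x ^ 2)).mul w1)
  have key := tendsto_nhds_unique (lhs.congr' ?_) (tendsto_const_nhds (x := (0 : ℝ)))
  · linear_combination key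
  · filter_upwards [h.eventually_mem] with R hR
    exact h.field_eq_Phi hR hx

theorem horizon_eq_A :
    (1 - x ^ 2) * (pX F.R₀ (pX F.R₀ F.A) 0 x - 2 * pX F.R₀ F.logU 0 x * pX F.R₀ F.A 0 x)
    = F.uHat 0 x ^ 2 / 4 * (1 - x ^ 2)
      * ((pR F.R₀ F.Phi 0 x - F.A 0 x * pR F.R₀ F.omega 0 x) * pR F.R₀ F.omega 0 x
        + (1 - x ^ 2) * (pX F.R₀ (pR F.R₀ F.Phi) 0 x - F.A 0 x * pX F.R₀ (pR F.R₀ F.omega) 0 x)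
          * pX F.R₀ (pR F.R₀ F.omega) 0 x) := by
  have h0 := h.R₀_pos
  have hx' := Ioo_subset_Icc_self hx
  have L : ∀ {f : ℝ → ℝ → ℝ}, StripSmooth F.R₀ f → _ := fun hf => hf.tendsto_horizon h0 hx'
  have tR : Tendsto (fun R : ℝ => R) (𝓝[>] 0) (𝓝 0) := tendsto_id.mono_left nhdsWithin_le_nhds
  obtain ⟨w1, -⟩ := h.tendsto_pX_div h.stripSmooth_omega h.omega_const hx'
  obtain ⟨p1, -⟩ := h.tendsto_pX_div h.stripSmooth_Phi h.Phi_const hx'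
  have sω := h.stripSmooth_omega
  have sΦ := h.stripSmooth_Phi
  have sA := h.stripSmooth_A
  have sv := h.stripSmooth_logU
  have su := h.stripSmooth_uHat
  have E := (L (sΦ.stripDeriv (1, 0))).sub ((L sA).mul (L (sω.stripDeriv (1, 0))))
  have lhs := (((tR.pow 2).mul ((L ((sA.stripDeriv (1, 0)).stripDeriv (1, 0))).sub
    (((L (sv.stripDeriv (1, 0))).const_mul 2).mul (L (sA.stripDeriv (1, 0)))))).add
    ((tR.const_mul 2).mul (L (sA.stripDeriv (1, 0))))).add
    (((L ((sA.stripDeriv (0, 1)).stripDeriv (0, 1))).sub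
      (((L (sv.stripDeriv (0, 1))).const_mul 2).mul (L (sA.stripDeriv (0, 1))))).const_mul
        (1 - x ^ 2))
  have rhs := ((((L su).pow 2).div_const 4).mul_const (1 - x ^ 2)).mul
    ((E.mul (L (sω.stripDeriv (1, 0)))).add
      (((p1.sub ((L sA).mul w1)).const_mul (1 - x ^ 2)).mul w1))
  have key := tendsto_nhds_unique (lhs.congr' ?_) rhs
  · linear_combination key
  · filter_upwards [h.eventually_mem] with R hR
    exact h.field_eq_A hR hx

theorem horizon_eq_u :
    (1 - x ^ 2) * pX F.R₀ (pX F.R₀ F.logU) 0 x - 2 * x * pX F.R₀ F.logU 0 x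
    = 1 - F.uHat 0 x ^ 2 / 8 * (1 - x ^ 2)
        * (pR F.R₀ F.omega 0 x ^ 2 + (1 - x ^ 2) * pX F.R₀ (pR F.R₀ F.omega) 0 x ^ 2)
      - pX F.R₀ F.A 0 x ^ 2 / F.uHat 0 x
      - F.uHat 0 x / 4 * ((pR F.R₀ F.Phi 0 x - F.A 0 x * pR F.R₀ F.omega 0 x) ^ 2
        + (1 - x ^ 2) * (pX F.R₀ (pR F.R₀ F.Phi) 0 x
          - F.A 0 x * pX F.R₀ (pR F.R₀ F.omega) 0 x) ^ 2) := by
  have h0 := h.R₀_pos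
  have hx' := Ioo_subset_Icc_self hx
  have L : ∀ {f : ℝ → ℝ → ℝ}, StripSmooth F.R₀ f → _ := fun hf => hf.tendsto_horizon h0 hx'
  have tR : Tendsto (fun R : ℝ => R) (𝓝[>] 0) (𝓝 0) := tendsto_id.mono_left nhdsWithin_le_nhds
  obtain ⟨w1, -⟩ := h.tendsto_pX_div h.stripSmooth_omega h.omega_const hx'
  obtain ⟨p1, -⟩ := h.tendsto_pX_div h.stripSmooth_Phi h.Phi_const hx'
  have sω := h.stripSmooth_omega
  have sΦ := h.stripSmooth_Phi
  have sA := h.stripSmooth_A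
  have sv := h.stripSmooth_logU
  have su := h.stripSmooth_uHat
  have hu := (h.uHat_pos 0 ⟨le_rfl, h0⟩ x hx').ne'
  have h1 : 1 - x ^ 2 ≠ 0 := by nlinarith [hx.1, hx.2]
  have E := (L (sΦ.stripDeriv (1, 0))).sub ((L sA).mul (L (sω.stripDeriv (1, 0))))
  have lhs := ((((tR.pow 2).mul (L ((sv.stripDeriv (1, 0)).stripDeriv (1, 0)))).add
    ((tR.const_mul 2).mul (L (sv.stripDeriv (1, 0))))).add
    ((L ((sv.stripDeriv (0, 1)).stripDeriv (0, 1))).const_mul (1 - x ^ 2))).sub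
    ((L (sv.stripDeriv (0, 1))).const_mul (2 * x))
  have rhs := ((((((L su).pow 2).div_const 8).mul_const (1 - x ^ 2)).mul
      (((L (sω.stripDeriv (1, 0))).pow 2).add ((w1.pow 2).const_mul (1 - x ^ 2)))).const_sub 1
    |>.sub (((tendsto_const_nhds (x := (1 : ℝ))).div ((L su).mul_const (1 - x ^ 2))
      (mul_ne_zero hu h1)).mul (((tR.pow 2).mul ((L (sA.stripDeriv (1, 0))).pow 2)).add
        (((L (sA.stripDeriv (0, 1))).pow 2).const_mul (1 - x ^ 2))))).sub
    (((L su).div_const 4).mul ((E.pow 2).add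
      (((p1.sub ((L sA).mul w1)).pow 2).const_mul (1 - x ^ 2))))
  have key := tendsto_nhds_unique (lhs.congr' ?_) rhs
  · have e : 1 / (F.uHat 0 x * (1 - x ^ 2)) * ((1 - x ^ 2) * pX F.R₀ F.A 0 x ^ 2)
        = pX F.R₀ F.A 0 x ^ 2 / F.uHat 0 x := by field_simp
    rw [← e]
    linear_combination key
  · filter_upwards [h.eventually_mem] with R hR
    exact h.field_eq_u hR hx

end Limits

end IsDegenerateBlackHole

end HorizonFields

/-! ### Rigidity of the horizon and reduction to the Euler-Lagrange equations. -/

theorem StripSmooth.deriv_horizon {R₀ : ℝ} {f : ℝ → ℝ → ℝ} (hf : StripSmooth R₀ f) (h0 : 0 < R₀)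
    {x : ℝ} (hx : x ∈ Ioo (-1 : ℝ) 1) :
    deriv (f 0) x = pX R₀ f 0 x ∧ deriv (deriv (f 0)) x = pX R₀ (pX R₀ f) 0 x := by
  have m0 : (0 : ℝ) ∈ Ico 0 R₀ := ⟨le_rfl, h0⟩
  refine ⟨(hf.hasDerivAt_pX m0 hx).deriv, ?_⟩
  have e : deriv (f 0) =ᶠ[𝓝 x] fun y => pX R₀ f 0 y := by
    filter_upwards [isOpen_Ioo.mem_nhds hx] with y hy
    exact (hf.hasDerivAt_pX m0 hy).deriv
  exact e.deriv_eq.trans ((hf.stripDeriv (0, 1)).hasDerivAt_pX m0 hx).deriv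

namespace HorizonFields

namespace IsDegenerateBlackHole

variable {F : HorizonFields} (h : F.IsDegenerateBlackHole)

include h

theorem uHat_horizon {x : ℝ} (hx : x ∈ Icc (-1 : ℝ) 1) :
    F.uHat 0 x = F.uN * Real.exp (2 * F.logU 0 x) := by
  have h1 := h.uHat_pos 0 ⟨le_rfl, h.R₀_pos⟩ x hx
  have h2 := h.uN_pos
  rw [logU, show 2 * (1 / 2 * Real.log (F.uHat 0 x / F.uN)) = Real.log (F.uHat 0 x / F.uN) by ring,
    Real.exp_log (div_pos h1 h2)]
  field_simp

/-- The `R`-derivatives of `ω` and `Φ` are constant on the horizon. -/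
theorem horizon_rigidity : ∀ x ∈ Ioo (-1 : ℝ) 1,
    pX F.R₀ (pR F.R₀ F.omega) 0 x = 0 ∧ pX F.R₀ (pR F.R₀ F.Phi) 0 x = 0 := by
  have h0 := h.R₀_pos
  have m0 : (0 : ℝ) ∈ Ico 0 F.R₀ := ⟨le_rfl, h0⟩
  have h11 : (-1 : ℝ) < 1 := by norm_num
  have sω : StripSmooth F.R₀ (pR F.R₀ F.omega) := h.stripSmooth_omega.stripDeriv (1, 0)
  have sΦ : StripSmooth F.R₀ (pR F.R₀ F.Phi) := h.stripSmooth_Phi.stripDeriv (1, 0)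
  have sA := h.stripSmooth_A
  have sv := h.stripSmooth_logU
  have d1 : ∀ x : ℝ, HasDerivAt (fun x : ℝ => 1 - x ^ 2) (-(2 * x)) x := fun x => by
    simpa using ((hasDerivAt_id x).fun_pow 2).const_sub 1
  have cW := ((sω.stripDeriv (0, 1)).contDiffOn_horizon h0).continuousOn
  have cP := ((sΦ.stripDeriv (0, 1)).contDiffOn_horizon h0).continuousOn
  have cA := (sA.contDiffOn_horizon h0).continuousOn
  have cv := (sv.contDiffOn_horizon h0).continuousOn
  have hpos : ∀ x ∈ Ioo (-1 : ℝ) 1, 1 - x ^ 2 ≠ 0 := fun x hx => by nlinarith [hx.1, hx.2]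
  -- The equation for `Φ` says that `(1-x²)e^{2U}(Φ_{,Rx} - A_φ ω_{,Rx})` is constant, and at `x =
  -- -1` it vanishes.
  have G : ∀ x ∈ Ioo (-1 : ℝ) 1, pX F.R₀ (pR F.R₀ F.Phi) 0 x
      - F.A 0 x * pX F.R₀ (pR F.R₀ F.omega) 0 x = 0 := by
    intro x hx
    have key := eq_left_of_hasDerivAt_zero (f := fun x => (1 - x ^ 2) * Real.exp (2 * F.logU 0 x)
      * (pX F.R₀ (pR F.R₀ F.Phi) 0 x - F.A 0 x * pX F.R₀ (pR F.R₀ F.omega) 0 x)) h11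
      (by fun_prop) (fun x hx => ?_) x (Ioo_subset_Icc_self hx)
    · simp only [neg_sq, one_pow, sub_self, zero_mul] at key
      exact (mul_eq_zero.1 key).resolve_left (mul_ne_zero (hpos x hx) (Real.exp_pos _).ne')
    · refine (((d1 x).fun_mul (((sv.hasDerivAt_pX m0 hx).const_mul 2).exp)).fun_mul
        (((sΦ.stripDeriv (0, 1)).hasDerivAt_pX m0 hx).fun_sub
          ((sA.hasDerivAt_pX m0 hx).fun_mul
            ((sω.stripDeriv (0, 1)).hasDerivAt_pX m0 hx)))).congr_deriv ?_
      linear_combination Real.exp (2 * F.logU 0 x) * h.horizon_eq_Phi hx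
  -- By `G` the equation for `ω` loses its source, so `(1-x²)²e^{4U}ω_{,Rx}` is constant and again
  -- zero at `x = -1`.
  have W : ∀ x ∈ Ioo (-1 : ℝ) 1, pX F.R₀ (pR F.R₀ F.omega) 0 x = 0 := by
    intro x hx
    have key := eq_left_of_hasDerivAt_zero (f := fun x => (1 - x ^ 2) ^ 2
      * Real.exp (4 * F.logU 0 x) * pX F.R₀ (pR F.R₀ F.omega) 0 x) h11
      (by fun_prop) (fun x hx => ?_) x (Ioo_subset_Icc_self hx)
    · simp only [neg_sq, one_pow, sub_self, zero_mul, zero_pow two_ne_zero] at key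
      exact (mul_eq_zero.1 key).resolve_left
        (mul_ne_zero (pow_ne_zero 2 (hpos x hx)) (Real.exp_pos _).ne')
    · refine ((((d1 x).fun_pow 2).fun_mul (((sv.hasDerivAt_pX m0 hx).const_mul 4).exp)).fun_mul
        ((sω.stripDeriv (0, 1)).hasDerivAt_pX m0 hx)).congr_deriv ?_
      have e := h.horizon_eq_omega hx
      rw [G x hx, mul_zero] at e
      push_cast
      linear_combination (1 - x ^ 2) * Real.exp (4 * F.logU 0 x) * e
  refine fun x hx => ⟨W x hx, ?_⟩
  have := G x hx
  rw [W x hx, mul_zero, sub_zero] at this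
  exact this

/-- After the rigidity result only the constants `ω₁ = ω_{,R}` and `Φ₁ = Φ_{,R}` remain in the
horizon equations. They play the role of the multipliers `λ₂` and `λ₃`. -/
theorem isSmoothELSolution :
    ∃ l₁ l₂ l₃ : ℝ, l₁ = -(1 / 8) * l₂ ^ 2 ∧ IsSmoothELSolution l₁ l₂ l₃ F.potS F.potT F.potU := by
  have h0 := h.R₀_pos
  have m0 : (0 : ℝ) ∈ Ico 0 F.R₀ := ⟨le_rfl, h0⟩
  have h11 : (-1 : ℝ) < 1 := by norm_num
  have sω : StripSmooth F.R₀ (pR F.R₀ F.omega) := h.stripSmooth_omega.stripDeriv (1, 0)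
  have sΦ : StripSmooth F.R₀ (pR F.R₀ F.Phi) := h.stripSmooth_Phi.stripDeriv (1, 0)
  have sA := h.stripSmooth_A
  have sv := h.stripSmooth_logU
  have const : ∀ {f : ℝ → ℝ → ℝ}, StripSmooth F.R₀ f →
      (∀ x ∈ Ioo (-1 : ℝ) 1, pX F.R₀ f 0 x = 0) → ∃ c, ∀ x ∈ Icc (-1 : ℝ) 1, f 0 x = c :=
    fun hf hz => ⟨_, eq_left_of_hasDerivAt_zero h11 (hf.contDiffOn_horizon h0).continuousOn
      fun x hx => (hf.hasDerivAt_pX m0 hx).congr_deriv (hz x hx)⟩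
  obtain ⟨ω₁, hω⟩ : ∃ c, ∀ x ∈ Icc (-1 : ℝ) 1, pR F.R₀ F.omega 0 x = c := const sω fun x hx => (h.horizon_rigidity x hx).1
  obtain ⟨Φ₁, hΦ⟩ : ∃ c, ∀ x ∈ Icc (-1 : ℝ) 1, pR F.R₀ F.Phi 0 x = c := const sΦ fun x hx => (h.horizon_rigidity x hx).2
  have hn := h.uN_pos
  obtain ⟨r, hr, hr2⟩ : ∃ r, 0 < r ∧ F.uN = r ^ 2 :=
    ⟨Real.sqrt F.uN, Real.sqrt_pos.2 hn, (Real.sq_sqrt hn.le).symm⟩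
  have hrs : Real.sqrt F.uN = r := by rw [hr2, Real.sqrt_sq hr.le]
  have eT : F.potT = fun x => F.A 0 x / r := by funext x; rw [potT, hrs]
  have eU : F.potU = F.logU 0 := rfl
  have eS : ∀ x ∈ Icc (-1 : ℝ) 1,
      F.potS x = r / 2 * Real.exp (2 * F.logU 0 x) * (Φ₁ - F.A 0 x * ω₁) := by
    intro x hx
    rw [potS, hrs, h.stripSmooth_Phi.horizonDeriv_eq h0 hx,
      h.stripSmooth_omega.horizonDeriv_eq h0 hx, hω x hx, hΦ x hx, h.uHat_horizon hx, hr2]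
    field_simp
  have dT : ∀ x ∈ Ioo (-1 : ℝ) 1, deriv F.potT x = pX F.R₀ F.A 0 x / r ∧
      deriv (deriv F.potT) x = pX F.R₀ (pX F.R₀ F.A) 0 x / r := by
    intro x hx
    have e : deriv F.potT = fun y => deriv (F.A 0) y / r := by
      funext y; rw [eT, deriv_div_const]
    rw [e, deriv_div_const, (sA.deriv_horizon h0 hx).2, ← (sA.deriv_horizon h0 hx).1]
    exact ⟨rfl, rfl⟩
  have cA := sA.contDiffOn_horizon h0
  have cv := sv.contDiffOn_horizon h0
  -- Read off from `S = (r/2)e^{2U}(Φ₁ - A_φ ω₁)` with `A_φ = rT`, where `r² = û_N`; the value of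
  -- `λ₁` is the coefficient of `ω₁²` in the equation for `û`.
  refine ⟨-(1 / 8) * (r ^ 2 * ω₁ / 2) ^ 2, r ^ 2 * ω₁ / 2, -(r * Φ₁ / 2), rfl, ?_, ?_, cv, ?_, ?_,
    ?_, ?_, ?_, ?_, ?_⟩
  · exact ((contDiffOn_const.mul (contDiffOn_const.mul cv).exp).mul
      (contDiffOn_const.sub (cA.mul contDiffOn_const))).congr eS
  · rw [eT]
    exact cA.div_const r
  · rw [eT]; simp only [h.A_south 0 m0, zero_div]
  · rw [eT]; simp only [h.A_north 0 m0, zero_div]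
  · obtain ⟨k, hk⟩ := h.muHat_uHat_const
    have e1 := hk 1 (by norm_num)
    have e2 := hk (-1) (by norm_num)
    rw [h.north] at e1
    rw [h.south] at e2
    have p1 := h.uHat_pos 0 m0 1 (by norm_num)
    have p2 := h.uHat_pos 0 m0 (-1) (by norm_num)
    -- At the poles `μ̂û = û²`, so constancy of `μ̂û` and positivity give equal values of `û`, that
    -- is `U(-1) = 0`.
    have e3 : F.uHat 0 (-1) = F.uHat 0 1 := by nlinarith
    rw [potU, e3, uN, div_self p1.ne', Real.log_one, mul_zero]
  · have p1 := h.uHat_pos 0 m0 1 (by norm_num)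
    rw [potU, uN, div_self p1.ne', Real.log_one, mul_zero]
  · intro x hx
    have hx' := Ioo_subset_Icc_self hx
    have e := h.horizon_eq_u hx
    obtain ⟨z1, z2⟩ := h.horizon_rigidity x hx
    rw [z1, z2, hω x hx', hΦ x hx', h.uHat_horizon hx', hr2] at e
    rw [(dT x hx).1, eU, (sv.deriv_horizon h0 hx).1, (sv.deriv_horizon h0 hx).2, eS x hx',
      exp_four_eq, exp_neg_two_eq]
    have hX := (Real.exp_pos (2 * F.logU 0 x)).ne'
    field_simp at e ⊢
    linear_combination e
  · intro x hx
    have hx' := Ioo_subset_Icc_self hx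
    have e := h.horizon_eq_A hx
    obtain ⟨z1, z2⟩ := h.horizon_rigidity x hx
    rw [z1, z2, hω x hx', hΦ x hx', h.uHat_horizon hx', hr2] at e
    rw [(dT x hx).1, (dT x hx).2, eU, (sv.deriv_horizon h0 hx).1, eS x hx']
    have h1 : 1 - x ^ 2 ≠ 0 := by nlinarith [hx.1, hx.2]
    have e' : pX F.R₀ (pX F.R₀ F.A) 0 x - 2 * pX F.R₀ F.logU 0 x * pX F.R₀ F.A 0 x
        = (r ^ 2 * Real.exp (2 * F.logU 0 x)) ^ 2 / 4 * ((Φ₁ - F.A 0 x * ω₁) * ω₁) := by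
      refine mul_left_cancel₀ h1 ?_
      linear_combination e
    field_simp
    linear_combination 4 * e'
  · intro x hx
    rw [eS x (Ioo_subset_Icc_self hx), eT, eU]
    field_simp
    ring

end IsDegenerateBlackHole

end HorizonFields

theorem family_of_areDegeneratePotentials {S T U : ℝ → ℝ} (h : AreDegeneratePotentials S T U) :
    ∃ g ∈ Icc (0 : ℝ) 1, ∃ σS ∈ ({1, -1} : Set ℝ), ∃ σT ∈ ({1, -1} : Set ℝ),
      ∀ x ∈ Icc (-1 : ℝ) 1, S x = famS g σS x ∧ T x = famT g σT x ∧ U x = famU g x := by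
  obtain ⟨F, hF, hpot⟩ := h
  obtain ⟨l₁, l₂, l₃, hl, hs⟩ := hF.isSmoothELSolution
  obtain ⟨g, hg, σS, hS, σT, hT, hfam⟩ := hs.family hl
  refine ⟨g, hg, σS, hS, σT, hT, fun x hx => ?_⟩
  obtain ⟨e1, e2, e3⟩ := hpot x hx
  rw [e1, e2, e3]
  exact hfam x hx

/-! ### The near-horizon geometries -/

/-- The near-horizon geometry with the horizon potentials of the family. -/
noncomputable def nearHorizonFields (g σS σT : ℝ) : HorizonFields where
  R₀ := 1
  muHat := fun _ x => famD g x / 2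
  uHat := fun _ x => 2 / famD g x
  omega := fun R _ => -2 * (σS * σT) * Real.sqrt (1 - g ^ 4) * R
  Phi := fun R _ => 2 * σS * g ^ 3 * R
  A := fun _ x => famT g σT x

theorem dR_const (f : ℝ → ℝ) : dR (fun _ θ => f θ) = fun _ _ => 0 := by
  funext R θ; exact deriv_const _ _

theorem dTheta_const (f : ℝ → ℝ) : dTheta (fun R _ => f R) = fun _ _ => 0 := by
  funext R θ; exact deriv_const _ _

theorem dR_linear (a : ℝ) : dR (fun R _ => a * R) = fun _ _ => a := by
  funext R θ
  exact ((hasDerivAt_id R).const_mul a).deriv.trans (mul_one a)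

theorem dTheta_cos {f f' : ℝ → ℝ} (h : ∀ x, HasDerivAt f (f' x) x) :
    dTheta (fun _ θ => f (Real.cos θ)) = fun _ θ => -Real.sin θ * f' (Real.cos θ) := by
  funext R θ
  exact ((h _).comp θ (Real.hasDerivAt_cos θ)).deriv.trans (mul_comm _ _)

theorem dTheta_sin_cos {f' f'' : ℝ → ℝ} (h : ∀ x, HasDerivAt f' (f'' x) x) :
    dTheta (fun _ θ => -Real.sin θ * f' (Real.cos θ))
      = fun _ θ => Real.sin θ ^ 2 * f'' (Real.cos θ) - Real.cos θ * f' (Real.cos θ) := by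
  funext R θ
  refine ((Real.hasDerivAt_sin θ).fun_neg.fun_mul
    ((h _).comp θ (Real.hasDerivAt_cos θ))).deriv.trans ?_
  simp only [Function.comp]
  ring

/-! ### The near-horizon fields solve the Einstein-Maxwell equations. -/

section

variable {g : ℝ} (hg : g ∈ Icc (0 : ℝ) 1) {σS σT : ℝ} (hS : σS ∈ ({1, -1} : Set ℝ))
  (hT : σT ∈ ({1, -1} : Set ℝ))

include hg

omit hg in
theorem uN_nearHorizonFields : (nearHorizonFields g σS σT).uN = 1 := by
  simp only [HorizonFields.uN, nearHorizonFields, famD]; norm_num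

omit hg in
theorem uTilde_nearHorizonFields :
    (nearHorizonFields g σS σT).uTilde = fun _ θ => famU g (Real.cos θ) := by
  funext R θ
  rw [HorizonFields.uTilde, uN_nearHorizonFields, div_one]
  simp only [polar, nearHorizonFields, famU]
  rw [← inv_div (famD g _) 2, Real.log_inv]
  ring

omit hg in
theorem muTilde_nearHorizonFields :
    (nearHorizonFields g σS σT).muTilde = fun _ θ => -famU g (Real.cos θ) := by
  funext R θ
  rw [HorizonFields.muTilde, uN_nearHorizonFields, div_one]
  simp only [polar, nearHorizonFields, famU]
  ring

/-- The equation for `U` that comes from the equation for `μ̂`. -/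
theorem fam_eqMu (x : ℝ) :
    -(1 - g ^ 2) * (1 + g ^ 2 - (1 - g ^ 2) * x ^ 2) / famD g x ^ 2 - famU' g x ^ 2
      = -(1 - g ^ 4) / famD g x ^ 2 := by
  have hD := famD_pos hg x
  rw [famU']
  field_simp
  ring

include hS hT

/-- `R` enters only through `ω` and `Φ`, which are linear in `R` and independent of `θ`. The
equations for `ω` and `Φ` are then trivial, and the others are `fam_eqU`, `fam_eqMu` and `fam_eqT`
at `x = cos θ`. -/
theorem einsteinMaxwellAt_nearHorizonFields {R θ : ℝ} (hθ : θ ∈ Ioo 0 Real.pi) :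
    (nearHorizonFields g σS σT).EinsteinMaxwellAt R θ := by
  have hs := (Real.sin_pos_of_pos_of_lt_pi hθ.1 hθ.2).ne'
  have hD := famD_pos hg (Real.cos θ)
  have hc := sq_sqrt_one_sub_pow_four hg
  have hσ := sq_of_sign hS
  have hσ' := sq_of_sign hT
  have eω : polar (nearHorizonFields g σS σT).omega
      = fun R _ => -2 * (σS * σT) * Real.sqrt (1 - g ^ 4) * R := rfl
  have eΦ : polar (nearHorizonFields g σS σT).Phi = fun R _ => 2 * σS * g ^ 3 * R := rfl
  have eA : polar (nearHorizonFields g σS σT).A = fun _ θ => famT g σT (Real.cos θ) := rfl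
  have eu : polar (nearHorizonFields g σS σT).uHat R θ = 2 / famD g (Real.cos θ) := rfl
  have eN : (fun (_ : ℝ) θ => -famU g (Real.cos θ))
      = fun (_ : ℝ) θ => (fun x => -famU g x) (Real.cos θ) := rfl
  have dU := dTheta_cos (hasDerivAt_famU hg)
  have ddU := dTheta_sin_cos (hasDerivAt_famU' hg)
  have dT := dTheta_cos (hasDerivAt_famT hg σT)
  have ddT := dTheta_sin_cos (hasDerivAt_famT' hg σT)
  have dN := dTheta_cos (f := fun x => -famU g x) fun x => (hasDerivAt_famU hg x).fun_neg
  have ddN := dTheta_sin_cos fun x => (hasDerivAt_famU' hg x).fun_neg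
  have eER : (nearHorizonFields g σS σT).eR R θ = famS g σS (Real.cos θ) * famD g (Real.cos θ) := by
    simp only [HorizonFields.eR, eω, eΦ, eA, dR_linear]
    rw [famS_eq hg hT]
    field_simp
    ring
  have eEθ : (nearHorizonFields g σS σT).eTheta R θ = 0 := by
    simp only [HorizonFields.eTheta, eω, eΦ, dTheta_const, mul_zero, sub_zero]
  have hs2 : Real.sin θ ^ 2 = 1 - Real.cos θ ^ 2 := Real.sin_sq θ
  have hcot : ∀ a : ℝ, Real.cot θ * (-Real.sin θ * a) = -Real.cos θ * a := by
    intro a; rw [Real.cot_eq_cos_div_sin]; field_simp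
  refine ⟨?_, ?_, ?_, ?_, ?_⟩
  · rw [uTilde_nearHorizonFields, dU, ddU, eER, eEθ, eω, eA, eu, dT]
    simp only [dR_const, dR_linear, dTheta_const, hcot]
    have e := fam_eqU hg hS hT (Real.cos θ)
    rw [← hs2] at e
    have e1 : (-2 * (σS * σT) * Real.sqrt (1 - g ^ 4)) ^ 2 = 4 * (1 - g ^ 4) := by
      rw [mul_pow, hc, mul_pow, mul_pow, hσ, hσ']; ring
    rw [e1]
    field_simp at e ⊢
    linear_combination (-32 * Real.sin θ ^ 2) * e
  · rw [uTilde_nearHorizonFields, muTilde_nearHorizonFields, eN, dU, dN, ddN, eω, eu]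
    simp only [dR_const, dR_linear, dTheta_const]
    have e := fam_eqMu hg (Real.cos θ)
    have e1 : (-2 * (σS * σT) * Real.sqrt (1 - g ^ 4)) ^ 2 = 4 * (1 - g ^ 4) := by
      rw [mul_pow, hc, mul_pow, mul_pow, hσ, hσ']; ring
    rw [e1]
    linear_combination (-Real.sin θ ^ 2) * e + hcot (famU' g (Real.cos θ))
  · rw [uTilde_nearHorizonFields, eEθ, eω, eA]
    simp only [dR_const, dR_linear, dTheta_const]
    ring
  · rw [uTilde_nearHorizonFields, eEθ, eω, eΦ, eA]
    simp only [dR_const, dR_linear, dTheta_const]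
    ring
  · rw [uTilde_nearHorizonFields, eER, eEθ, eω, eA, eu, dU, dT, ddT]
    simp only [dR_const, dR_linear, dTheta_const]
    have e := fam_eqT (σT := σT) hg hS (Real.cos θ)
    rw [add_mul _ (Real.cot θ), hcot]
    field_simp at e ⊢
    linear_combination (-4 * Real.sin θ ^ 2) * e

theorem isDegenerateBlackHole_nearHorizonFields :
    (nearHorizonFields g σS σT).IsDegenerateBlackHole where
  R₀_pos := one_pos
  smooth_muHat := ((contDiff_famD.comp contDiff_snd).div_const 2).contDiffOn
  smooth_uHat := ((contDiff_const.div contDiff_famD fun x => (famD_pos hg x).ne').comp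
    contDiff_snd).contDiffOn
  smooth_omega := (contDiff_const.mul contDiff_fst).contDiffOn
  smooth_Phi := (contDiff_const.mul contDiff_fst).contDiffOn
  smooth_A := ((contDiff_famT hg σT).comp contDiff_snd).contDiffOn
  muHat_pos := fun _ _ x _ => half_pos (famD_pos hg x)
  uHat_pos := fun _ _ x _ => div_pos two_pos (famD_pos hg x)
  field_eqs := fun _ _ _ hθ => einsteinMaxwellAt_nearHorizonFields hg hS hT hθ
  omega_const := ⟨0, fun x _ => by simp only [nearHorizonFields, mul_zero]⟩
  Phi_const := ⟨0, fun x _ => by simp only [nearHorizonFields, mul_zero]⟩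
  muHat_uHat_const := ⟨1, fun x _ => by
    have := (famD_pos hg x).ne'
    simp only [nearHorizonFields]
    field_simp⟩
  north := by simp only [nearHorizonFields, famD]; norm_num
  south := by simp only [nearHorizonFields, famD]; norm_num
  A_north := fun _ _ => famT_one σT
  A_south := fun _ _ => famT_neg_one σT

theorem areDegeneratePotentials_of_family {S T U : ℝ → ℝ}
    (h : ∀ x ∈ Icc (-1 : ℝ) 1, S x = famS g σS x ∧ T x = famT g σT x ∧ U x = famU g x) :
    AreDegeneratePotentials S T U := by
  refine ⟨nearHorizonFields g σS σT, isDegenerateBlackHole_nearHorizonFields hg hS hT,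
    fun x hx => ?_⟩
  obtain ⟨e1, e2, e3⟩ := h x hx
  have hlin : ∀ a : ℝ, derivWithin (fun R : ℝ => a * R) (Ici 0) 0 = a := fun a =>
    (((hasDerivAt_id (0 : ℝ)).const_mul a).hasDerivWithinAt.derivWithin
      (uniqueDiffOn_Ici 0 0 self_mem_Ici)).trans (mul_one a)
  have hD := famD_pos hg x
  refine ⟨?_, ?_, ?_⟩
  · rw [e1, HorizonFields.potS, uN_nearHorizonFields, Real.sqrt_one]
    simp only [HorizonFields.horizonDeriv, nearHorizonFields]
    rw [hlin, hlin, famS_eq hg hT]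
    field_simp
    ring
  · rw [e2, HorizonFields.potT, uN_nearHorizonFields, Real.sqrt_one, div_one]
    rfl
  · rw [e3, HorizonFields.potU, uN_nearHorizonFields, div_one]
    simp only [nearHorizonFields, famU]
    rw [← inv_div (famD g _) 2, Real.log_inv]
    ring

end

/-- The horizon potentials of degenerate black holes are the members of the family. -/
theorem areDegeneratePotentials_iff (S T U : ℝ → ℝ) :
    AreDegeneratePotentials S T U ↔
      ∃ γ ∈ Icc (-1 : ℝ) 0, ∃ σS ∈ ({1, -1} : Set ℝ), ∃ σT ∈ ({1, -1} : Set ℝ),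
        InFamilyOn γ σS σT S T U := by
  rw [exists_inFamilyOn_iff]
  refine ⟨family_of_areDegeneratePotentials, ?_⟩
  rintro ⟨g, hg, σS, hS, σT, hT, h⟩
  exact areDegeneratePotentials_of_family hg hS hT h

theorem AreDegeneratePotentials.even {S T U : ℝ → ℝ} (h : AreDegeneratePotentials S T U) :
    ∀ x ∈ Icc (-1 : ℝ) 1, S (-x) = S x ∧ T (-x) = T x ∧ U (-x) = U x := by
  obtain ⟨g, -, σS, -, σT, -, h⟩ := family_of_areDegeneratePotentials h
  intro x hx
  obtain ⟨e1, e2, e3⟩ := h x hx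
  obtain ⟨n1, n2, n3⟩ := h (-x) ⟨by linarith [hx.2], by linarith [hx.1]⟩
  have hD : famD g (-x) = famD g x := by rw [famD, famD, neg_sq]
  rw [e1, e2, e3, n1, n2, n3, famS, famT, famU, hD, neg_sq]
  exact ⟨rfl, rfl, rfl⟩

end DegenerateHorizon

theorem mainTheorem3 :
    -- the minimum of `I` on `X` is attained and equals `1`
    IsLeast {r : ℝ | ∃ S T U : ℝ → ℝ, DegenerateHorizon.MemX S T U ∧
      DegenerateHorizon.functionalI S T U = r} 1 ∧
    -- the minimizers are exactly the members of the family
    (∀ S T U : ℝ → ℝ,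
      (DegenerateHorizon.MemX S T U ∧ DegenerateHorizon.functionalI S T U = 1) ↔
        ∃ γ ∈ Set.Icc (-1 : ℝ) 0, ∃ σS ∈ ({1, -1} : Set ℝ), ∃ σT ∈ ({1, -1} : Set ℝ),
          DegenerateHorizon.InFamilyAE γ σS σT S T U) ∧
    -- the Lagrange multipliers
    (∀ γ ∈ Set.Icc (-1 : ℝ) 0, ∀ σS ∈ ({1, -1} : Set ℝ), ∀ σT ∈ ({1, -1} : Set ℝ),
      ∀ S T U : ℝ → ℝ, DegenerateHorizon.InFamilyAE γ σS σT S T U →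
        ∀ l₁ l₂ l₃ : ℝ, DegenerateHorizon.IsLagrangeMultiplier l₁ l₂ l₃ S T U ↔
          l₁ = -(1 / 8) * (1 - γ ^ 2) ∧
          (γ = 0 ∨ l₂ = -(σS * σT) * Real.sqrt (1 - γ ^ 2)) ∧
          l₃ = -σS * (-γ) ^ (3 / 2 : ℝ)) ∧
    -- the smooth solutions of the Euler-Lagrange equations with the relation between `λ₁`, `λ₂`
    -- that holds for degenerate horizons are exactly the members of the family
    (∀ S T U : ℝ → ℝ,
      (∃ l₁ l₂ l₃ : ℝ, l₁ = -(1 / 8) * l₂ ^ 2 ∧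
        DegenerateHorizon.IsSmoothELSolution l₁ l₂ l₃ S T U) ↔
        ∃ γ ∈ Set.Icc (-1 : ℝ) 0, ∃ σS ∈ ({1, -1} : Set ℝ), ∃ σT ∈ ({1, -1} : Set ℝ),
          DegenerateHorizon.InFamilyOn γ σS σT S T U) ∧
    -- the horizon potentials of degenerate black holes are exactly the members of the family
    (∀ S T U : ℝ → ℝ,
      DegenerateHorizon.AreDegeneratePotentials S T U ↔
        ∃ γ ∈ Set.Icc (-1 : ℝ) 0, ∃ σS ∈ ({1, -1} : Set ℝ), ∃ σT ∈ ({1, -1} : Set ℝ),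
          DegenerateHorizon.InFamilyOn γ σS σT S T U) ∧
    -- in particular, degenerate horizons are equatorially symmetric
    (∀ S T U : ℝ → ℝ, DegenerateHorizon.AreDegeneratePotentials S T U →
      ∀ x ∈ Set.Icc (-1 : ℝ) 1, S (-x) = S x ∧ T (-x) = T x ∧ U (-x) = U x) := by
  exact ⟨DegenerateHorizon.isLeast_functionalI,
    DegenerateHorizon.memX_and_functionalI_eq_one_iff,
    fun _ hγ _ hS _ hT _ _ _ h => DegenerateHorizon.lagrange_multipliers hγ hS hT h,
    DegenerateHorizon.exists_isSmoothELSolution_iff,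
    DegenerateHorizon.areDegeneratePotentials_iff,
    fun _ _ _ h => h.even⟩
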